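/- Let $d\ge 1$, $\beta\in(2,3)$, $\theta>0$, $a=\frac{1}{\theta(\beta-2)}$ and $b=a$. Let $g:\mathbb R\to\mathbb R$ be twice differentiable with $g(0)=0$, $0<\ell\le g'\le L$ and $|g''|\le L$ for some constants $\ell,L\in(0,\infty)$. Put $f(t,y)=\exp\{-g(y-bt)\}$, $f_y=\partial f/\partial y$, let $U$ be the solution of $\dot U(t)=af(t,U(t))$, $t\ge 0$, $U(0)=0$, and let $\Lambda(t)=\int_0^t f(s,U(s))\,ds$, $\gamma=\Lambda^{-1}$, $B(t)=[0,\Lambda(t)]\times[0,\infty)$. Let $\Sigma_1,\dots,\Sigma_d$ be independent Gaussian random measures on $[0,\infty)\times[0,\infty)$ with common control measure $ds\,(\beta-1)\theta^{1-\beta}r^{-\beta}\,dr$ (independently scattered, almost surely $\sigma$-additive, with $\Sigma_i(A)$ centred normal with variance equal to the control measure of $A$), and let $Z_1,\dots,Z_d$ be processes with continuous paths such that, for all $i$ and $t\ge 0$, almost surely $$Z_i(t)=\int_{B(t)} r\wedge(t-\gamma(s))\,\Sigma_i(ds,dr)+a\int_0^t f_y(s,U(s))\bar Z(s)\,ds,\qquad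 \bar Z=\frac1d\sum_{i=1}^d Z_i .$$ Let $\kappa=a\,g'(0)$, $H=\frac{4-\beta}{2}\in(\tfrac12,1)$ and $\sigma=\sqrt{\frac{2\theta^{1-\beta}}{d(\beta-2)(3-\beta)(4-\beta)}}$. Then $$\sigma_0^2=\frac{\theta^{1-\beta}}{d(\beta-2)}\int_0^\infty\!\!\int_0^\infty e^{-\kappa v}e^{-\kappa u}|u-v|^{2-\beta}\,du\,dv<\infty .$$ On some probability space there are a continuous standard fractional Brownian motion $B_H$ (a centred Gaussian process with covariance $\frac12(t^{2H}+s^{2H}-|t-s|^{2H})$) and a centred normal variable $Z_\infty(0)$ with variance $\sigma_0^2$, such that $(B_H,Z_\infty(0))$ is jointly Gaussian with $$\mathrm{cov}(B_H(t),Z_\infty(0))=\frac{\theta^{1-\beta}}{\sigma d(\beta-2)}\int_0^t\int_0^\infty e^{-\kappa v}(u+v)^{2-\beta}\,dv\,du,\qquad t\ge0 .$$ For every such pair $(B_H,Z_\infty(0))$, the equation $$Z_\infty(t)=Z_\infty(0)-\kappa\int_0^t Z_\infty(s)\,ds+\sigma B_H(t),\qquad t\ge 0,$$ has an almost surely unique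 solution $Z_\infty$ with continuous paths (the fractional Ornstein–Uhlenbeck process). As $T\to\infty$, $\bar Z(T+\cdot)$ converges in distribution to $Z_\infty$ in $C_{\mathbb R}[0,\infty)$ with the topology of locally uniform convergence. Moreover $Z_\infty$ is stationary: for every $h\ge0$, $Z_\infty(h+\cdot)$ and $Z_\infty$ have the same law. -/

import Mathlib

open MeasureTheory ProbabilityTheory Filter Set
open scoped NNReal ENNReal Topology

noncomputable section

/-! ### The path space `C_ℝ[0,∞)`

`C(ℝ≥0, ℝ)` carries the compact-open topology, that is, the topology of locally uniform
convergence; it is given its Borel σ-algebra. -/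

instance instMeasurableSpacePath : MeasurableSpace C(ℝ≥0, ℝ) := borel _

instance instBorelSpacePath : BorelSpace C(ℝ≥0, ℝ) := ⟨rfl⟩

/-- The shifted path `x(T + ·)`. -/
def shiftPath (T : ℝ≥0) (x : C(ℝ≥0, ℝ)) : C(ℝ≥0, ℝ) :=
  x.comp ⟨fun t => T + t, by fun_prop⟩

/-! ### Gaussian random measures and integrals with respect to them -/

/-- `M` is a Gaussian random measure on `E` with control measure `m`: it attaches to every
measurable set `A` of finite control measure a centred normal variable of variance `m A`,
it is independently scattered, and it is almost surely σ-additive along every sequence of disjoint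
sets whose union has finite control measure. (Values `M A` on other sets are irrelevant.) -/
structure IsGaussianRandomMeasure {Ω E : Type*} [MeasurableSpace Ω] [MeasurableSpace E]
    (P : Measure Ω) (m : Measure E) (M : Set E → Ω → ℝ) : Prop where
  measurable : ∀ A, MeasurableSet A → m A < ∞ → Measurable (M A)
  law : ∀ A, MeasurableSet A → m A < ∞ → P.map (M A) = gaussianReal 0 (m A).toNNReal
  indep : ∀ (n : ℕ) (A : Fin n → Set E), (∀ j, MeasurableSet (A j)) → (∀ j, m (A j) < ∞) →
    Pairwise (fun j k => Disjoint (A j) (A k)) → iIndepFun (fun j => M (A j)) P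
  sigma_additive : ∀ A : ℕ → Set E, (∀ j, MeasurableSet (A j)) →
    Pairwise (fun j k => Disjoint (A j) (A k)) → m (⋃ j, A j) < ∞ →
    ∀ᵐ ω ∂P, Tendsto (fun n => ∑ j ∈ Finset.range n, M (A j) ω) atTop (𝓝 (M (⋃ j, A j) ω))

/-- The integral `∑ c, c M(φ = c)` of a simple function `φ`. -/
def simpleGaussianIntegral {Ω E : Type*} [MeasurableSpace E]
    (M : Set E → Ω → ℝ) (φ : SimpleFunc E ℝ) (ω : Ω) : ℝ :=
  ∑ c ∈ φ.range, c * M (φ ⁻¹' {c}) ω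

/-- The random variable `I` is (a version of) the integral `∫ h dM`, where `h ∈ L²(m)`: it is the
`L²(P)`-limit of the integrals of simple functions of finite support that converge to `h` in
`L²(m)`. -/
structure IsGaussianIntegral {Ω E : Type*} [MeasurableSpace Ω] [MeasurableSpace E]
    (P : Measure Ω) (m : Measure E) (M : Set E → Ω → ℝ) (h : E → ℝ) (I : Ω → ℝ) : Prop where
  memLp : MemLp h 2 m
  aemeasurable : AEMeasurable I P
  approx : ∃ φ : ℕ → SimpleFunc E ℝ, (∀ n, (φ n).FinMeasSupp m) ∧
    Tendsto (fun n => eLpNorm (fun x => φ n x - h x) 2 m) atTop (𝓝 0) ∧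
    Tendsto (fun n => eLpNorm (fun ω => simpleGaussianIntegral M (φ n) ω - I ω) 2 P) atTop (𝓝 0)

/-! ### The workload model and its fluctuation limit -/

/-- The standing assumption on the admission control policy `g`. -/
structure IsAdmissionPolicy (g : ℝ → ℝ) : Prop where
  zero : g 0 = 0
  differentiable : Differentiable ℝ g
  differentiable_deriv : Differentiable ℝ (deriv g)
  bounds : ∃ l L : ℝ, 0 < l ∧ 0 < L ∧ (∀ x, l ≤ deriv g x) ∧ (∀ x, deriv g x ≤ L) ∧
    ∀ x, |deriv (deriv g) x| ≤ L

/-- The mean session length `a = 1 / (θ (β - 2))`. -/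
def meanSession (β θ : ℝ) : ℝ := 1 / (θ * (β - 2))

/-- The arrival intensity `f(t, y) = exp (-g (y - b t))`. -/
def intensity (g : ℝ → ℝ) (b t y : ℝ) : ℝ := Real.exp (-g (y - b * t))

/-- The partial derivative `f_y(t, y)`. -/
def intensityDy (g : ℝ → ℝ) (b t y : ℝ) : ℝ := deriv (fun x => intensity g b t x) y

/-- `U` solves the fluid equation `U' = a f(t, U)`, `U(0) = 0` on `[0, ∞)`. -/
def IsFluidLimit (β θ b : ℝ) (g U : ℝ → ℝ) : Prop :=
  U 0 = 0 ∧ ∀ t, 0 ≤ t →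
    HasDerivWithinAt U (meanSession β θ * intensity g b t (U t)) (Ici 0) t

/-- `Λ(t) = ∫₀ᵗ f(s, U(s)) ds`. -/
def cumIntensity (b : ℝ) (g U : ℝ → ℝ) (t : ℝ) : ℝ := ∫ s in (0 : ℝ)..t, intensity g b s (U s)

/-- `γ = Λ⁻¹`, the inverse of `Λ` on `[0, ∞)`. -/
def activationTime (b : ℝ) (g U : ℝ → ℝ) : ℝ → ℝ :=
  Function.invFunOn (cumIntensity b g U) (Ici 0)

/-- `B(t) = [0, Λ(t)] × [0, ∞)`. -/
def activeRegion (b : ℝ) (g U : ℝ → ℝ) (t : ℝ) : Set (ℝ × ℝ) :=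
  Icc 0 (cumIntensity b g U t) ×ˢ Ici 0

/-- The measure `ds (β - 1) θ^(1-β) r^(-β) dr` on `[0, ∞) × [0, ∞)`, seen as a measure on the plane
carried by the quadrant. -/
def controlMeasure (β θ : ℝ) : Measure (ℝ × ℝ) :=
  (volume.restrict (Ici (0 : ℝ))).prod
    ((volume.restrict (Ici (0 : ℝ))).withDensity
      fun r => ENNReal.ofReal ((β - 1) * θ ^ (1 - β) * r ^ (-β)))

/-- The station average `Z̄ = (1/d) ∑ Z_i`. -/
def stationAverage {Ω : Type*} {d : ℕ} (Z : Fin d → Ω → C(ℝ≥0, ℝ)) (ω : Ω) : C(ℝ≥0, ℝ) :=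
  (d : ℝ)⁻¹ • ∑ i, Z i ω

/-- The continuous processes `Z_1, …, Z_d` solve the limit equation
`Z_i(t) = ∫_{B(t)} r ∧ (t - γ(s)) M_i(ds, dr) + a ∫₀ᵗ f_y(s, U(s)) Z̄(s) ds`
driven by independent Gaussian random measures `M_1, …, M_d` with the above control measure. -/
structure IsFluctuationLimit {Ω : Type*} [MeasurableSpace Ω] (P : Measure Ω) {d : ℕ}
    (β θ b : ℝ) (g U : ℝ → ℝ) (M : Fin d → Set (ℝ × ℝ) → Ω → ℝ)
    (Z : Fin d → Ω → C(ℝ≥0, ℝ)) : Prop where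
  gaussian : ∀ i, IsGaussianRandomMeasure P (controlMeasure β θ) (M i)
  indep : iIndepFun (fun i ω =>
    fun A : {A : Set (ℝ × ℝ) // MeasurableSet A ∧ controlMeasure β θ A < ∞} => M i A.1 ω) P
  aemeasurable : ∀ i t, AEMeasurable (fun ω => Z i ω t) P
  equation : ∀ (i : Fin d) (t : ℝ≥0), ∃ R : Ω → ℝ,
    IsGaussianIntegral P (controlMeasure β θ) (M i)
      ((activeRegion b g U t).indicator fun p => min p.2 (t - activationTime b g U p.1)) R ∧
    ∀ᵐ ω ∂P, Z i ω t = R ω + meanSession β θ *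
      ∫ s in (0 : ℝ)..t, intensityDy g b s (U s) * stationAverage Z ω s.toNNReal

/-! ### The fractional Ornstein–Uhlenbeck process -/

/-- `κ = a g'(0)`. -/
def ouRate (β θ : ℝ) (g : ℝ → ℝ) : ℝ := meanSession β θ * deriv g 0

/-- `σ = √(2 θ^(1-β) / (d (β-2) (3-β) (4-β)))`. -/
def ouSigma (d : ℕ) (β θ : ℝ) : ℝ :=
  √(2 * θ ^ (1 - β) / (d * (β - 2) * (3 - β) * (4 - β)))

/-- The variance `σ₀²` of the initial value. -/
def ouInitVar (d : ℕ) (β θ κ : ℝ) : ℝ :=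
  θ ^ (1 - β) / (d * (β - 2)) *
    ∫ v in Ioi (0 : ℝ), ∫ u in Ioi (0 : ℝ),
      Real.exp (-κ * v) * Real.exp (-κ * u) * |u - v| ^ (2 - β)

/-- The covariance of `B_H(t)` and the initial value. -/
def ouCrossCov (d : ℕ) (β θ κ t : ℝ) : ℝ :=
  θ ^ (1 - β) / (ouSigma d β θ * d * (β - 2)) *
    ∫ u in (0 : ℝ)..t, ∫ v in Ioi (0 : ℝ), Real.exp (-κ * v) * (u + v) ^ (2 - β)

/-- `B` is a (continuous) standard fractional Brownian motion with Hurst parameter `H`. -/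
structure IsFractionalBM {Ω : Type*} [MeasurableSpace Ω] (P : Measure Ω) (H : ℝ)
    (B : Ω → C(ℝ≥0, ℝ)) : Prop where
  gaussian : IsGaussianProcess (fun (t : ℝ≥0) ω => B ω t) P
  mean_zero : ∀ t, ∫ ω, B ω t ∂P = 0
  covariance : ∀ s t : ℝ≥0, cov[fun ω => B ω t, fun ω => B ω s; P] =
    1 / 2 * ((t : ℝ) ^ (2 * H) + (s : ℝ) ^ (2 * H) - |(t : ℝ) - s| ^ (2 * H))

/-- The data `(B_H, Z_∞(0))` of the fractional Ornstein–Uhlenbeck equation: a fractional Brownian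
motion with `H = (4 - β) / 2` and a centred variable, jointly Gaussian, with the prescribed
variance and covariances. -/
structure IsOUData {Ω : Type*} [MeasurableSpace Ω] (P : Measure Ω) (d : ℕ) (β θ κ : ℝ)
    (B : Ω → C(ℝ≥0, ℝ)) (Z₀ : Ω → ℝ) : Prop where
  fbm : IsFractionalBM P ((4 - β) / 2) B
  jointly_gaussian :
    IsGaussianProcess (fun (o : Option ℝ≥0) ω => o.elim (Z₀ ω) (fun t => B ω t)) P
  init_mean : ∫ ω, Z₀ ω ∂P = 0
  init_var : Var[Z₀; P] = ouInitVar d β θ κ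
  cross_cov : ∀ t : ℝ≥0, cov[fun ω => B ω t, Z₀; P] = ouCrossCov d β θ κ t

/-- The continuous process `X` solves `X(t) = Z₀ - κ ∫₀ᵗ X(s) ds + σ B(t)`, `t ≥ 0`, a.s. -/
def IsOUSolution {Ω : Type*} [MeasurableSpace Ω] (P : Measure Ω) (κ σ : ℝ)
    (B : Ω → C(ℝ≥0, ℝ)) (Z₀ : Ω → ℝ) (X : Ω → C(ℝ≥0, ℝ)) : Prop :=
  ∀ᵐ ω ∂P, ∀ t : ℝ≥0,
    X ω t = Z₀ ω - κ * (∫ s in (0 : ℝ)..t, X ω s.toNNReal) + σ * B ω t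

/-- A process with continuous paths is (strictly) stationary: its law on path space is invariant
under all time shifts. -/
def IsStationaryPath {Ω : Type*} [MeasurableSpace Ω] (P : Measure Ω)
    (X : Ω → C(ℝ≥0, ℝ)) : Prop :=
  ∀ h : ℝ≥0, IdentDistrib (fun ω => shiftPath h (X ω)) X P P

end

/-!
In the critical regime `b = a` the intensity decreases in the workload and equals `1` on the line
`y = a t`, so the fluid limit is `U(t) = a t` (`IsFluidLimit.eq_mul`). Hence `Λ` and `γ` are the
identity on `[0, ∞)`, `a f_y(s, U(s)) = -κ`, and the station average solves
`Z̄(t) = W(t) - κ ∫₀ᵗ Z̄(s) ds`, where `W(t)` is an average of Gaussian integrals of the kernel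
`workKernel t`, the work done until time `t`.

The equation `x(t) = y(t) - κ ∫₀ᵗ x(s) ds` is solved by a continuous map `linearSolution κ` of path
space. The shifted path `Z̄(T + ·)` solves it for the input
`Y_T(t) = W(T + t) - κ ∫₀ᵀ e^{-κ(T-r)} W(r) dr` (`drivingPath_shiftPath`), and the fractional
Ornstein–Uhlenbeck process solves it for `Y = Z₀ + σ B`. By the continuous mapping theorem it is
enough that `Y_T` converges in distribution to `Y`.

All `Y_T` are centred Gaussian (`isCentredGaussianPath_input`). A session that starts at `s` and has
length `r` works at rate one during `[s, s + r)`, so the kernel of `Y_T(t)` is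
`∫ ψ_t(T - u) 1{session active at u} du` for the weight `ψ_t` called `inputWeight κ t`, which is
`e^{-κx}` for `x ≥ 0`, one on `[-t, 0)` and zero elsewhere. The control measure of the sessions that
are active at both `u` and `v` is
`θ^{1-β}/(β-2) · (|u - v|^{2-β} - max(u, v)^{2-β})` (`controlMeasure_activeAt_inter`). By dominated
convergence the covariance of `Y_T(s)` and `Y_T(t)` tends to
`θ^{1-β}/(d(β-2)) ∬ ψ_s(x) ψ_t(y) |x - y|^{2-β} dx dy`, and splitting both weights at `0` shows that
this is the covariance of `Z₀ + σ B` (`rieszForm_inputWeight`).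

The variance of `Y_T(0)` is bounded and that of `Y_T(t) - Y_T(s)` is at most `σ² |t - s|^{4-β}` with
`4 - β > 1`, uniformly in `T`, so the laws of the `Y_T` are tight by Kolmogorov's criterion
(`isTightMeasureSet_of_increments`), and convergence of the characteristic functions of the marginals
gives weak convergence (`tendsto_of_tight_of_tendsto_charFun`). A cluster point of these laws, which
exists by Prokhorov's theorem, carries the data `(B, Z₀)`. Stationarity holds because
`Z̄(T + ·)` and `Z̄(T + h + ·)` have the same limit in distribution.
-/

noncomputable section

/-! ### Measurability on path space and the linear integral equation -/

/-- A continuous injection from a Polish space is a measurable embedding, so the Borel σ-algebra of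
path space is generated by the evaluations at a dense sequence of times. -/
lemma measurableEmbedding_eval_denseSeq :
    MeasurableEmbedding fun (x : C(ℝ≥0, ℝ)) (n : ℕ) => x (TopologicalSpace.denseSeq ℝ≥0 n) := by
  refine Continuous.measurableEmbedding (by fun_prop) fun x y hxy => ?_
  exact DFunLike.coe_injective <| (TopologicalSpace.denseRange_denseSeq ℝ≥0).equalizer
    x.continuous y.continuous (funext fun n => congrFun hxy n)

lemma aemeasurable_path {Ω : Type*} [MeasurableSpace Ω] {P : Measure Ω} {X : Ω → C(ℝ≥0, ℝ)}
    (hX : ∀ t, AEMeasurable (fun ω => X ω t) P) : AEMeasurable X P := by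
  rw [← measurableEmbedding_eval_denseSeq.aemeasurable_comp_iff]
  exact aemeasurable_pi_iff.2 fun n => hX _

/-- The integral `∫₀ᵗ e^{-κ(t-s)} x(s) ds`, as a function of the path `x` and the time `t`. -/
def expConv (κ : ℝ) (x : C(ℝ≥0, ℝ)) (t : ℝ) : ℝ :=
  ∫ s in (0 : ℝ)..t, Real.exp (-κ * (t - s)) * x s.toNNReal

lemma continuous_expConv (κ : ℝ) :
    Continuous fun p : C(ℝ≥0, ℝ) × ℝ => expConv κ p.1 p.2 := by
  unfold expConv
  apply intervalIntegral.continuous_parametric_intervalIntegral_of_continuous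
    (f := fun (p : C(ℝ≥0, ℝ) × ℝ) s => Real.exp (-κ * (p.2 - s)) * p.1 s.toNNReal)
  · simp only [Function.uncurry_def]
    have : Continuous fun q : (C(ℝ≥0, ℝ) × ℝ) × ℝ => q.1.1 q.2.toNNReal :=
      continuous_eval.comp (by fun_prop : Continuous fun q : (C(ℝ≥0, ℝ) × ℝ) × ℝ =>
        (q.1.1, q.2.toNNReal))
    fun_prop
  · fun_prop

/-- The solution map `y ↦ x` of the linear equation `x(t) = y(t) - κ ∫₀ᵗ x(s) ds` on path space,
given by variation of constants as `x(t) = y(t) - κ ∫₀ᵗ e^{-κ(t-s)} y(s) ds`. -/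
def linearSolution (κ : ℝ) (y : C(ℝ≥0, ℝ)) : C(ℝ≥0, ℝ) where
  toFun t := y t - κ * expConv κ y t
  continuous_toFun := by
    have := (continuous_expConv κ).comp (by fun_prop :
      Continuous fun t : ℝ≥0 => (y, (t : ℝ)))
    exact y.continuous.sub (continuous_const.mul this)

lemma linearSolution_apply (κ : ℝ) (y : C(ℝ≥0, ℝ)) (t : ℝ≥0) :
    linearSolution κ y t = y t - κ * expConv κ y t := rfl

lemma continuous_linearSolution (κ : ℝ) : Continuous (linearSolution κ) := by
  refine ContinuousMap.continuous_of_continuous_uncurry _ ?_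
  have := (continuous_expConv κ).comp (by fun_prop :
    Continuous fun q : C(ℝ≥0, ℝ) × ℝ≥0 => (q.1, (q.2 : ℝ)))
  exact continuous_eval.sub (continuous_const.mul this)

lemma continuous_comp_toNNReal (x : C(ℝ≥0, ℝ)) : Continuous fun s : ℝ => x s.toNNReal := by
  fun_prop

lemma hasDerivAt_primitive (x : C(ℝ≥0, ℝ)) (t : ℝ) :
    HasDerivAt (fun t => ∫ s in (0 : ℝ)..t, x s.toNNReal) (x t.toNNReal) t :=
  (continuous_comp_toNNReal x).integral_hasStrictDerivAt 0 t |>.hasDerivAt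

/-- The linear equation `x(t) = y(t) - κ ∫₀ᵗ x(s) ds` has at most the solution given by variation
of constants: `e^{κt} ∫₀ᵗ x` has derivative `e^{κt} y(t)`. -/
lemma eq_linearSolution {κ : ℝ} {x y : C(ℝ≥0, ℝ)}
    (h : ∀ t : ℝ≥0, x t = y t - κ * ∫ s in (0 : ℝ)..t, x s.toNNReal) :
    x = linearSolution κ y := by
  ext t
  rw [linearSolution_apply, h t]
  congr 2
  have hd : ∀ s ∈ uIcc (0 : ℝ) t, HasDerivAt
      (fun s => Real.exp (κ * s) * ∫ r in (0 : ℝ)..s, x r.toNNReal)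
      (Real.exp (κ * s) * y s.toNNReal) s := by
    intro s hs
    rw [uIcc_of_le t.coe_nonneg] at hs
    have h1 : HasDerivAt (fun s : ℝ => Real.exp (κ * s)) (Real.exp (κ * s) * (κ * 1)) s :=
      ((hasDerivAt_id s).const_mul κ).exp
    refine (h1.mul (hasDerivAt_primitive x s)).congr_deriv ?_
    have := h s.toNNReal
    rw [Real.coe_toNNReal _ hs.1] at this
    rw [this]; ring
  have hc : Continuous fun s : ℝ => Real.exp (κ * s) * y s.toNNReal := by
    have := continuous_comp_toNNReal y
    fun_prop
  have hi := intervalIntegral.integral_eq_sub_of_hasDerivAt hd (hc.intervalIntegrable _ _)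
  simp only [intervalIntegral.integral_same, mul_zero, sub_zero] at hi
  have he : expConv κ y t = Real.exp (-κ * t) *
      ∫ s in (0 : ℝ)..t, Real.exp (κ * s) * y s.toNNReal := by
    rw [expConv, ← intervalIntegral.integral_const_mul]
    congr 1; ext s
    rw [← mul_assoc, ← Real.exp_add]; ring_nf
  rw [he, hi, ← mul_assoc, ← Real.exp_add]
  simp

/-- Variation of constants does solve the linear equation: both `∫₀ᵗ x` and `∫₀ᵗ e^{-κ(t-s)} y(s) ds`
vanish at `0` and have the same derivative. -/
lemma linearSolution_eq (κ : ℝ) (y : C(ℝ≥0, ℝ)) (t : ℝ≥0) :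
    linearSolution κ y t = y t - κ * ∫ s in (0 : ℝ)..t, linearSolution κ y s.toNNReal := by
  have he : ∀ t, expConv κ y t = Real.exp (-κ * t) *
      ∫ s in (0 : ℝ)..t, Real.exp (κ * s) * y s.toNNReal := by
    intro t
    rw [expConv, ← intervalIntegral.integral_const_mul]
    congr 1; ext s
    rw [← mul_assoc, ← Real.exp_add]; ring_nf
  have hc : Continuous fun s : ℝ => Real.exp (κ * s) * y s.toNNReal := by
    have := continuous_comp_toNNReal y
    fun_prop
  have hd : ∀ s ∈ uIcc (0 : ℝ) t, HasDerivAt (fun s => expConv κ y s)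
      (linearSolution κ y s.toNNReal) s := by
    intro s hs
    rw [uIcc_of_le t.coe_nonneg] at hs
    rw [show (fun s => expConv κ y s) = _ from funext he]
    have h1 : HasDerivAt (fun s : ℝ => Real.exp (-κ * s)) (Real.exp (-κ * s) * (-κ * 1)) s :=
      ((hasDerivAt_id s).const_mul (-κ)).exp
    refine (h1.mul (hc.integral_hasStrictDerivAt 0 s).hasDerivAt).congr_deriv ?_
    have h2 : Real.exp (-κ * s) * Real.exp (κ * s) = 1 := by rw [← Real.exp_add]; simp
    rw [linearSolution_apply, Real.coe_toNNReal _ hs.1, he]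
    linear_combination y s.toNNReal * h2
  have hi := intervalIntegral.integral_eq_sub_of_hasDerivAt hd
    ((continuous_comp_toNNReal (linearSolution κ y)).intervalIntegrable _ _)
  rw [hi, linearSolution_apply]
  simp [expConv]

/-! ### Tightness on path space -/

/-- The dyadic point `k / 2ⁿ`. -/
def dyadic (n k : ℕ) : ℝ≥0 := k / 2 ^ n

/-- The paths that start in `[-M, M]` and whose increments over the dyadic intervals of length
`2⁻ⁿ` in `[N, N + 1]` are at most `M 2ᴺ rⁿ`. The integer division `k / 2 ^ n` is `N`; the factor `2ᴺ`
makes the exceptional probabilities summable over the unbounded time axis. -/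
def dyadicClass (r M : ℝ) : Set C(ℝ≥0, ℝ) :=
  {x | |x 0| ≤ M ∧ ∀ n k, |x (dyadic n (k + 1)) - x (dyadic n k)| ≤ M * 2 ^ (k / 2 ^ n) * r ^ n}

/-- The largest dyadic point `k / 2ⁿ` that is at most `s`. -/
def dyadicFloor (n : ℕ) (s : ℝ≥0) : ℝ≥0 := dyadic n ⌊s * 2 ^ n⌋₊

lemma dyadicFloor_le (n : ℕ) (s : ℝ≥0) : dyadicFloor n s ≤ s := by
  unfold dyadicFloor dyadic
  rw [div_le_iff₀ (by positivity)]
  exact Nat.floor_le (by positivity)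

lemma lt_dyadicFloor_add (n : ℕ) (s : ℝ≥0) : s < dyadicFloor n s + (2 ^ n)⁻¹ := by
  unfold dyadicFloor dyadic
  have := Nat.lt_floor_add_one (s * 2 ^ n)
  rw [div_eq_mul_inv, ← add_one_mul, ← div_eq_mul_inv, lt_div_iff₀ (by positivity)]
  exact this

lemma tendsto_dyadicFloor (s : ℝ≥0) : Tendsto (fun n => dyadicFloor n s) atTop (𝓝 s) := by
  have h0 : Tendsto (fun n : ℕ => ((2 : ℝ≥0) ^ n)⁻¹) atTop (𝓝 0) := by
    have := tendsto_pow_atTop_nhds_zero_of_lt_one (r := (2 : ℝ≥0)⁻¹) zero_le (by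
      rw [← NNReal.coe_lt_coe]; norm_num)
    simpa [inv_pow] using this
  have h1 : Tendsto (fun n : ℕ => s - ((2 : ℝ≥0) ^ n)⁻¹) atTop (𝓝 s) := by
    simpa using tendsto_const_nhds (x := s).sub h0
  refine tendsto_of_tendsto_of_tendsto_of_le_of_le h1 tendsto_const_nhds (fun n => ?_)
    (fun n => dyadicFloor_le n s)
  exact tsub_le_iff_right.2 (lt_dyadicFloor_add n s).le

section

variable {r M : ℝ} {x : C(ℝ≥0, ℝ)}

lemma floor_div_pow_le {n N : ℕ} {s : ℝ≥0} (hs : s ≤ N) : ⌊s * 2 ^ n⌋₊ / 2 ^ n ≤ N := by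
  refine Nat.div_le_of_le_mul ?_
  have : (⌊s * 2 ^ n⌋₊ : ℝ≥0) ≤ 2 ^ n * N := by
    refine (Nat.floor_le (by positivity)).trans ?_
    rw [mul_comm]; gcongr
  exact_mod_cast this

lemma dyadic_increment_le (hM : 0 ≤ M) (hr : 0 ≤ r) (hx : x ∈ dyadicClass r M) {n k N : ℕ}
    (hk : k / 2 ^ n ≤ N) :
    |x (dyadic n (k + 1)) - x (dyadic n k)| ≤ M * 2 ^ N * r ^ n := by
  refine (hx.2 n k).trans ?_
  gcongr
  norm_num

lemma dist_dyadicFloor_succ_le (hM : 0 ≤ M) (hr : 0 ≤ r) (hx : x ∈ dyadicClass r M) {N : ℕ}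
    {s : ℝ≥0} (hs : s ≤ N) (n : ℕ) :
    dist (x (dyadicFloor n s)) (x (dyadicFloor (n + 1) s)) ≤ M * 2 ^ N * r * r ^ n := by
  have h2 : dyadicFloor n s = dyadic (n + 1) (2 * ⌊s * 2 ^ n⌋₊) := by
    unfold dyadicFloor dyadic
    push_cast
    rw [pow_succ]
    field_simp
  have h3 : ⌊s * 2 ^ (n + 1)⌋₊ = 2 * ⌊s * 2 ^ n⌋₊ ∨ ⌊s * 2 ^ (n + 1)⌋₊ = 2 * ⌊s * 2 ^ n⌋₊ + 1 := by
    have : ⌊s * 2 ^ (n + 1)⌋₊ / 2 = ⌊s * 2 ^ n⌋₊ := by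
      rw [← Nat.floor_div_natCast]
      congr 1
      push_cast
      rw [pow_succ]
      field_simp
    omega
  have h4 : dyadicFloor (n + 1) s = dyadic (n + 1) ⌊s * 2 ^ (n + 1)⌋₊ := rfl
  rw [h2, h4]
  rcases h3 with h | h <;> rw [h]
  · rw [dist_self]; positivity
  · rw [dist_comm, Real.dist_eq, mul_assoc, ← pow_succ']
    refine dyadic_increment_le hM hr hx ?_
    rw [pow_succ', Nat.mul_div_mul_left _ _ (by norm_num)]
    exact floor_div_pow_le hs

lemma dist_dyadicFloor_le (hM : 0 ≤ M) (hr : 0 ≤ r) (hr1 : r < 1) (hx : x ∈ dyadicClass r M)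
    {N : ℕ} {s : ℝ≥0} (hs : s ≤ N) (n : ℕ) :
    dist (x (dyadicFloor n s)) (x s) ≤ M * 2 ^ N * r * r ^ n / (1 - r) :=
  dist_le_of_le_geometric_of_tendsto r _ hr1 (dist_dyadicFloor_succ_le hM hr hx hs)
    ((x.continuous.tendsto s).comp (tendsto_dyadicFloor s)) n

lemma dist_dyadicFloor_dyadicFloor_le (hM : 0 ≤ M) (hr : 0 ≤ r) (hx : x ∈ dyadicClass r M) {N : ℕ}
    {s t : ℝ≥0} (hs : s ≤ N) (hst : s ≤ t) {n : ℕ} (h : t ≤ s + (2 ^ n)⁻¹) :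
    dist (x (dyadicFloor n s)) (x (dyadicFloor n t)) ≤ M * 2 ^ N * r ^ n := by
  have h1 : ⌊s * 2 ^ n⌋₊ ≤ ⌊t * 2 ^ n⌋₊ := Nat.floor_le_floor (by gcongr)
  have h2 : ⌊t * 2 ^ n⌋₊ ≤ ⌊s * 2 ^ n⌋₊ + 1 := by
    rw [← Nat.floor_add_one (by positivity)]
    refine Nat.floor_le_floor ?_
    calc t * 2 ^ n ≤ (s + (2 ^ n)⁻¹) * 2 ^ n := by gcongr
      _ = s * 2 ^ n + 1 := by field_simp
  have h3 : ⌊t * 2 ^ n⌋₊ = ⌊s * 2 ^ n⌋₊ ∨ ⌊t * 2 ^ n⌋₊ = ⌊s * 2 ^ n⌋₊ + 1 := by omega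
  unfold dyadicFloor
  rcases h3 with h | h <;> rw [h]
  · rw [dist_self]; positivity
  · rw [dist_comm, Real.dist_eq]
    exact dyadic_increment_le hM hr hx (floor_div_pow_le hs)

/-- Chaining: a bound on the dyadic increments controls the modulus of continuity. -/
lemma dist_le_of_mem_dyadicClass (hM : 0 ≤ M) (hr : 0 ≤ r) (hr1 : r < 1)
    (hx : x ∈ dyadicClass r M) {N : ℕ} {s t : ℝ≥0} (hs : s ≤ N) (ht : t ≤ N) {n : ℕ}
    (h : dist s t ≤ (2 ^ n)⁻¹) :
    dist (x s) (x t) ≤ M * 2 ^ N * (1 + 2 * (r / (1 - r))) * r ^ n := by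
  wlog hst : s ≤ t generalizing s t
  · rw [dist_comm]
    exact this ht hs (by rwa [dist_comm]) (le_of_not_ge hst)
  have h' : t ≤ s + (2 ^ n)⁻¹ := by
    rw [NNReal.dist_eq, abs_sub_comm] at h
    have := (le_abs_self _).trans h
    rw [← NNReal.coe_le_coe]; push_cast; linarith
  have h1 := dist_dyadicFloor_le hM hr hr1 hx hs n
  have h2 := dist_dyadicFloor_le hM hr hr1 hx ht n
  have h3 := dist_dyadicFloor_dyadicFloor_le hM hr hx hs hst h'
  have h4 := dist_triangle4 (x s) (x (dyadicFloor n s)) (x (dyadicFloor n t)) (x t)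
  rw [dist_comm (x s) (x (dyadicFloor n s))] at h4
  calc dist (x s) (x t) ≤ _ := h4
    _ ≤ M * 2 ^ N * r * r ^ n / (1 - r) + M * 2 ^ N * r ^ n + M * 2 ^ N * r * r ^ n / (1 - r) := by
      gcongr
    _ = _ := by ring

lemma abs_natCast_le_of_mem_dyadicClass (hM : 0 ≤ M) (hr : 0 ≤ r) (hx : x ∈ dyadicClass r M)
    {k N : ℕ} (hk : k ≤ N) : |x k| ≤ M + k * (M * 2 ^ N) := by
  induction k with
  | zero => simpa using hx.1
  | succ k ih =>
    have h1 := ih (by omega)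
    have h2 := dyadic_increment_le hM hr hx (n := 0) (k := k) (N := N) (by simp; omega)
    simp only [dyadic, pow_zero, div_one, mul_one] at h2
    have h3 := abs_sub_abs_le_abs_sub (x ((k + 1 : ℕ) : ℝ≥0)) (x k)
    push_cast at *
    linarith

end

/-- The paths of a dyadic class are equicontinuous and pointwise bounded, so the Arzelà–Ascoli theorem
applies. -/
lemma isCompact_closure_dyadicClass {r M : ℝ} (hM : 0 ≤ M) (hr : 0 < r) (hr1 : r < 1) :
    IsCompact (closure (dyadicClass r M)) := by
  have : T2Space (UniformOnFun ℝ≥0 ℝ {K | IsCompact K}) :=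
    UniformOnFun.t2Space_of_covering <| eq_univ_iff_forall.2 fun s =>
      mem_sUnion_of_mem (mem_singleton s) isCompact_singleton
  refine ArzelaAscoli.isCompact_closure_of_isClosedEmbedding (𝔖 := {K | IsCompact K})
    (F := fun x : C(ℝ≥0, ℝ) => (x : ℝ≥0 → ℝ)) (fun K hK => hK)
    ContinuousMap.isUniformEmbedding_toUniformOnFunIsCompact.isClosedEmbedding
    (fun K _ => Equicontinuous.equicontinuousOn (fun s => ?_) K) fun K _ s _ => ?_
  · rw [Metric.equicontinuousAt_iff_right]
    intro ε hε
    obtain ⟨N, hN⟩ := exists_nat_ge (s + 1)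
    obtain ⟨n, hn⟩ : ∃ n : ℕ, M * 2 ^ N * (1 + 2 * (r / (1 - r))) * r ^ n < ε := by
      have := (tendsto_pow_atTop_nhds_zero_of_lt_one hr.le hr1).const_mul
        (M * 2 ^ N * (1 + 2 * (r / (1 - r))))
      rw [mul_zero] at this
      exact (this.eventually_lt_const hε).exists
    have h2 : (0 : ℝ) < (2 ^ n)⁻¹ := by positivity
    filter_upwards [Metric.ball_mem_nhds s h2, Metric.ball_mem_nhds s one_pos] with t ht ht1 i
    refine (dist_le_of_mem_dyadicClass hM hr.le hr1 i.2 (N := N) (n := n) ?_ ?_ ?_).trans_lt hn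
    · exact le_trans (by simp) hN
    · refine le_trans ?_ hN
      rw [Metric.mem_ball, NNReal.dist_eq] at ht1
      have := (le_abs_self _).trans ht1.le
      rw [← NNReal.coe_le_coe]; push_cast; linarith
    · rw [dist_comm]; exact (Metric.mem_ball.1 ht).le
  · obtain ⟨N, hN⟩ := exists_nat_ge s
    refine ⟨Metric.closedBall 0 (M + N * (M * 2 ^ N) + M * 2 ^ N * r * r ^ 0 / (1 - r)),
      isCompact_closedBall _ _, fun x hx => ?_⟩
    rw [mem_closedBall_zero_iff, Real.norm_eq_abs]
    have h1 := dist_dyadicFloor_le hM hr.le hr1 hx hN 0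
    have hf : ⌊s⌋₊ ≤ N := Nat.floor_le_of_le hN
    have h2 := abs_natCast_le_of_mem_dyadicClass hM hr.le hx hf
    have h3 : dyadicFloor 0 s = ⌊s⌋₊ := by simp [dyadicFloor, dyadic]
    rw [h3, dist_comm, Real.dist_eq] at h1
    have h4 := abs_sub_abs_le_abs_sub (x s) (x ⌊s⌋₊)
    have h5 : (⌊s⌋₊ : ℝ) * (M * 2 ^ N) ≤ N * (M * 2 ^ N) := by
      have : (⌊s⌋₊ : ℝ) ≤ N := by exact_mod_cast hf
      gcongr
    linarith

lemma tsum_pow_div_pow (n : ℕ) (q : ℝ≥0∞) :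
    ∑' k : ℕ, q ^ (k / 2 ^ n) = 2 ^ n * (1 - q)⁻¹ := by
  have : NeZero (2 ^ n) := ⟨by positivity⟩
  rw [← (Nat.divModEquiv (2 ^ n)).symm.tsum_eq,
    ENNReal.tsum_prod (f := fun a b => q ^ ((Nat.divModEquiv (2 ^ n)).symm (a, b) / 2 ^ n))]
  have : ∀ (a : ℕ) (b : Fin (2 ^ n)), ((Nat.divModEquiv (2 ^ n)).symm (a, b)) / 2 ^ n = a := by
    intro a b
    have := (Nat.divModEquiv (2 ^ n)).apply_symm_apply (a, b)
    rw [Nat.divModEquiv_apply] at this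
    exact congrArg Prod.fst this
  simp_rw [this]
  simp only [tsum_fintype, Finset.sum_const, Finset.card_univ, Fintype.card_fin, nsmul_eq_mul]
  rw [ENNReal.tsum_mul_left, ENNReal.tsum_geometric]
  push_cast; rfl

/-- A Kolmogorov-type estimate: second moment tail bounds of order `|t - s|^(1+δ)` on the increments
bound the mass outside the dyadic classes. -/
lemma measure_compl_dyadicClass_le {μ : Measure C(ℝ≥0, ℝ)} {C δ : ℝ} (hC : 0 ≤ C)
    (h0 : ∀ ε > 0, μ {x | ε < |x 0|} ≤ ENNReal.ofReal (C / ε ^ 2))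
    (h1 : ∀ (s t : ℝ≥0), ∀ ε > 0, μ {x | ε < |x t - x s|} ≤
      ENNReal.ofReal (C * |(t : ℝ) - s| ^ (1 + δ) / ε ^ 2)) {M : ℝ} (hM : 0 < M) :
    μ (dyadicClass (2 ^ (-(δ / 4))) M)ᶜ ≤ ENNReal.ofReal (C / M ^ 2) *
      (1 + (1 - ENNReal.ofReal (1 / 4))⁻¹ * (1 - ENNReal.ofReal (2 ^ (-(δ / 2))))⁻¹) := by
  set r : ℝ := 2 ^ (-(δ / 4)) with hr
  have hr0 : 0 < r := by positivity
  have hsub : (dyadicClass r M)ᶜ ⊆ {x | M < |x 0|} ∪ ⋃ n, ⋃ k,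
      {x | M * 2 ^ (k / 2 ^ n) * r ^ n < |x (dyadic n (k + 1)) - x (dyadic n k)|} := by
    intro x hx
    simp only [dyadicClass, mem_compl_iff, mem_ofPred_eq, not_and_or, not_le, not_forall] at hx
    simpa [mem_union, mem_iUnion] using hx
  have hterm : ∀ n k,
      μ {x | M * 2 ^ (k / 2 ^ n) * r ^ n < |x (dyadic n (k + 1)) - x (dyadic n k)|} ≤
      ENNReal.ofReal (C / M ^ 2) * ((2 ^ n)⁻¹ * ENNReal.ofReal (2 ^ (-(δ / 2))) ^ n) *
        ENNReal.ofReal (1 / 4) ^ (k / 2 ^ n) := by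
    intro n k
    refine (h1 _ _ _ (by positivity)).trans ?_
    have e1 : (2 ^ n : ℝ≥0∞)⁻¹ = ENNReal.ofReal ((2 ^ n)⁻¹) := by
      rw [ENNReal.ofReal_inv_of_pos (by positivity), ENNReal.ofReal_pow (by norm_num)]; simp
    rw [e1, ← ENNReal.ofReal_pow (by positivity), ← ENNReal.ofReal_pow (by positivity),
      ← ENNReal.ofReal_mul (by positivity), ← ENNReal.ofReal_mul (by positivity),
      ← ENNReal.ofReal_mul (by positivity)]
    refine ENNReal.ofReal_le_ofReal (le_of_eq ?_)
    have e2 : |((dyadic n (k + 1) : ℝ≥0) : ℝ) - (dyadic n k : ℝ≥0)| = (2 ^ n)⁻¹ := by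
      simp only [dyadic]; push_cast
      rw [← sub_div, add_sub_cancel_left, one_div, abs_of_pos (by positivity)]
    -- with `r = 2^{-δ/4}`, dividing by `(rⁿ)²` leaves a surplus `2^{-nδ/2}` to sum over `n`
    have e3 : ((2 ^ n)⁻¹ : ℝ) ^ (1 + δ) = (2 ^ n)⁻¹ * (2 ^ (-(δ / 2))) ^ n * (r ^ n) ^ 2 := by
      have p1 : ((2 ^ n)⁻¹ : ℝ) = 2 ^ (-(n : ℝ)) := by
        rw [Real.rpow_neg (by norm_num), Real.rpow_natCast]
      have p2 : ∀ y : ℝ, ((2 : ℝ) ^ y) ^ n = 2 ^ (y * n) := fun y => by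
        rw [← Real.rpow_natCast, ← Real.rpow_mul (by norm_num)]
      rw [hr, p1, p2, p2, sq, ← Real.rpow_mul (by norm_num), ← Real.rpow_add (by norm_num),
        ← Real.rpow_add (by norm_num), ← Real.rpow_add (by norm_num)]
      congr 1; ring
    have e4 : (1 / 4 : ℝ) ^ (k / 2 ^ n) = ((2 ^ (k / 2 ^ n)) ^ 2)⁻¹ := by
      rw [← pow_mul, mul_comm, pow_mul, one_div, inv_pow]; norm_num
    rw [e2, e3, e4]
    field_simp
  calc μ (dyadicClass r M)ᶜ ≤ μ {x | M < |x 0|} + ∑' n, ∑' k,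
        μ {x | M * 2 ^ (k / 2 ^ n) * r ^ n < |x (dyadic n (k + 1)) - x (dyadic n k)|} := by
        refine (measure_mono hsub).trans ((measure_union_le _ _).trans ?_)
        gcongr
        refine (measure_iUnion_le _).trans ?_
        gcongr
        exact measure_iUnion_le _
    _ ≤ ENNReal.ofReal (C / M ^ 2) + ∑' n : ℕ, ∑' k : ℕ,
        ENNReal.ofReal (C / M ^ 2) * ((2 ^ n)⁻¹ * ENNReal.ofReal (2 ^ (-(δ / 2))) ^ n) *
        ENNReal.ofReal (1 / 4) ^ (k / 2 ^ n) := by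
        gcongr with n k
        · exact h0 M hM
        · exact hterm n k
    _ = _ := by
        simp_rw [ENNReal.tsum_mul_left, tsum_pow_div_pow]
        have : ∀ n : ℕ, ENNReal.ofReal (C / M ^ 2) *
            ((2 ^ n)⁻¹ * ENNReal.ofReal (2 ^ (-(δ / 2))) ^ n) *
            (2 ^ n * (1 - ENNReal.ofReal (1 / 4))⁻¹) =
            ENNReal.ofReal (C / M ^ 2) * (1 - ENNReal.ofReal (1 / 4))⁻¹ *
              ENNReal.ofReal (2 ^ (-(δ / 2))) ^ n := by
          intro n
          have : (2 ^ n : ℝ≥0∞)⁻¹ * 2 ^ n = 1 := ENNReal.inv_mul_cancel (by simp) (by simp)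
          calc _ = ENNReal.ofReal (C / M ^ 2) * (1 - ENNReal.ofReal (1 / 4))⁻¹ *
              ENNReal.ofReal (2 ^ (-(δ / 2))) ^ n * ((2 ^ n : ℝ≥0∞)⁻¹ * 2 ^ n) := by ring
            _ = _ := by rw [this, mul_one]
        simp_rw [this]
        rw [ENNReal.tsum_mul_left, ENNReal.tsum_geometric]
        ring

/-- **Kolmogorov's tightness criterion** on `C(ℝ≥0, ℝ)`. -/
theorem isTightMeasureSet_of_increments {S : Set (Measure C(ℝ≥0, ℝ))} {C δ : ℝ} (hC : 0 ≤ C)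
    (hδ : 0 < δ)
    (h0 : ∀ μ ∈ S, ∀ ε > 0, μ {x | ε < |x 0|} ≤ ENNReal.ofReal (C / ε ^ 2))
    (h1 : ∀ μ ∈ S, ∀ (s t : ℝ≥0), ∀ ε > 0, μ {x | ε < |x t - x s|} ≤
      ENNReal.ofReal (C * |(t : ℝ) - s| ^ (1 + δ) / ε ^ 2)) :
    IsTightMeasureSet S := by
  rw [isTightMeasureSet_iff_exists_isCompact_measure_compl_le]
  intro ε hε
  set A : ℝ≥0∞ := 1 + (1 - ENNReal.ofReal (1 / 4))⁻¹ * (1 - ENNReal.ofReal (2 ^ (-(δ / 2))))⁻¹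
    with hA
  have hAfin : A ≠ ∞ := by
    refine ENNReal.add_ne_top.2 ⟨by simp, ENNReal.mul_ne_top ?_ ?_⟩
    · simp only [ne_eq, ENNReal.inv_eq_top, tsub_eq_zero_iff_le, not_le]
      exact ENNReal.ofReal_lt_one.2 (by norm_num)
    · simp only [ne_eq, ENNReal.inv_eq_top, tsub_eq_zero_iff_le, not_le]
      exact ENNReal.ofReal_lt_one.2 (Real.rpow_lt_one_of_one_lt_of_neg (by norm_num) (by linarith))
  have hlim : Tendsto (fun M : ℝ => ENNReal.ofReal (C / M ^ 2) * A) atTop (𝓝 0) := by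
    have h : Tendsto (fun M : ℝ => C / M ^ 2) atTop (𝓝 0) :=
      Tendsto.const_div_atTop (tendsto_pow_atTop (by norm_num)) C
    have h' := ENNReal.tendsto_ofReal h
    rw [ENNReal.ofReal_zero] at h'
    simpa using ENNReal.Tendsto.mul_const h' (Or.inr hAfin)
  obtain ⟨M, hMε, hM⟩ := ((hlim.eventually_lt_const hε).and (eventually_gt_atTop 0)).exists
  refine ⟨closure (dyadicClass (2 ^ (-(δ / 4))) M), isCompact_closure_dyadicClass hM.le
    (by positivity) (Real.rpow_lt_one_of_one_lt_of_neg (by norm_num) (by linarith)), ?_⟩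
  intro μ hμ
  refine (measure_mono (compl_subset_compl.2 subset_closure)).trans ?_
  exact (measure_compl_dyadicClass_le hC (h0 μ hμ) (h1 μ hμ) hM).trans hMε.le

/-! ### Weak convergence on path space through characteristic functions -/

/-- The pairing `(x, w) ↦ ∑ₜ w(t) x(t)` of a path with a finitely supported function. -/
def pathPairing : C(ℝ≥0, ℝ) →ₗ[ℝ] (ℝ≥0 →₀ ℝ) →ₗ[ℝ] ℝ :=
  LinearMap.mk₂ ℝ (fun x w => w.sum fun t c => c * x t)
    (fun x y w => by simp [Finsupp.sum, mul_add, Finset.sum_add_distrib])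
    (fun a x w => by simp [Finsupp.sum, Finset.mul_sum, mul_left_comm])
    (fun x v w => Finsupp.sum_add_index' (by simp) (by simp [add_mul]))
    (fun a x w => by
      rw [Finsupp.sum_smul_index (by simp)]
      simp [Finsupp.sum, Finset.mul_sum, mul_assoc])

lemma pathPairing_apply (x : C(ℝ≥0, ℝ)) (w : ℝ≥0 →₀ ℝ) :
    pathPairing x w = w.sum fun t c => c * x t := rfl

lemma continuous_pathPairing (w : ℝ≥0 →₀ ℝ) : Continuous fun x => pathPairing x w := by
  simp only [pathPairing_apply, Finsupp.sum]
  fun_prop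

lemma pathPairing_ne_zero {x : C(ℝ≥0, ℝ)} (hx : x ≠ 0) : pathPairing x ≠ 0 := by
  contrapose! hx
  ext t
  simpa [pathPairing_apply] using LinearMap.congr_fun hx (Finsupp.single t 1)

lemma continuous_exp_pathPairing (w : ℝ≥0 →₀ ℝ) :
    Continuous fun x => Complex.exp (pathPairing x w * Complex.I) := by
  have := continuous_pathPairing w
  fun_prop

/-- The bounded continuous function `x ↦ exp (i ∑ₜ w(t) x(t))` on path space. -/
def pathChar (w : ℝ≥0 →₀ ℝ) : BoundedContinuousFunction C(ℝ≥0, ℝ) ℂ :=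
  .ofNormedAddCommGroup (fun x => Complex.exp (pathPairing x w * Complex.I))
    (continuous_exp_pathPairing w) 1 fun x => by rw [Complex.norm_exp_ofReal_mul_I]

/-- A tight family of laws on path space converges weakly as soon as the characteristic functions
of its finite-dimensional marginals converge. -/
theorem tendsto_of_tight_of_tendsto_charFun {ι : Type*} {F : Filter ι}
    {μ : ι → ProbabilityMeasure C(ℝ≥0, ℝ)} {μ₀ : ProbabilityMeasure C(ℝ≥0, ℝ)}
    (ht : IsTightMeasureSet {(μ n : Measure C(ℝ≥0, ℝ)) | n})
    (h : ∀ w : ℝ≥0 →₀ ℝ, Tendsto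
      (fun n => ∫ x, Complex.exp (pathPairing x w * Complex.I) ∂(μ n : Measure C(ℝ≥0, ℝ))) F
      (𝓝 (∫ x, Complex.exp (pathPairing x w * Complex.I) ∂(μ₀ : Measure C(ℝ≥0, ℝ))))) :
    Tendsto μ F (𝓝 μ₀) := by
  let : TopologicalSpace (ℝ≥0 →₀ ℝ) := ⊥
  have : DiscreteTopology (ℝ≥0 →₀ ℝ) := ⟨rfl⟩
  have hL : Continuous fun p : C(ℝ≥0, ℝ) × (ℝ≥0 →₀ ℝ) => pathPairing p.1 p.2 :=
    continuous_prod_of_discrete_right.2 continuous_pathPairing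
  refine ProbabilityMeasure.tendsto_of_tight_of_separatesPoints ℂ ht
    (A := BoundedContinuousFunction.charPoly Real.continuous_probChar hL)
    (BoundedContinuousFunction.separatesPoints_charPoly
      Real.continuous_probChar Real.probChar_ne_one _
      fun x hx => pathPairing_ne_zero hx) fun g hg => ?_
  rw [BoundedContinuousFunction.mem_charPoly] at hg
  obtain ⟨p, hp⟩ := hg
  have h_eq (ν : Measure C(ℝ≥0, ℝ)) [IsProbabilityMeasure ν] : ∫ x, g x ∂ν =
      p.coeff.sum fun a z => z * ∫ x, Complex.exp (pathPairing x a * Complex.I) ∂ν := by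
    simp_rw [hp, Finsupp.sum]
    rw [integral_finsetSum]
    · refine Finset.sum_congr rfl fun a _ => ?_
      rw [← integral_const_mul]
      simp [Real.probChar_apply]
    · refine fun a _ => Integrable.const_mul ?_ _
      simpa [pathChar, Real.probChar_apply] using (pathChar a).integrable ν
  simp_rw [h_eq]
  exact tendsto_finsetSum _ fun a _ => (h a).const_mul _

/-- **Prokhorov's theorem**: if the characteristic functions of the finite-dimensional marginals of a
tight family of laws on path space converge, the limits belong to a law on path space. -/
theorem exists_law_of_tight_of_tendsto_charFun {ι : Type*} {F : Filter ι} [F.NeBot]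
    {μ : ι → ProbabilityMeasure C(ℝ≥0, ℝ)}
    (ht : IsTightMeasureSet {(μ n : Measure C(ℝ≥0, ℝ)) | n}) {φ : (ℝ≥0 →₀ ℝ) → ℂ}
    (h : ∀ w : ℝ≥0 →₀ ℝ, Tendsto
      (fun n => ∫ x, Complex.exp (pathPairing x w * Complex.I) ∂(μ n : Measure C(ℝ≥0, ℝ))) F
      (𝓝 (φ w))) :
    ∃ μ₀ : ProbabilityMeasure C(ℝ≥0, ℝ), ∀ w,
      ∫ x, Complex.exp (pathPairing x w * Complex.I) ∂(μ₀ : Measure C(ℝ≥0, ℝ)) = φ w := by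
  have h_compact : IsCompact (closure {μ n | n}) :=
    isCompact_closure_of_isTightMeasureSet (by simpa using ht)
  obtain ⟨μ₀, -, hμ₀⟩ := h_compact.ultrafilter_le_nhds ((Ultrafilter.of F).map μ)
    (.trans (by simp) (monotone_principal subset_closure))
  have hμ₀ : Tendsto μ (Ultrafilter.of F) (𝓝 μ₀) := hμ₀
  refine ⟨μ₀, fun w => tendsto_nhds_unique ?_ ((h w).mono_left (Ultrafilter.of_le F))⟩
  rw [ProbabilityMeasure.tendsto_iff_forall_integral_rclike_tendsto ℂ] at hμ₀
  exact hμ₀ (pathChar w)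

/-! ### Integrals with respect to Gaussian random measures -/

/-- The set where the function vanishes may have infinite control measure; it does not contribute. -/
lemma simpleGaussianIntegral_eq_filter {Ω E : Type*} [MeasurableSpace E] {M : Set E → Ω → ℝ}
    (φ : SimpleFunc E ℝ) (ω : Ω) :
    simpleGaussianIntegral M φ ω = ∑ c ∈ φ.range with c ≠ 0, c * M (φ ⁻¹' {c}) ω := by
  rw [simpleGaussianIntegral, Finset.sum_filter_of_ne]
  rintro c - h rfl
  simp at h

namespace IsGaussianRandomMeasure

variable {Ω E : Type*} [MeasurableSpace Ω] [MeasurableSpace E] {P : Measure Ω}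
  {m : Measure E} {M : Set E → Ω → ℝ}

lemma empty_ae_eq (hM : IsGaussianRandomMeasure P m M) : ∀ᵐ ω ∂P, M ∅ ω = 0 := by
  have h := hM.law ∅ .empty (by simp)
  simp only [measure_empty, ENNReal.toNNReal_zero, gaussianReal_zero_var] at h
  refine ae_of_ae_map (hM.measurable ∅ .empty (by simp)).aemeasurable (p := fun y => y = 0) ?_
  rw [h]
  simp [ae_dirac_eq]

lemma union_ae_eq (hM : IsGaussianRandomMeasure P m M) {A B : Set E} (hA : MeasurableSet A)
    (hB : MeasurableSet B) (hAm : m A < ∞) (hBm : m B < ∞) (hd : Disjoint A B) :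
    ∀ᵐ ω ∂P, M (A ∪ B) ω = M A ω + M B ω := by
  let S : ℕ → Set E := fun j => if j = 0 then A else if j = 1 then B else ∅
  have hS : ⋃ j, S j = A ∪ B := by
    ext x
    simp only [mem_iUnion, mem_union]
    constructor
    · rintro ⟨j, hj⟩
      rcases j with _ | _ | j <;> simp_all [S]
    · rintro (h | h)
      · exact ⟨0, by simpa [S] using h⟩
      · exact ⟨1, by simpa [S] using h⟩
  have hd' : Pairwise fun j k => Disjoint (S j) (S k) := by
    intro j k hjk
    rcases j with _ | _ | j <;> rcases k with _ | _ | k <;> simp_all [S, hd.symm]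
  have h := hM.sigma_additive S (fun j => by
    rcases j with _ | _ | j <;> simp [S, hA, hB]) hd'
    (by rw [hS]; exact (measure_union_le _ _).trans_lt (ENNReal.add_lt_top.2 ⟨hAm, hBm⟩))
  filter_upwards [h, hM.empty_ae_eq] with ω h1 h2
  rw [hS] at h1
  refine tendsto_nhds_unique h1 (tendsto_const_nhds.congr' ?_)
  filter_upwards [eventually_ge_atTop 2] with n hn
  obtain ⟨k, rfl⟩ := Nat.exists_eq_add_of_le hn
  rw [Finset.sum_range_add, Finset.sum_eq_zero (s := Finset.range k)]
  · simp [Finset.sum_range_succ, S]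
  · intro j _
    simp [S, h2, show 2 + j ≠ 1 by omega]

lemma biUnion_ae_eq (hM : IsGaussianRandomMeasure P m M) {ι : Type*} (s : Finset ι) {A : ι → Set E}
    (hA : ∀ i ∈ s, MeasurableSet (A i)) (hm : ∀ i ∈ s, m (A i) < ∞)
    (hd : (s : Set ι).PairwiseDisjoint A) :
    ∀ᵐ ω ∂P, M (⋃ i ∈ s, A i) ω = ∑ i ∈ s, M (A i) ω := by
  classical
  induction s using Finset.induction_on with
  | empty => simpa using hM.empty_ae_eq
  | insert a s ha ih =>
    have ih' := ih (fun i hi => hA i (Finset.mem_insert_of_mem hi))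
      (fun i hi => hm i (Finset.mem_insert_of_mem hi))
      (hd.subset (by simp))
    have h2 := hM.union_ae_eq (A := A a) (B := ⋃ i ∈ s, A i) (hA a (Finset.mem_insert_self _ _))
      (Finset.measurableSet_biUnion s fun i hi => hA i (Finset.mem_insert_of_mem hi))
      (hm a (Finset.mem_insert_self _ _))
      ((measure_biUnion_finset_le s A).trans_lt
        (ENNReal.sum_lt_top.2 fun i hi => hm i (Finset.mem_insert_of_mem hi))) (by
        rw [disjoint_iUnion₂_right]
        intro i hi
        exact hd (by simp) (by simp [hi]) (by rintro rfl; exact ha hi))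
    filter_upwards [ih', h2] with ω h3 h4
    rw [Finset.set_biUnion_insert, h4, h3, Finset.sum_insert ha]

/-- The integral of a simple function may be computed on any finer partition. -/
lemma simpleGaussianIntegral_map_ae_eq (hM : IsGaussianRandomMeasure P m M) {F : Type*}
    (χ : SimpleFunc E F) (f : F → ℝ) (hχ : ∀ z, f z ≠ 0 → m (χ ⁻¹' {z}) < ∞) :
    ∀ᵐ ω ∂P, simpleGaussianIntegral M (χ.map f) ω = ∑ z ∈ χ.range, f z * M (χ ⁻¹' {z}) ω := by
  classical
  have h : ∀ᵐ ω ∂P, ∀ c ∈ (χ.map f).range, c ≠ 0 →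
      M (χ.map f ⁻¹' {c}) ω = ∑ z ∈ χ.range with f z = c, M (χ ⁻¹' {z}) ω := by
    refine (Finset.eventually_all _).2 fun c _ => ?_
    by_cases hc : c = 0
    · simp [hc]
    have := hM.biUnion_ae_eq (χ.range.filter fun z => f z = c) (A := fun z => χ ⁻¹' {z})
      (fun z _ => χ.measurableSet_preimage _) (fun z hz => hχ z (by
        rw [(Finset.mem_filter.1 hz).2]; exact hc))
      (fun z _ z' _ hz => (disjoint_singleton.2 hz).preimage χ)
    filter_upwards [this] with ω h1 _
    rw [← h1, SimpleFunc.map_preimage_singleton]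
    congr 1
    ext x; simp
  filter_upwards [h] with ω hω
  unfold simpleGaussianIntegral
  rw [SimpleFunc.range_map]
  refine Finset.sum_image' _ fun z hz => ?_
  by_cases hc : f z = 0
  · rw [hc, zero_mul]
    refine (Finset.sum_eq_zero fun y hy => ?_).symm
    rw [(Finset.mem_filter.1 hy).2, zero_mul]
  · rw [hω _ (by rw [SimpleFunc.range_map]; exact Finset.mem_image_of_mem f hz) hc,
      Finset.mul_sum]
    refine Finset.sum_congr rfl fun y hy => ?_
    rw [(Finset.mem_filter.1 hy).2]

lemma simpleGaussianIntegral_linear_ae_eq (hM : IsGaussianRandomMeasure P m M)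
    {φ ψ : SimpleFunc E ℝ} (hφ : φ.FinMeasSupp m) (hψ : ψ.FinMeasSupp m) (a b : ℝ) :
    ∀ᵐ ω ∂P, simpleGaussianIntegral M ((φ.pair ψ).map fun z => a * z.1 + b * z.2) ω =
      a * simpleGaussianIntegral M φ ω + b * simpleGaussianIntegral M ψ ω := by
  have hp := hφ.pair hψ
  have h1 := hM.simpleGaussianIntegral_map_ae_eq (φ.pair ψ) (fun z => a * z.1 + b * z.2)
    (fun z hz => hp.meas_preimage_singleton_ne_zero (by rintro rfl; simp at hz))
  have h2 := hM.simpleGaussianIntegral_map_ae_eq (φ.pair ψ) Prod.fst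
    (fun z hz => hp.meas_preimage_singleton_ne_zero (by rintro rfl; simp at hz))
  have h3 := hM.simpleGaussianIntegral_map_ae_eq (φ.pair ψ) Prod.snd
    (fun z hz => hp.meas_preimage_singleton_ne_zero (by rintro rfl; simp at hz))
  rw [SimpleFunc.map_fst_pair] at h2
  rw [SimpleFunc.map_snd_pair] at h3
  filter_upwards [h1, h2, h3] with ω h1 h2 h3
  rw [h1, h2, h3, Finset.mul_sum, Finset.mul_sum, ← Finset.sum_add_distrib]
  exact Finset.sum_congr rfl fun z _ => by ring

lemma measurable_simpleGaussianIntegral (hM : IsGaussianRandomMeasure P m M) {φ : SimpleFunc E ℝ}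
    (hφ : φ.FinMeasSupp m) : Measurable (simpleGaussianIntegral M φ) := by
  rw [show simpleGaussianIntegral M φ = _ from funext (simpleGaussianIntegral_eq_filter φ)]
  refine Finset.measurable_sum _ fun c hc => ?_
  exact (hM.measurable _ (φ.measurableSet_preimage _)
    (hφ.meas_preimage_singleton_ne_zero (Finset.mem_filter.1 hc).2)).const_mul _

/-- The variance of the integral of a simple function, written over its nonzero values. -/
lemma integral_sq_simpleFunc {φ : SimpleFunc E ℝ} (hφ : φ.FinMeasSupp m) :
    ∫ x, φ x ^ 2 ∂m = ∑ c ∈ φ.range with c ≠ 0, c ^ 2 * m.real (φ ⁻¹' {c}) := by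
  have h1 : (fun x => φ x ^ 2) = φ.map (fun c => c ^ 2) := by ext; simp
  have h2 : Integrable φ m := SimpleFunc.integrable_iff_finMeasSupp.2 hφ
  have h3 : Integrable (φ.map fun c => c ^ 2) m :=
    SimpleFunc.integrable_iff_finMeasSupp.2 (hφ.map (by simp))
  rw [h1, ← SimpleFunc.integral_eq_integral _ h3, SimpleFunc.map_integral _ _ h2 (by simp)]
  rw [Finset.sum_filter_of_ne]
  · exact Finset.sum_congr rfl fun c _ => by rw [smul_eq_mul, mul_comm]
  · rintro c - h rfl
    simp at h

/-- The integral of a simple function is a sum of independent centred normal variables, hence centred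
normal with variance `∫ φ²`. -/
lemma charFun_map_simpleGaussianIntegral [IsProbabilityMeasure P]
    (hM : IsGaussianRandomMeasure P m M) {φ : SimpleFunc E ℝ} (hφ : φ.FinMeasSupp m) (ξ : ℝ) :
    charFun (P.map (simpleGaussianIntegral M φ)) ξ =
      Complex.exp (-((∫ x, φ x ^ 2 ∂m : ℝ) * ξ ^ 2 / 2)) := by
  set s := φ.range.filter (fun c => c ≠ 0) with hs
  let e := s.equivFin
  let A : Fin s.card → Set E := fun j => φ ⁻¹' {(e.symm j : ℝ)}
  have hA : ∀ j, MeasurableSet (A j) := fun j => φ.measurableSet_preimage _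
  have hAm : ∀ j, m (A j) < ∞ := fun j =>
    hφ.meas_preimage_singleton_ne_zero (Finset.mem_filter.1 (e.symm j).2).2
  have hd : Pairwise fun j k => Disjoint (A j) (A k) := fun j k hjk =>
    (disjoint_singleton.2 fun h => hjk (e.symm.injective (Subtype.ext h))).preimage φ
  have hind := (hM.indep _ A hA hAm hd).comp (fun j x => (e.symm j : ℝ) * x) fun j => by fun_prop
  have hmeas : ∀ j, Measurable (fun ω => (e.symm j : ℝ) * M (A j) ω) := fun j =>
    (hM.measurable _ (hA j) (hAm j)).const_mul _
  have hsum : simpleGaussianIntegral M φ = ∑ j, fun ω => (e.symm j : ℝ) * M (A j) ω := by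
    ext ω
    rw [simpleGaussianIntegral_eq_filter, Finset.sum_apply, ← hs, ← Finset.sum_coe_sort,
      ← e.symm.sum_comp]
  have hlaw : ∀ j, charFun (P.map fun ω => (e.symm j : ℝ) * M (A j) ω) ξ =
      Complex.exp (-(((e.symm j : ℝ) ^ 2 * m.real (A j) : ℝ) * ξ ^ 2 / 2)) := by
    intro j
    have : P.map (fun ω => (e.symm j : ℝ) * M (A j) ω) =
        (P.map (M (A j))).map fun x => (e.symm j : ℝ) * x := by
      rw [Measure.map_map (by fun_prop) (hM.measurable _ (hA j) (hAm j))]; rfl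
    rw [this, charFun_map_mul, hM.law _ (hA j) (hAm j), charFun_gaussianReal]
    congr 1
    simp only [Complex.ofReal_zero, mul_zero, zero_mul, zero_sub, Measure.real,
      ENNReal.coe_toNNReal_eq_toReal, Complex.ofReal_mul, Complex.ofReal_pow]
    ring
  have hprod := iIndepFun.charFun_map_sum_eq_prod (fun j => (hmeas j).aemeasurable) hind
  rw [hsum]
  have h2 := congrFun hprod ξ
  rw [Finset.prod_apply] at h2
  refine h2.trans ?_
  simp only [Function.comp_def] at *
  simp_rw [hlaw]
  have hv : ∑ c ∈ s, c ^ 2 * m.real (φ ⁻¹' {c}) = ∑ j, (e.symm j : ℝ) ^ 2 * m.real (A j) := by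
    rw [← Finset.sum_coe_sort, ← e.symm.sum_comp]
  rw [← Complex.exp_sum, integral_sq_simpleFunc hφ, ← hs, hv]
  congr 1
  rw [Finset.sum_neg_distrib, ← Finset.sum_div, ← Finset.sum_mul]
  push_cast
  rfl

end IsGaussianRandomMeasure

namespace IsGaussianIntegral

variable {Ω E : Type*} [MeasurableSpace Ω] [MeasurableSpace E] {P : Measure Ω}
  {m : Measure E} {M : Set E → Ω → ℝ}

/-- Integration is linear: combine the approximating simple functions on a common refinement. -/
lemma linear (hM : IsGaussianRandomMeasure P m M) {h k : E → ℝ} {I J : Ω → ℝ}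
    (hI : IsGaussianIntegral P m M h I) (hJ : IsGaussianIntegral P m M k J) (a b : ℝ) :
    IsGaussianIntegral P m M (fun x => a * h x + b * k x) (fun ω => a * I ω + b * J ω) where
  memLp := (hI.memLp.const_mul a).add (hJ.memLp.const_mul b)
  aemeasurable := (hI.aemeasurable.const_mul a).add (hJ.aemeasurable.const_mul b)
  approx := by
    obtain ⟨φ, hφ, hφh, hφI⟩ := hI.approx
    obtain ⟨ψ, hψ, hψk, hψJ⟩ := hJ.approx
    have hlim : ∀ {u v : ℕ → ℝ≥0∞}, Tendsto u atTop (𝓝 0) → Tendsto v atTop (𝓝 0) →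
        Tendsto (fun n => ‖a‖ₑ * u n + ‖b‖ₑ * v n) atTop (𝓝 0) := fun hu hv => by
      simpa using (ENNReal.Tendsto.const_mul hu (Or.inr (by simp))).add
        (ENNReal.Tendsto.const_mul hv (Or.inr (by simp)))
    refine ⟨fun n => ((φ n).pair (ψ n)).map fun z => a * z.1 + b * z.2,
      fun n => ((hφ n).pair (hψ n)).map (by simp), ?_, ?_⟩
    · refine tendsto_of_tendsto_of_tendsto_of_le_of_le tendsto_const_nhds (hlim hφh hψk)
        (fun _ => zero_le) fun n => ?_
      have h1 : (fun x => (((φ n).pair (ψ n)).map fun z => a * z.1 + b * z.2) x -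
          (a * h x + b * k x)) =
          (a • fun x => φ n x - h x) + (b • fun x => ψ n x - k x) := by
        ext x
        simp only [SimpleFunc.map_apply, SimpleFunc.pair_apply, Pi.add_apply, Pi.smul_apply,
          smul_eq_mul]
        ring
      have h2 : AEStronglyMeasurable (fun x => φ n x - h x) m :=
        (φ n).aestronglyMeasurable.sub hI.memLp.1
      have h3 : AEStronglyMeasurable (fun x => ψ n x - k x) m :=
        (ψ n).aestronglyMeasurable.sub hJ.memLp.1
      rw [h1]
      refine (eLpNorm_add_le (h2.const_smul a) (h3.const_smul b) (by norm_num)).trans ?_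
      rw [eLpNorm_const_smul, eLpNorm_const_smul]
    · refine tendsto_of_tendsto_of_tendsto_of_le_of_le tendsto_const_nhds (hlim hφI hψJ)
        (fun _ => zero_le) fun n => ?_
      have h1 : (fun ω => simpleGaussianIntegral M
          (((φ n).pair (ψ n)).map fun z => a * z.1 + b * z.2) ω - (a * I ω + b * J ω)) =ᵐ[P]
          (a • fun ω => simpleGaussianIntegral M (φ n) ω - I ω) +
            (b • fun ω => simpleGaussianIntegral M (ψ n) ω - J ω) := by
        filter_upwards [hM.simpleGaussianIntegral_linear_ae_eq (hφ n) (hψ n) a b] with ω hω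
        simp only [hω, Pi.add_apply, Pi.smul_apply, smul_eq_mul]
        ring
      have h2 : AEStronglyMeasurable (fun ω => simpleGaussianIntegral M (φ n) ω - I ω) P :=
        ((hM.measurable_simpleGaussianIntegral (hφ n)).aemeasurable.sub
          hI.aemeasurable).aestronglyMeasurable
      have h3 : AEStronglyMeasurable (fun ω => simpleGaussianIntegral M (ψ n) ω - J ω) P :=
        ((hM.measurable_simpleGaussianIntegral (hψ n)).aemeasurable.sub
          hJ.aemeasurable).aestronglyMeasurable
      rw [eLpNorm_congr_ae h1]
      refine (eLpNorm_add_le (h2.const_smul a) (h3.const_smul b) (by norm_num)).trans ?_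
      rw [eLpNorm_const_smul, eLpNorm_const_smul]

lemma zero : IsGaussianIntegral P m M (fun _ => 0) (fun _ => 0) where
  memLp := MemLp.zero
  aemeasurable := aemeasurable_const
  approx := by
    refine ⟨fun _ => 0, fun _ => by simp [SimpleFunc.finMeasSupp_iff_support], ?_, ?_⟩
    · simp
    · have : (fun ω => simpleGaussianIntegral M (0 : SimpleFunc E ℝ) ω - 0) = fun _ => 0 := by
        ext ω
        rw [simpleGaussianIntegral_eq_filter, sub_zero]
        refine Finset.sum_eq_zero fun c hc => absurd ?_ (Finset.mem_filter.1 hc).2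
        obtain ⟨x, hx⟩ := SimpleFunc.mem_range.1 (Finset.mem_filter.1 hc).1
        simpa using hx.symm
      simp only [this]
      simp

lemma sum (hM : IsGaussianRandomMeasure P m M) {ι : Type*} (s : Finset ι) (c : ι → ℝ)
    {h : ι → E → ℝ} {I : ι → Ω → ℝ} (hI : ∀ i ∈ s, IsGaussianIntegral P m M (h i) (I i)) :
    IsGaussianIntegral P m M (fun x => ∑ i ∈ s, c i * h i x) (fun ω => ∑ i ∈ s, c i * I i ω) := by
  classical
  induction s using Finset.induction_on with
  | empty => simpa using zero
  | insert a s ha ih =>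
    simp only [Finset.sum_insert ha]
    simpa using linear hM (hI a (Finset.mem_insert_self _ _))
      (ih fun i hi => hI i (Finset.mem_insert_of_mem hi)) (c a) 1

end IsGaussianIntegral

lemma integral_sq_eq_norm_toLp_sq {E : Type*} [MeasurableSpace E] {m : Measure E} {f : E → ℝ}
    (hf : MemLp f 2 m) : ∫ x, f x ^ 2 ∂m = ‖hf.toLp f‖ ^ 2 := by
  rw [← real_inner_self_eq_norm_sq, L2.inner_def]
  refine integral_congr_ae ?_
  filter_upwards [hf.coeFn_toLp] with x hx
  simp [hx, sq]

lemma tendsto_integral_sq {E : Type*} [MeasurableSpace E] {m : Measure E} {f : ℕ → E → ℝ}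
    {g : E → ℝ} (hf : ∀ n, MemLp (f n) 2 m) (hg : MemLp g 2 m)
    (h : Tendsto (fun n => eLpNorm (fun x => f n x - g x) 2 m) atTop (𝓝 0)) :
    Tendsto (fun n => ∫ x, f n x ^ 2 ∂m) atTop (𝓝 (∫ x, g x ^ 2 ∂m)) := by
  simp_rw [fun n => integral_sq_eq_norm_toLp_sq (hf n), integral_sq_eq_norm_toLp_sq hg]
  exact (((Lp.tendsto_Lp_iff_tendsto_eLpNorm'' f hf g hg).2 h).norm).pow 2

lemma tendsto_charFun_of_tendsto_eLpNorm {Ω : Type*} [MeasurableSpace Ω] {P : Measure Ω}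
    [IsProbabilityMeasure P] {X : ℕ → Ω → ℝ} {Y : Ω → ℝ} (hX : ∀ n, AEMeasurable (X n) P)
    (hY : AEMeasurable Y P) (h : Tendsto (fun n => eLpNorm (X n - Y) 2 P) atTop (𝓝 0)) (ξ : ℝ) :
    Tendsto (fun n => charFun (P.map (X n)) ξ) atTop (𝓝 (charFun (P.map Y) ξ)) := by
  have h1 : TendstoInMeasure P X atTop Y := tendstoInMeasure_of_tendsto_eLpNorm (by norm_num)
    (fun n => (hX n).aestronglyMeasurable) hY.aestronglyMeasurable h
  have h2 := (h1.tendstoInDistribution_of_aemeasurable hX hY).tendsto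
  exact ProbabilityMeasure.tendsto_iff_tendsto_charFun.1 h2 ξ

lemma charFun_centred_gaussianReal {v : ℝ} (hv : 0 ≤ v) (ξ : ℝ) :
    charFun (gaussianReal 0 v.toNNReal) ξ = Complex.exp (-(v * ξ ^ 2 / 2)) := by
  rw [charFun_gaussianReal]
  simp [Real.coe_toNNReal _ hv]

lemma map_eq_gaussianReal_of_charFun {Ω : Type*} [MeasurableSpace Ω] {P : Measure Ω}
    [IsProbabilityMeasure P] {Y : Ω → ℝ} (hY : AEMeasurable Y P) {v : ℝ} (hv : 0 ≤ v)
    (h : ∀ ξ : ℝ, charFun (P.map Y) ξ = Complex.exp (-(v * ξ ^ 2 / 2))) :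
    P.map Y = gaussianReal 0 v.toNNReal := by
  have := Measure.isProbabilityMeasure_map hY
  refine Measure.ext_of_charFun (funext fun ξ => ?_)
  rw [h, charFun_centred_gaussianReal hv]

lemma charFun_map_sum_simpleGaussianIntegral {Ω E : Type*} [MeasurableSpace Ω]
    [MeasurableSpace E] {P : Measure Ω} [IsProbabilityMeasure P] {m : Measure E} {d : ℕ}
    {M : Fin d → Set E → Ω → ℝ} (hM : ∀ i, IsGaussianRandomMeasure P m (M i))
    (hind : iIndepFun (fun i ω =>
      fun A : {A : Set E // MeasurableSet A ∧ m A < ∞} => M i A.1 ω) P)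
    {φ : Fin d → SimpleFunc E ℝ} (hφ : ∀ i, (φ i).FinMeasSupp m) (ξ : ℝ) :
    charFun (P.map (∑ i, simpleGaussianIntegral (M i) (φ i))) ξ =
      ∏ i, Complex.exp (-((∫ x, φ i x ^ 2 ∂m : ℝ) * ξ ^ 2 / 2)) := by
  classical
  -- the `i`-th integral is a measurable function `G i` of the values of the `i`-th measure
  let G : (i : Fin d) → ({A : Set E // MeasurableSet A ∧ m A < ∞} → ℝ) → ℝ := fun i x =>
    ∑ c ∈ (φ i).range with c ≠ 0, c * if hc : MeasurableSet ((φ i) ⁻¹' {c}) ∧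
      m ((φ i) ⁻¹' {c}) < ∞ then x ⟨_, hc⟩ else 0
  have hG : ∀ i, Measurable (G i) := by
    intro i
    refine Finset.measurable_sum _ fun c _ => Measurable.const_mul ?_ _
    split_ifs
    · exact measurable_pi_apply _
    · exact measurable_const
  have hGe : (fun i => simpleGaussianIntegral (M i) (φ i)) = fun i => G i ∘ fun ω =>
      fun A : {A : Set E // MeasurableSet A ∧ m A < ∞} => M i A.1 ω := by
    ext i ω
    rw [simpleGaussianIntegral_eq_filter]
    refine Finset.sum_congr rfl fun c hc => ?_
    rw [dif_pos ⟨(φ i).measurableSet_preimage _,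
      (hφ i).meas_preimage_singleton_ne_zero (Finset.mem_filter.1 hc).2⟩]
  have hi : iIndepFun (fun i => simpleGaussianIntegral (M i) (φ i)) P := by
    rw [hGe]; exact hind.comp G hG
  rw [iIndepFun.charFun_map_sum_eq_prod
    (fun i => ((hM i).measurable_simpleGaussianIntegral (hφ i)).aemeasurable) hi,
    Finset.prod_apply]
  exact Finset.prod_congr rfl fun i _ => (hM i).charFun_map_simpleGaussianIntegral (hφ i) ξ

/-- The integrals of one function with respect to independent Gaussian random measures with the
same control measure sum to a centred normal variable. -/
lemma map_sum_gaussianIntegral {Ω E : Type*} [MeasurableSpace Ω] [MeasurableSpace E]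
    {P : Measure Ω} [IsProbabilityMeasure P] {m : Measure E} {d : ℕ}
    {M : Fin d → Set E → Ω → ℝ} (hM : ∀ i, IsGaussianRandomMeasure P m (M i))
    (hind : iIndepFun (fun i ω =>
      fun A : {A : Set E // MeasurableSet A ∧ m A < ∞} => M i A.1 ω) P)
    {h : E → ℝ} {R : Fin d → Ω → ℝ} (hh : MemLp h 2 m)
    (hR : ∀ i, IsGaussianIntegral P m (M i) h (R i)) :
    P.map (fun ω => ∑ i, R i ω) = gaussianReal 0 (d * ∫ x, h x ^ 2 ∂m).toNNReal := by
  have hv : 0 ≤ d * ∫ x, h x ^ 2 ∂m :=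
    mul_nonneg (by positivity) (integral_nonneg fun x => by positivity)
  choose φ hφ hφh hφR using fun i => (hR i).approx
  have hmeas : ∀ i n, Measurable (simpleGaussianIntegral (M i) (φ i n)) := fun i n =>
    (hM i).measurable_simpleGaussianIntegral (hφ i n)
  have hsum : (fun ω => ∑ i, R i ω) = ∑ i, R i := by ext ω; simp
  have hRm : AEMeasurable (fun ω => ∑ i, R i ω) P :=
    Finset.aemeasurable_fun_sum _ fun i _ => (hR i).aemeasurable
  refine map_eq_gaussianReal_of_charFun hRm hv fun ξ => ?_
  -- the approximating sums converge in `L²`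
  have h1 : Tendsto (fun n => eLpNorm ((∑ i, simpleGaussianIntegral (M i) (φ i n)) -
      fun ω => ∑ i, R i ω) 2 P) atTop (𝓝 0) := by
    have h0 : Tendsto (fun n => ∑ i, eLpNorm (fun ω => simpleGaussianIntegral (M i) (φ i n) ω -
        R i ω) 2 P) atTop (𝓝 0) := by
      simpa using tendsto_finsetSum Finset.univ fun i _ => hφR i
    refine tendsto_of_tendsto_of_tendsto_of_le_of_le tendsto_const_nhds h0
      (fun _ => zero_le) fun n => ?_
    rw [hsum, ← Finset.sum_sub_distrib]
    exact eLpNorm_sum_le (fun i _ => ((hmeas i n).aemeasurable.sub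
      (hR i).aemeasurable).aestronglyMeasurable) (by norm_num)
  have hXm : ∀ n, AEMeasurable (∑ i, simpleGaussianIntegral (M i) (φ i n)) P := fun n =>
    Finset.aemeasurable_sum _ fun i _ => (hmeas i n).aemeasurable
  have h2 := tendsto_charFun_of_tendsto_eLpNorm
    (X := fun n => ∑ i, simpleGaussianIntegral (M i) (φ i n)) hXm hRm h1 ξ
  have h4 : Tendsto (fun n => ∏ i, Complex.exp (-((∫ x, φ i n x ^ 2 ∂m : ℝ) * ξ ^ 2 / 2))) atTop
      (𝓝 (∏ _i : Fin d, Complex.exp (-((∫ x, h x ^ 2 ∂m : ℝ) * ξ ^ 2 / 2)))) := by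
    refine tendsto_finsetProd _ fun i _ => ?_
    have h5 := tendsto_integral_sq (fun n => (SimpleFunc.memLp_iff_finMeasSupp (by norm_num)
      (by norm_num)).2 (hφ i n)) hh (hφh i)
    have h6 : Continuous fun v : ℝ => Complex.exp (-((v : ℂ) * ξ ^ 2 / 2)) := by fun_prop
    exact (h6.tendsto _).comp h5
  simp_rw [fun n => charFun_map_sum_simpleGaussianIntegral hM hind (fun i => hφ i n) ξ] at h2
  rw [tendsto_nhds_unique h2 h4, Finset.prod_const, Finset.card_univ, Fintype.card_fin,
    ← Complex.exp_nat_mul]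
  congr 1
  push_cast
  ring

/-- Averages over `d` independent Gaussian random measures of finite linear combinations of
integrals are centred normal, with variance given by the `L²`-norm of the integrand. -/
lemma map_sum_average_gaussianIntegral {Ω E : Type*} [MeasurableSpace Ω] [MeasurableSpace E]
    {P : Measure Ω} [IsProbabilityMeasure P] {m : Measure E} {d : ℕ} (hd : 0 < d)
    {M : Fin d → Set E → Ω → ℝ} (hM : ∀ i, IsGaussianRandomMeasure P m (M i))
    (hind : iIndepFun (fun i ω =>
      fun A : {A : Set E // MeasurableSet A ∧ m A < ∞} => M i A.1 ω) P)
    {ι : Type*} (s : Finset ι) (c : ι → ℝ) {h : ι → E → ℝ} {R : ι → Fin d → Ω → ℝ}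
    (hh : ∀ j ∈ s, MemLp (h j) 2 m)
    (hR : ∀ j ∈ s, ∀ i, IsGaussianIntegral P m (M i) (h j) (R j i)) :
    P.map (fun ω => ∑ j ∈ s, c j * ((d : ℝ)⁻¹ * ∑ i, R j i ω)) =
      gaussianReal 0 ((d : ℝ)⁻¹ * ∫ x, (∑ j ∈ s, c j * h j x) ^ 2 ∂m).toNNReal := by
  have hd' : (d : ℝ) ≠ 0 := by positivity
  have h1 := map_sum_gaussianIntegral hM hind (h := fun x => ∑ j ∈ s, ((d : ℝ)⁻¹ * c j) * h j x)
    (R := fun i ω => ∑ j ∈ s, ((d : ℝ)⁻¹ * c j) * R j i ω)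
    (memLp_finsetSum s fun j hj => (hh j hj).const_mul _)
    (fun i => IsGaussianIntegral.sum (hM i) s _ fun j hj => hR j hj i)
  have e1 : (fun ω => ∑ j ∈ s, c j * ((d : ℝ)⁻¹ * ∑ i, R j i ω)) =
      fun ω => ∑ i, ∑ j ∈ s, ((d : ℝ)⁻¹ * c j) * R j i ω := by
    ext ω
    rw [Finset.sum_comm]
    refine Finset.sum_congr rfl fun j _ => ?_
    rw [← Finset.mul_sum]
    ring
  rw [e1, h1]
  congr 2
  have : ∀ x, (∑ j ∈ s, ((d : ℝ)⁻¹ * c j) * h j x) ^ 2 =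
      (d : ℝ)⁻¹ ^ 2 * (∑ j ∈ s, c j * h j x) ^ 2 := by
    intro x
    rw [← mul_pow, Finset.mul_sum]
    simp_rw [mul_assoc]
  simp_rw [this]
  rw [integral_const_mul]
  field_simp

/-! ### Time integrals of Gaussian paths -/

/-- The weight `∫ ρ` over the part of `(0, T]` where the dyadic floor of order `n` is `k / 2ⁿ`. -/
def dyadicWeight (ρ : ℝ → ℝ) (T : ℝ) (n k : ℕ) : ℝ :=
  ∫ r in (0 : ℝ)..T, if ⌊r.toNNReal * 2 ^ n⌋₊ = k then ρ r else 0

lemma measurable_floor_toNNReal (n : ℕ) : Measurable fun r : ℝ => ⌊r.toNNReal * 2 ^ n⌋₊ :=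
  Nat.measurable_floor.comp (measurable_real_toNNReal.mul_const _)

lemma intervalIntegral_dyadicFloor_eq {ρ : ℝ → ℝ} (hρ : Continuous ρ) (T : ℝ≥0) (n : ℕ)
    (f : ℝ≥0 → ℝ) :
    ∫ r in (0 : ℝ)..T, ρ r * f (dyadicFloor n r.toNNReal) =
      ∑ k ∈ Finset.range (⌊T * 2 ^ n⌋₊ + 1), dyadicWeight ρ T n k * f (dyadic n k) := by
  unfold dyadicWeight
  simp_rw [← intervalIntegral.integral_mul_const]
  rw [← intervalIntegral.integral_finsetSum]
  · refine intervalIntegral.integral_congr fun r hr => ?_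
    rw [uIcc_of_le T.coe_nonneg] at hr
    have hr' : ⌊r.toNNReal * 2 ^ n⌋₊ ∈ Finset.range (⌊T * 2 ^ n⌋₊ + 1) := by
      rw [Finset.mem_range, Nat.lt_succ_iff]
      refine Nat.floor_le_floor ?_
      gcongr
      exact Real.toNNReal_le_iff_le_coe.2 hr.2
    simp only [ite_mul, zero_mul]
    rw [Finset.sum_ite_eq, if_pos hr']
    rfl
  · intro k _
    refine IntervalIntegrable.mul_const ?_ _
    have h1 : IntervalIntegrable ρ volume 0 T := hρ.intervalIntegrable _ _
    refine h1.mono_fun ?_ (.of_forall fun r => ?_)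
    · exact ((Measurable.ite ((measurable_floor_toNNReal n) (measurableSet_singleton k))
        hρ.measurable measurable_const)).aestronglyMeasurable
    · dsimp only
      split_ifs <;> simp

lemma tendsto_intervalIntegral_dyadicFloor {ρ : ℝ → ℝ} (hρ : Continuous ρ) (T : ℝ≥0)
    {f : ℝ≥0 → ℝ} (hf : Continuous f) :
    Tendsto (fun n => ∫ r in (0 : ℝ)..T, ρ r * f (dyadicFloor n r.toNNReal)) atTop
      (𝓝 (∫ r in (0 : ℝ)..T, ρ r * f r.toNNReal)) := by
  obtain ⟨B, hB⟩ := (isCompact_Icc (a := (0 : ℝ≥0)) (b := T)).exists_bound_of_continuousOn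
    hf.continuousOn
  refine intervalIntegral.tendsto_integral_filter_of_dominated_convergence
    (fun r => |ρ r| * B) (.of_forall fun n => ?_) (.of_forall fun n => .of_forall fun r hr => ?_) ?_
    (.of_forall fun r _ => ?_)
  · have h1 : Measurable fun r : ℝ => dyadicFloor n r.toNNReal := by
      unfold dyadicFloor dyadic
      exact (Measurable.comp (by fun_prop : Measurable fun k : ℕ => (k : ℝ≥0))
        (measurable_floor_toNNReal n)).div_const _
    exact (hρ.measurable.mul (hf.measurable.comp h1)).aestronglyMeasurable
  · rw [uIoc_of_le T.coe_nonneg] at hr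
    rw [Real.norm_eq_abs, abs_mul]
    gcongr
    exact hB _ ⟨zero_le, (dyadicFloor_le _ _).trans (Real.toNNReal_le_iff_le_coe.2 hr.2)⟩
  · exact (hρ.abs.mul continuous_const).intervalIntegrable _ _
  · exact ((hf.tendsto _).comp (tendsto_dyadicFloor _)).const_mul _

lemma abs_intervalIntegral_dyadicFloor_le {ρ : ℝ → ℝ} (hρ : Continuous ρ) (T : ℝ≥0) (n : ℕ)
    {f : ℝ≥0 → ℝ} {B : ℝ} (hB : ∀ t ≤ T, |f t| ≤ B) :
    |∫ r in (0 : ℝ)..T, ρ r * f (dyadicFloor n r.toNNReal)| ≤ (∫ r in (0 : ℝ)..T, |ρ r|) * B := by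
  rw [← intervalIntegral.integral_mul_const, ← Real.norm_eq_abs]
  refine intervalIntegral.norm_integral_le_of_norm_le T.coe_nonneg (.of_forall fun r hr => ?_)
    ((hρ.abs.mul continuous_const).intervalIntegrable _ _)
  rw [Real.norm_eq_abs, abs_mul]
  gcongr
  exact hB _ ((dyadicFloor_le _ _).trans (Real.toNNReal_le_iff_le_coe.2 hr.2))

/-- If the finite linear combinations of `W(t)` are centred normal with the variances of the
corresponding combinations of the kernels `h(t)`, then the same holds for finite linear combinations
together with a time integral `∫₀ᵀ ρ(r) W(r) dr`: Riemann sums converge on both sides. -/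
theorem map_sum_add_integral_eq_gaussianReal {Ω E : Type*} [MeasurableSpace Ω] [MeasurableSpace E]
    {P : Measure Ω} [IsProbabilityMeasure P] {m : Measure E} {W : Ω → C(ℝ≥0, ℝ)}
    {h : ℝ≥0 → E → ℝ} {C : ℝ} (hC : 0 ≤ C) (hW : ∀ t, AEMeasurable (fun ω => W ω t) P)
    (hlaw : ∀ (ι : Type) (s : Finset ι) (τ : ι → ℝ≥0) (c : ι → ℝ),
      P.map (fun ω => ∑ j ∈ s, c j * W ω (τ j)) =
        gaussianReal 0 (C * ∫ x, (∑ j ∈ s, c j * h (τ j) x) ^ 2 ∂m).toNNReal)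
    (hm : ∀ t, AEStronglyMeasurable (h t) m) (hc : ∀ x, Continuous fun t => h t x)
    {K : ℝ≥0} {G : E → ℝ} (hG : MemLp G 2 m) (hb : ∀ t ≤ K, ∀ x, |h t x| ≤ G x)
    {ι : Type} (s : Finset ι) (τ : ι → ℝ≥0) (hτ : ∀ j ∈ s, τ j ≤ K) (c : ι → ℝ)
    {ρ : ℝ → ℝ} (hρ : Continuous ρ) {T : ℝ≥0} (hT : T ≤ K) :
    P.map (fun ω => (∑ j ∈ s, c j * W ω (τ j)) + ∫ r in (0 : ℝ)..T, ρ r * W ω r.toNNReal) =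
      gaussianReal 0 (C * ∫ x, ((∑ j ∈ s, c j * h (τ j) x) +
        ∫ r in (0 : ℝ)..T, ρ r * h r.toNNReal x) ^ 2 ∂m).toNNReal := by
  classical
  -- the approximations, as linear functionals of a function `f` of time
  let A : ℕ → (ℝ≥0 → ℝ) → ℝ := fun n f =>
    (∑ j ∈ s, c j * f (τ j)) + ∫ r in (0 : ℝ)..T, ρ r * f (dyadicFloor n r.toNNReal)
  let A' : (ℝ≥0 → ℝ) → ℝ := fun f =>
    (∑ j ∈ s, c j * f (τ j)) + ∫ r in (0 : ℝ)..T, ρ r * f r.toNNReal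
  let S : ℕ → Finset (ι ⊕ ℕ) := fun n => s.disjSum (Finset.range (⌊T * 2 ^ n⌋₊ + 1))
  let σ : ℕ → ι ⊕ ℕ → ℝ≥0 := fun n => Sum.elim τ (dyadic n)
  let e : ℕ → ι ⊕ ℕ → ℝ := fun n => Sum.elim c (dyadicWeight ρ T n)
  have hA : ∀ n f, A n f = ∑ j ∈ S n, e n j * f (σ n j) := by
    intro n f
    simp only [A, S, σ, e, Finset.sum_disjSum, Sum.elim_inl, Sum.elim_inr]
    rw [intervalIntegral_dyadicFloor_eq hρ]
  have hlim : ∀ f, Continuous f → Tendsto (fun n => A n f) atTop (𝓝 (A' f)) := fun f hf =>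
    tendsto_const_nhds.add (tendsto_intervalIntegral_dyadicFloor hρ T hf)
  have hAm : ∀ n, AEMeasurable (fun ω => A n (W ω)) P := by
    intro n
    simp_rw [hA]
    exact Finset.aemeasurable_fun_sum _ fun j _ => (hW _).const_mul _
  have hA'm : AEMeasurable (fun ω => A' (W ω)) P :=
    aemeasurable_of_tendsto_metrizable_ae atTop hAm
      (.of_forall fun ω => hlim _ (W ω).continuous)
  have hlawA : ∀ n, P.map (fun ω => A n (W ω)) =
      gaussianReal 0 (C * ∫ x, (A n fun t => h t x) ^ 2 ∂m).toNNReal := by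
    intro n
    simp_rw [hA]
    exact hlaw _ (S n) (σ n) (e n)
  have hv : Tendsto (fun n => C * ∫ x, (A n fun t => h t x) ^ 2 ∂m) atTop
      (𝓝 (C * ∫ x, (A' fun t => h t x) ^ 2 ∂m)) := by
    refine Tendsto.const_mul _ ?_
    set D : ℝ := (∑ j ∈ s, |c j|) + ∫ r in (0 : ℝ)..T, |ρ r| with hD
    refine tendsto_integral_of_dominated_convergence (fun x => D ^ 2 * G x ^ 2) (fun n => ?_)
      (hG.integrable_sq.const_mul _) (fun n => .of_forall fun x => ?_)
      (.of_forall fun x => (hlim _ (hc x)).pow 2)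
    · simp_rw [hA]
      exact (Finset.aestronglyMeasurable_fun_sum _ fun j _ => (hm _).const_mul _).pow 2
    · have hx : |A n fun t => h t x| ≤ D * G x := by
        refine (abs_add_le _ _).trans ?_
        rw [hD, add_mul, Finset.sum_mul]
        refine add_le_add ((Finset.abs_sum_le_sum_abs _ _).trans ?_)
          (abs_intervalIntegral_dyadicFloor_le hρ T n fun t ht => hb t (ht.trans hT) x)
        refine Finset.sum_le_sum fun j hj => ?_
        rw [abs_mul]
        gcongr
        exact hb _ (hτ j hj) x
      rw [Real.norm_eq_abs, abs_pow, ← mul_pow]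
      gcongr
  have hv0 : ∀ F : E → ℝ, 0 ≤ C * ∫ x, F x ^ 2 ∂m := fun F =>
    mul_nonneg hC (integral_nonneg fun x => by positivity)
  refine map_eq_gaussianReal_of_charFun hA'm (hv0 _) fun ξ => ?_
  have h1 := (tendstoInDistribution_of_ae_tendsto hAm hA'm
    (.of_forall fun ω => hlim _ (W ω).continuous)).tendsto
  have h2 := ProbabilityMeasure.tendsto_iff_tendsto_charFun.1 h1 ξ
  simp only [ProbabilityMeasure.coe_mk] at h2
  simp_rw [hlawA, fun n => charFun_centred_gaussianReal (hv0 fun x => A n fun t => h t x) ξ] at h2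
  have h3 : Continuous fun v : ℝ => Complex.exp (-((v : ℂ) * ξ ^ 2 / 2)) := by fun_prop
  exact tendsto_nhds_unique h2 ((h3.tendsto _).comp hv)

/-! ### Overlap of the sets of active sessions -/

/-- The pairs (start `s`, length `r`) of the sessions that are active at time `u`. -/
def activeAt (u : ℝ) : Set (ℝ × ℝ) := {p | 0 ≤ p.1 ∧ p.1 ≤ u ∧ u < p.1 + p.2}

lemma measurableSet_activeAt_uncurry :
    MeasurableSet {q : ℝ × (ℝ × ℝ) | q.2 ∈ activeAt q.1} := by
  have h1 : MeasurableSet {q : ℝ × (ℝ × ℝ) | 0 ≤ q.2.1} :=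
    measurableSet_le measurable_const (by fun_prop)
  have h2 : MeasurableSet {q : ℝ × (ℝ × ℝ) | q.2.1 ≤ q.1} :=
    measurableSet_le (by fun_prop) (by fun_prop)
  have h3 : MeasurableSet {q : ℝ × (ℝ × ℝ) | q.1 < q.2.1 + q.2.2} :=
    measurableSet_lt (by fun_prop) (by fun_prop)
  exact h1.inter (h2.inter h3)

lemma measurableSet_activeAt (u : ℝ) : MeasurableSet (activeAt u) :=
  measurableSet_activeAt_uncurry.preimage (measurable_prodMk_left (x := u))

instance sFinite_controlMeasure (β θ : ℝ) : SFinite (controlMeasure β θ) := by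
  unfold controlMeasure; infer_instance

lemma lengthMeasure_Ioi {β θ z : ℝ} (hβ : β ∈ Ioo (2 : ℝ) 3) (hθ : 0 < θ) (hz : 0 < z) :
    ((volume.restrict (Ici (0 : ℝ))).withDensity
      fun r => ENNReal.ofReal ((β - 1) * θ ^ (1 - β) * r ^ (-β))) (Ioi z) =
      ENNReal.ofReal (θ ^ (1 - β) * z ^ (1 - β)) := by
  obtain ⟨h2, h3⟩ := hβ
  rw [withDensity_apply _ measurableSet_Ioi, Measure.restrict_restrict measurableSet_Ioi,
    inter_eq_left.2 (show Ioi z ⊆ Ici 0 from fun r hr => hz.le.trans (le_of_lt hr)),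
    ← ofReal_integral_eq_lintegral_ofReal]
  · rw [integral_const_mul, integral_Ioi_rpow_of_lt (by linarith) hz]
    congr 1
    rw [show -β + 1 = 1 - β by ring]
    have : (1 - β) ≠ 0 := by linarith
    field_simp
    ring
  · exact (integrableOn_Ioi_rpow_of_lt (by linarith) hz).const_mul _
  · refine (ae_restrict_iff' measurableSet_Ioi).2 (.of_forall fun r hr => ?_)
    have : 0 < r := hz.trans hr
    have : 0 ≤ β - 1 := by linarith
    simp only [Pi.zero_apply]
    positivity

/-- The control measure of the sessions active at both times `u ≠ v`. -/
lemma controlMeasure_activeAt_inter {β θ u v : ℝ} (hβ : β ∈ Ioo (2 : ℝ) 3) (hθ : 0 < θ)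
    (hu : 0 ≤ u) (hv : 0 ≤ v) (huv : u ≠ v) :
    controlMeasure β θ (activeAt u ∩ activeAt v) =
      ENNReal.ofReal (θ ^ (1 - β) / (β - 2) * (|u - v| ^ (2 - β) - max u v ^ (2 - β))) := by
  wlog h : u < v generalizing u v
  · rw [inter_comm, abs_sub_comm, max_comm]
    exact this hv hu huv.symm (lt_of_le_of_ne (not_lt.1 h) huv.symm)
  have hslice : ∀ x : ℝ, ((volume.restrict (Ici (0 : ℝ))).withDensity
      fun r => ENNReal.ofReal ((β - 1) * θ ^ (1 - β) * r ^ (-β)))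
      (Prod.mk x ⁻¹' (activeAt u ∩ activeAt v)) =
      (Icc 0 u).indicator (fun x => ENNReal.ofReal (θ ^ (1 - β) * (v - x) ^ (1 - β))) x := by
    intro x
    by_cases hx : x ∈ Icc 0 u
    · rw [indicator_of_mem hx, ← lengthMeasure_Ioi hβ hθ (by linarith [hx.2] : 0 < v - x)]
      congr 1
      ext r
      simp only [activeAt, mem_preimage, mem_inter_iff, mem_ofPred_eq, mem_Ioi]
      constructor
      · rintro ⟨-, -, -, h⟩; linarith
      · intro hr
        exact ⟨⟨hx.1, hx.2, by linarith⟩, hx.1, by linarith [hx.2], by linarith⟩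
    · rw [indicator_of_notMem hx]
      convert measure_empty
      · ext r
        simp only [activeAt, mem_preimage, mem_inter_iff, mem_ofPred_eq, mem_empty_iff_false,
          iff_false]
        rintro ⟨⟨h1, h2, -⟩, -⟩
        exact hx ⟨h1, h2⟩
      · infer_instance
  rw [controlMeasure,
    Measure.prod_apply ((measurableSet_activeAt u).inter (measurableSet_activeAt v))]
  simp_rw [hslice]
  obtain ⟨h2, h3⟩ := hβ
  have hpos : ∀ x ∈ Icc 0 u, 0 < v - x := fun x hx => by linarith [hx.2]
  have hcont : ContinuousOn (fun x => θ ^ (1 - β) * (v - x) ^ (1 - β)) (Icc 0 u) :=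
    continuousOn_const.mul ((continuousOn_const.sub continuousOn_id).rpow_const
      fun x hx => Or.inl (hpos x hx).ne')
  rw [lintegral_indicator measurableSet_Icc, Measure.restrict_restrict measurableSet_Icc,
    inter_eq_left.2 (show Icc 0 u ⊆ Ici 0 from fun r hr => hr.1),
    ← ofReal_integral_eq_lintegral_ofReal]
  · rw [integral_Icc_eq_integral_Ioc, ← intervalIntegral.integral_of_le hu,
      intervalIntegral.integral_const_mul,
      intervalIntegral.integral_comp_sub_left (fun x => x ^ (1 - β)) v,
      integral_rpow (Or.inr ⟨by linarith, by
        rw [uIcc_of_le (by linarith)]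
        intro h0
        linarith [h0.1]⟩)]
    congr 1
    rw [max_eq_right h.le, abs_sub_comm, abs_of_pos (by linarith : 0 < v - u),
      show 1 - β + 1 = 2 - β by ring, sub_zero]
    have : 2 - β ≠ 0 := by linarith
    have : β - 2 ≠ 0 := by linarith
    field_simp
    ring
  · exact hcont.integrableOn_Icc
  · refine (ae_restrict_iff' measurableSet_Icc).2 (.of_forall fun x hx => ?_)
    have := hpos x hx
    simp only [Pi.zero_apply]
    positivity

lemma activeAt_of_neg {u : ℝ} (hu : u < 0) : activeAt u = ∅ := by
  ext p
  simp only [activeAt, mem_ofPred_eq, mem_empty_iff_false, iff_false]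
  rintro ⟨h1, h2, -⟩
  linarith

/-- The amount of work weighted by `q` that the session `p` does. -/
def weightedWork (q : ℝ → ℝ≥0∞) (p : ℝ × ℝ) : ℝ≥0∞ :=
  ∫⁻ u, q u * (activeAt u).indicator 1 p

lemma measurable_activeAt_indicator :
    Measurable fun q : ℝ × (ℝ × ℝ) => (activeAt q.1).indicator (1 : ℝ × ℝ → ℝ≥0∞) q.2 := by
  have : (fun q : ℝ × (ℝ × ℝ) => (activeAt q.1).indicator (1 : ℝ × ℝ → ℝ≥0∞) q.2) =
      {q : ℝ × (ℝ × ℝ) | q.2 ∈ activeAt q.1}.indicator 1 := by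
    ext q; simp [indicator]
  rw [this]
  exact measurable_one.indicator measurableSet_activeAt_uncurry

/-- Tonelli's theorem for the `L²` inner product of two amounts of work. -/
lemma lintegral_weightedWork_mul {m : Measure (ℝ × ℝ)} [SFinite m] {q q' : ℝ → ℝ≥0∞}
    (hq : Measurable q) (hq' : Measurable q') :
    ∫⁻ p, weightedWork q p * weightedWork q' p ∂m =
      ∫⁻ u, ∫⁻ v, q u * q' v * m (activeAt u ∩ activeAt v) := by
  have hA := measurable_activeAt_indicator
  have hm1 : Measurable fun z : (ℝ × ℝ) × ℝ => q z.2 * (activeAt z.2).indicator 1 z.1 :=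
    (hq.comp measurable_snd).mul (hA.comp measurable_swap)
  have hm2 : Measurable fun z : (ℝ × ℝ) × ℝ => q' z.2 * (activeAt z.2).indicator 1 z.1 :=
    (hq'.comp measurable_snd).mul (hA.comp measurable_swap)
  calc ∫⁻ p, weightedWork q p * weightedWork q' p ∂m
      = ∫⁻ p, (∫⁻ u, ∫⁻ v, (q u * (activeAt u).indicator 1 p) *
          (q' v * (activeAt v).indicator 1 p)) ∂m := by
        refine lintegral_congr fun p => ?_
        unfold weightedWork
        have h1 : Measurable fun u => q u * (activeAt u).indicator (1 : ℝ × ℝ → ℝ≥0∞) p :=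
          hm1.comp measurable_prodMk_left
        have h2 : Measurable fun u => q' u * (activeAt u).indicator (1 : ℝ × ℝ → ℝ≥0∞) p :=
          hm2.comp measurable_prodMk_left
        rw [← lintegral_mul_const _ h1]
        refine lintegral_congr fun u => ?_
        rw [← lintegral_const_mul _ h2]
    _ = ∫⁻ u, (∫⁻ p, (∫⁻ v, (q u * (activeAt u).indicator 1 p) *
          (q' v * (activeAt v).indicator 1 p)) ∂m) := by
        refine lintegral_lintegral_swap (Measurable.aemeasurable ?_)
        refine Measurable.lintegral_prod_right' (f := fun z : ((ℝ × ℝ) × ℝ) × ℝ =>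
          (q z.1.2 * (activeAt z.1.2).indicator 1 z.1.1) *
            (q' z.2 * (activeAt z.2).indicator 1 z.1.1)) ?_
        exact (hm1.comp measurable_fst).mul (hm2.comp (by fun_prop :
          Measurable fun z : ((ℝ × ℝ) × ℝ) × ℝ => (z.1.1, z.2)))
    _ = ∫⁻ u, ∫⁻ v, (∫⁻ p, (q u * (activeAt u).indicator 1 p) *
          (q' v * (activeAt v).indicator 1 p) ∂m) := by
        refine lintegral_congr fun u => lintegral_lintegral_swap (Measurable.aemeasurable ?_)
        exact (hm1.comp (by fun_prop : Measurable fun z : (ℝ × ℝ) × ℝ => (z.1, u))).mul hm2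
    _ = _ := by
        refine lintegral_congr fun u => lintegral_congr fun v => ?_
        have : ∀ p, (q u * (activeAt u).indicator 1 p) * (q' v * (activeAt v).indicator 1 p) =
            q u * q' v * (activeAt u ∩ activeAt v).indicator 1 p := by
          intro p
          rw [inter_indicator_one, Pi.mul_apply]
          ring
        simp_rw [this]
        have hs := (measurableSet_activeAt u).inter (measurableSet_activeAt v)
        rw [lintegral_const_mul _ (measurable_one.indicator hs), lintegral_indicator_one hs]

/-! ### The Riesz form -/

/-- The bilinear form `∬ q(x) q'(y) |x - y|^γ dx dy`. -/
def rieszForm (γ : ℝ) (q q' : ℝ → ℝ) : ℝ :=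
  ∫ z : ℝ × ℝ, q z.1 * q' z.2 * |z.1 - z.2| ^ γ

lemma integrable_indicator_abs_rpow {γ : ℝ} (hγ : -1 < γ) :
    Integrable ((Icc (-1 : ℝ) 1).indicator fun x => |x| ^ γ) := by
  rw [integrable_indicator_iff measurableSet_Icc]
  have h0 : IntegrableOn (fun x : ℝ => |x| ^ γ) (Ioc 0 1) := by
    have := (intervalIntegral.intervalIntegrable_rpow' (a := 0) (b := 1) hγ).1
    exact this.congr_fun (fun x hx => by simp only [abs_of_pos hx.1]) measurableSet_Ioc
  have h1 : IntegrableOn (fun x : ℝ => |x| ^ γ) (Icc 0 1) :=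
    (integrableOn_Icc_iff_integrableOn_Ioc (by finiteness)).2 h0
  have h2 : IntegrableOn (fun x : ℝ => |x| ^ γ) (Icc (-1) 0) := by
    have := (Measure.measurePreserving_neg (volume : Measure ℝ)).integrableOn_comp_preimage
      (Homeomorph.neg ℝ).measurableEmbedding (f := fun x : ℝ => |x| ^ γ) (s := Icc 0 1)
    have h := this.2 h1
    simpa [Function.comp_def] using h
  have := h2.union h1
  rwa [Icc_union_Icc_eq_Icc (by norm_num) (by norm_num)] at this

lemma measurable_riesz (γ : ℝ) : Measurable fun z : ℝ × ℝ => |z.1 - z.2| ^ γ := by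
  fun_prop

/-- Near the diagonal the kernel is integrable and `q' ≤ 1`; away from it the kernel is at most `1`. -/
lemma integrable_riesz {γ : ℝ} (hγ : -1 < γ) (hγ0 : γ ≤ 0) {q q' : ℝ → ℝ}
    (hq : Integrable q) (hq' : Integrable q') (hq0 : ∀ x, 0 ≤ q x) (hq0' : ∀ x, 0 ≤ q' x)
    (hq1' : ∀ x, q' x ≤ 1) :
    Integrable fun z : ℝ × ℝ => q z.1 * q' z.2 * |z.1 - z.2| ^ γ := by
  have h1 := hq.mul_prod hq'
  have h2 := (hq.convolution_integrand (ContinuousLinearMap.mul ℝ ℝ)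
    (integrable_indicator_abs_rpow hγ)).swap
  refine (h1.add h2).mono ?_ (.of_forall fun z => ?_)
  · exact h1.aestronglyMeasurable.mul (measurable_riesz γ).aestronglyMeasurable
  · have e : ((Icc (-1 : ℝ) 1).indicator fun x => |x| ^ γ) (z.2 - z.1) =
        if |z.1 - z.2| ≤ 1 then |z.1 - z.2| ^ γ else 0 := by
      rw [abs_sub_comm]
      simp only [indicator, mem_Icc, abs_le]
    have hqz := hq0 z.1
    have hqz' := hq0' z.2
    have hqz1 := hq1' z.2
    have hp : 0 ≤ |z.1 - z.2| ^ γ := Real.rpow_nonneg (abs_nonneg _) _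
    simp only [Pi.add_apply, Function.comp_apply, Prod.swap, ContinuousLinearMap.mul_apply', e,
      Real.norm_eq_abs]
    rw [abs_of_nonneg (by positivity)]
    refine le_trans ?_ (le_abs_self _)
    split_ifs with h
    · nlinarith [mul_nonneg hqz hqz', mul_nonneg hqz hp,
        mul_nonneg (mul_nonneg hqz hp) (sub_nonneg.2 hqz1)]
    · have : |z.1 - z.2| ^ γ ≤ 1 := Real.rpow_le_one_of_one_le_of_nonpos (not_le.1 h).le hγ0
      nlinarith [mul_nonneg hqz hqz']

/-- `rieszForm` as a Lebesgue integral. -/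
lemma lintegral_riesz {γ : ℝ} (hγ : -1 < γ) (hγ0 : γ ≤ 0) {q q' : ℝ → ℝ}
    (hq : Integrable q) (hq' : Integrable q') (hq0 : ∀ x, 0 ≤ q x) (hq0' : ∀ x, 0 ≤ q' x)
    (hq1' : ∀ x, q' x ≤ 1) :
    ∫⁻ z : ℝ × ℝ, ENNReal.ofReal (q z.1 * q' z.2 * |z.1 - z.2| ^ γ) =
      ENNReal.ofReal (rieszForm γ q q') := by
  rw [rieszForm, ofReal_integral_eq_lintegral_ofReal (integrable_riesz hγ hγ0 hq hq' hq0 hq0' hq1')]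
  refine .of_forall fun z => ?_
  have := hq0 z.1
  have := hq0' z.2
  simp only [Pi.zero_apply]
  positivity

lemma rieszForm_comm (γ : ℝ) (q q' : ℝ → ℝ) : rieszForm γ q q' = rieszForm γ q' q := by
  unfold rieszForm
  rw [Measure.volume_eq_prod, ← integral_prod_swap]
  refine integral_congr_ae (.of_forall fun z => ?_)
  simp only [Prod.fst_swap, Prod.snd_swap]
  rw [abs_sub_comm, mul_comm (q z.2)]

lemma rieszForm_nonneg {γ : ℝ} {q q' : ℝ → ℝ} (hq0 : ∀ x, 0 ≤ q x) (hq0' : ∀ x, 0 ≤ q' x) :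
    0 ≤ rieszForm γ q q' :=
  integral_nonneg fun _ => mul_nonneg (mul_nonneg (hq0 _) (hq0' _))
    (Real.rpow_nonneg (abs_nonneg _) _)

/-- `∫₀ˢ ∫₀ᵗ |u - v|^γ dv du` for `s ≤ t`. -/
lemma integral_integral_abs_sub_rpow_of_le {γ s t : ℝ} (hγ : -1 < γ) (hs : 0 ≤ s) (hst : s ≤ t) :
    ∫ u in (0 : ℝ)..s, ∫ v in (0 : ℝ)..t, |u - v| ^ γ =
      (s ^ (γ + 2) + t ^ (γ + 2) - (t - s) ^ (γ + 2)) / ((γ + 1) * (γ + 2)) := by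
  have h1 : γ + 1 ≠ 0 := by linarith
  have hint : ∀ a b : ℝ, IntervalIntegrable (fun x : ℝ => |x| ^ γ) volume a b := by
    have key : ∀ b : ℝ, 0 ≤ b → IntervalIntegrable (fun x : ℝ => |x| ^ γ) volume 0 b :=
      fun b hb => (intervalIntegral.intervalIntegrable_rpow' (a := 0) (b := b) hγ).congr (by
        rw [uIoc_of_le hb]; intro x hx; simp only [abs_of_pos hx.1])
    have key' : ∀ b : ℝ, IntervalIntegrable (fun x : ℝ => |x| ^ γ) volume 0 b := by
      intro b
      rcases le_total 0 b with hb | hb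
      · exact key b hb
      · have := (key (-b) (by linarith)).comp_sub_left 0
        simpa using this
    exact fun a b => (key' a).symm.trans (key' b)
  have hin : ∀ u ∈ uIcc 0 s, ∫ v in (0 : ℝ)..t, |u - v| ^ γ =
      (u ^ (γ + 1) + (t - u) ^ (γ + 1)) / (γ + 1) := by
    intro u hu
    rw [uIcc_of_le hs] at hu
    have hut : 0 ≤ t - u := by linarith [hu.2]
    rw [intervalIntegral.integral_comp_sub_left (fun x => |x| ^ γ) u,
      ← intervalIntegral.integral_add_adjacent_intervals (hint (u - t) 0) (hint 0 (u - 0))]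
    have e1 : ∫ x in (0 : ℝ)..(u - 0), |x| ^ γ = u ^ (γ + 1) / (γ + 1) := by
      rw [sub_zero]
      rw [intervalIntegral.integral_congr (g := fun x => x ^ γ) (fun x hx => by
        rw [uIcc_of_le hu.1] at hx; simp only [abs_of_nonneg hx.1]), integral_rpow (Or.inl hγ),
        Real.zero_rpow h1, sub_zero]
    have e2 : ∫ x in (u - t)..(0 : ℝ), |x| ^ γ = (t - u) ^ (γ + 1) / (γ + 1) := by
      have := intervalIntegral.integral_comp_neg (fun x : ℝ => |x| ^ γ) (a := 0) (b := t - u)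
      rw [neg_sub, neg_zero] at this
      rw [← this]
      rw [intervalIntegral.integral_congr (g := fun x => x ^ γ) (fun x hx => by
        rw [uIcc_of_le hut] at hx; simp only [abs_neg, abs_of_nonneg hx.1]),
        integral_rpow (Or.inl hγ), Real.zero_rpow h1, sub_zero]
    rw [e1, e2]
    ring
  rw [intervalIntegral.integral_congr hin, intervalIntegral.integral_div,
    intervalIntegral.integral_add (intervalIntegral.intervalIntegrable_rpow' (by linarith))
      (by simpa using (intervalIntegral.intervalIntegrable_rpow' (a := t) (b := t - s)
        (r := γ + 1) (by linarith)).comp_sub_left t),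
    intervalIntegral.integral_comp_sub_left (fun x => x ^ (γ + 1)) t,
    integral_rpow (Or.inl (by linarith)), integral_rpow (Or.inl (by linarith)), sub_zero,
    show γ + 1 + 1 = γ + 2 by ring, Real.zero_rpow (by linarith : γ + 2 ≠ 0)]
  have h2 : γ + 2 ≠ 0 := by linarith
  field_simp
  ring

/-- The Riesz form of the indicators of two intervals that share their right end. -/
lemma rieszForm_indicator_Ico {γ s t : ℝ} (hγ : -1 < γ) (hγ0 : γ ≤ 0) (hs : 0 ≤ s) (ht : 0 ≤ t)
    (x : ℝ) :
    rieszForm γ ((Ico (x - s) x).indicator 1) ((Ico (x - t) x).indicator 1) =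
      (s ^ (γ + 2) + t ^ (γ + 2) - |t - s| ^ (γ + 2)) / ((γ + 1) * (γ + 2)) := by
  wlog hst : s ≤ t generalizing s t
  · rw [rieszForm_comm, this ht hs (not_le.1 hst).le, abs_sub_comm]
    ring
  have hI : ∀ s : ℝ, Integrable ((Ico (x - s) x).indicator (1 : ℝ → ℝ)) := fun s =>
    (integrable_indicator_iff measurableSet_Ico).2
      (integrableOn_const (by rw [Real.volume_Ico]; exact ENNReal.ofReal_ne_top) (by simp))
  have h0 : ∀ (s : ℝ) y, 0 ≤ (Ico (x - s) x).indicator (1 : ℝ → ℝ) y := fun s y =>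
    indicator_nonneg (fun _ _ => zero_le_one) _
  have h1 : ∀ (s : ℝ) y, (Ico (x - s) x).indicator (1 : ℝ → ℝ) y ≤ 1 := fun s y =>
    indicator_le_self' (fun _ _ => zero_le_one) _
  rw [abs_of_nonneg (by linarith), ← integral_integral_abs_sub_rpow_of_le hγ hs hst, rieszForm,
    Measure.volume_eq_prod,
    integral_prod _ (integrable_riesz hγ hγ0 (hI s) (hI t) (h0 s) (h0 t) (h1 t))]
  have hsub : ∀ (s : ℝ) (F : ℝ → ℝ), 0 ≤ s → ∫ y, (Ico (x - s) x).indicator (1 : ℝ → ℝ) y * F y =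
      ∫ u in (0 : ℝ)..s, F (x - u) := by
    intro s F hs
    rw [intervalIntegral.integral_comp_sub_left, sub_zero,
      intervalIntegral.integral_of_le (by linarith), ← integral_Ico_eq_integral_Ioc,
      ← integral_indicator measurableSet_Ico]
    refine integral_congr_ae (.of_forall fun y => ?_)
    simp [indicator]
  simp_rw [mul_assoc, integral_const_mul]
  rw [hsub s _ hs]
  refine intervalIntegral.integral_congr fun u _ => ?_
  rw [hsub t _ ht]
  refine intervalIntegral.integral_congr fun v _ => ?_
  rw [abs_sub_comm]
  congr 2
  ring

/-! ### The kernels of the workload and of the Ornstein–Uhlenbeck input -/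

/-- The work done until time `t` by the session that starts at `p.1` and has length `p.2`. The
positive part extends the kernel `min p.2 (t - p.1)` continuously by zero to sessions starting after
`t`. -/
def workKernel (t : ℝ) (p : ℝ × ℝ) : ℝ :=
  if 0 ≤ p.1 ∧ 0 ≤ p.2 then max 0 (min p.2 (t - p.1)) else 0

lemma continuous_workKernel (p : ℝ × ℝ) : Continuous fun t => workKernel t p := by
  unfold workKernel
  split_ifs <;> fun_prop

lemma monotone_workKernel (p : ℝ × ℝ) : Monotone fun t => workKernel t p := by
  intro s t hst
  unfold workKernel
  simp only
  split_ifs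
  · gcongr
  · exact le_rfl

lemma measurable_workKernel (t : ℝ) : Measurable (workKernel t) := by
  unfold workKernel
  refine Measurable.ite ?_ (by fun_prop) measurable_const
  exact (measurableSet_le measurable_const measurable_fst).inter
    (measurableSet_le measurable_const measurable_snd)

lemma workKernel_nonneg (t : ℝ) (p : ℝ × ℝ) : 0 ≤ workKernel t p := by
  unfold workKernel
  split_ifs
  · exact le_max_left _ _
  · exact le_rfl

lemma workKernel_zero (p : ℝ × ℝ) : workKernel 0 p = 0 := by
  unfold workKernel
  split_ifs with h
  · exact max_eq_left ((min_le_right _ _).trans (by linarith [h.1]))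
  · rfl

/-- Sessions work at rate one while they are active. -/
lemma hasDerivWithinAt_workKernel (t : ℝ) (p : ℝ × ℝ) :
    HasDerivWithinAt (fun t => workKernel t p) ((activeAt t).indicator 1 p) (Ioi t) t := by
  by_cases h : 0 ≤ p.1 ∧ 0 ≤ p.2
  · have e : ∀ t, workKernel t p = max 0 (min p.2 (t - p.1)) := fun t => by
      simp [workKernel, h]
    simp_rw [e]
    rcases lt_or_ge t p.1 with h1 | h1
    · rw [indicator_of_notMem (fun hp => by linarith [hp.2.1])]
      refine (hasDerivWithinAt_const t (Ioi t) (0 : ℝ)).congr_of_eventuallyEq ?_ ?_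
      · filter_upwards [mem_nhdsWithin_of_mem_nhds (Iio_mem_nhds h1)] with u hu
        exact max_eq_left ((min_le_right _ _).trans (by linarith [mem_Iio.1 hu]))
      · exact max_eq_left ((min_le_right _ _).trans (by linarith))
    rcases lt_or_ge t (p.1 + p.2) with h2 | h2
    · rw [indicator_of_mem (show p ∈ activeAt t from ⟨h.1, h1, h2⟩)]
      refine (((hasDerivAt_id t).sub_const p.1).hasDerivWithinAt).congr_of_eventuallyEq ?_ ?_
      · filter_upwards [mem_nhdsWithin_of_mem_nhds (Iio_mem_nhds h2), self_mem_nhdsWithin]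
          with u hu hu'
        rw [mem_Iio] at hu
        rw [mem_Ioi] at hu'
        rw [min_eq_right (by linarith), max_eq_right (by linarith)]
        rfl
      · rw [min_eq_right (by linarith), max_eq_right (by linarith)]
        rfl
    · rw [indicator_of_notMem (fun hp => by linarith [hp.2.2])]
      refine (hasDerivWithinAt_const t (Ioi t) p.2).congr_of_eventuallyEq ?_ ?_
      · filter_upwards [self_mem_nhdsWithin] with u hu
        rw [mem_Ioi] at hu
        rw [min_eq_left (by linarith), max_eq_right h.2]
      · rw [min_eq_left (by linarith), max_eq_right h.2]
  · rw [indicator_of_notMem]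
    · have e : ∀ t, workKernel t p = 0 := fun t => by simp [workKernel, h]
      simp_rw [e]
      exact hasDerivWithinAt_const _ _ _
    · rintro ⟨h1, h2, h3⟩
      exact h ⟨h1, by linarith⟩

lemma measurable_activeAt_indicator_left (p : ℝ × ℝ) :
    Measurable fun u => (activeAt u).indicator (1 : ℝ × ℝ → ℝ) p := by
  have : (fun u => (activeAt u).indicator (1 : ℝ × ℝ → ℝ) p) =
      {u | p ∈ activeAt u}.indicator 1 := by
    ext u; simp [indicator]
  rw [this]
  exact measurable_one.indicator
    (measurableSet_activeAt_uncurry.preimage (measurable_prodMk_right (y := p)))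

lemma intervalIntegrable_mul_activeAt {ρ : ℝ → ℝ} (hρ : Continuous ρ) (p : ℝ × ℝ) (a b : ℝ) :
    IntervalIntegrable (fun u => ρ u * (activeAt u).indicator (1 : ℝ × ℝ → ℝ) p) volume a b := by
  refine (hρ.intervalIntegrable a b).mono_fun ?_ (.of_forall fun u => ?_)
  · exact (hρ.measurable.mul (measurable_activeAt_indicator_left p)).aestronglyMeasurable
  · simp only [norm_mul]
    refine mul_le_of_le_one_right (norm_nonneg _) ?_
    by_cases h : p ∈ activeAt u <;> simp [h]

lemma integral_activeAt {a b : ℝ} (hab : a ≤ b) (p : ℝ × ℝ) :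
    ∫ u in a..b, (activeAt u).indicator (1 : ℝ × ℝ → ℝ) p = workKernel b p - workKernel a p :=
  intervalIntegral.integral_eq_sub_of_hasDeriv_right_of_le hab
    (continuous_workKernel p).continuousOn
    (fun u _ => hasDerivWithinAt_workKernel u p)
    (by simpa using intervalIntegrable_mul_activeAt continuous_const (ρ := fun _ => 1) p a b)

/-- The kernel of the input `Y(t) = W(T + t) - κ ∫₀ᵀ exp (-κ (T - r)) W(r) dr` of the shifted
equation, where `W` has the kernel `workKernel`. -/
def inputKernel (κ T t : ℝ) (p : ℝ × ℝ) : ℝ :=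
  workKernel (T + t) p + ∫ r in (0 : ℝ)..T, -κ * Real.exp (-κ * (T - r)) * workKernel r p

/-- The weight of the work done at time `T - x` in the input kernel: `e^{-κx}` for `x ≥ 0`, one for
`-t ≤ x < 0`, and zero otherwise. -/
def inputWeight (κ t x : ℝ) : ℝ :=
  if 0 ≤ x then Real.exp (-κ * x) else if -t ≤ x then 1 else 0

lemma inputWeight_nonneg (κ t x : ℝ) : 0 ≤ inputWeight κ t x := by
  unfold inputWeight
  split_ifs <;> positivity

lemma inputWeight_le_one {κ : ℝ} (hκ : 0 < κ) (t x : ℝ) : inputWeight κ t x ≤ 1 := by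
  unfold inputWeight
  split_ifs with h
  · exact Real.exp_le_one_iff.2 (by nlinarith)
  · exact le_rfl
  · exact zero_le_one

lemma measurable_inputWeight (κ t : ℝ) : Measurable (inputWeight κ t) := by
  unfold inputWeight
  exact Measurable.ite measurableSet_Ici (by fun_prop)
    (Measurable.ite measurableSet_Ici measurable_const measurable_const)

lemma inputWeight_eq (κ t x : ℝ) :
    inputWeight κ t x = (Ici 0).indicator (fun x => Real.exp (-κ * x)) x +
      (Ico (0 - t) 0).indicator 1 x := by
  unfold inputWeight
  by_cases h : 0 ≤ x
  · simp [h, not_lt.2 h]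
  · by_cases h' : -t ≤ x
    · simp [h, h', not_le.1 h]
    · simp [h, h', indicator]

lemma integrable_indicator_exp {κ : ℝ} (hκ : 0 < κ) :
    Integrable ((Ici (0 : ℝ)).indicator fun x => Real.exp (-κ * x)) := by
  rw [integrable_indicator_iff measurableSet_Ici, integrableOn_Ici_iff_integrableOn_Ioi]
  exact integrableOn_exp_mul_Ioi (by linarith) 0

lemma integrable_indicator_Ico (a b : ℝ) : Integrable ((Ico a b).indicator (1 : ℝ → ℝ)) :=
  (integrable_indicator_iff measurableSet_Ico).2
    (integrableOn_const (by rw [Real.volume_Ico]; exact ENNReal.ofReal_ne_top) (by simp))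

lemma integrable_inputWeight {κ : ℝ} (hκ : 0 < κ) (t : ℝ) :
    Integrable (inputWeight κ t) :=
  ((integrable_indicator_exp hκ).add (integrable_indicator_Ico (0 - t) 0)).congr
    (.of_forall fun x => (inputWeight_eq κ t x).symm)

/-- Integration by parts, through the right derivative of `r ↦ e^{-κ(T-r)} workKernel r p`. -/
lemma inputKernel_eq (κ : ℝ) {T t : ℝ} (hT : 0 ≤ T) (ht : 0 ≤ t) (p : ℝ × ℝ) :
    inputKernel κ T t p =
      (∫ u in (0 : ℝ)..T, Real.exp (-κ * (T - u)) * (activeAt u).indicator (1 : ℝ × ℝ → ℝ) p) +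
      ∫ u in T..(T + t), (activeAt u).indicator (1 : ℝ × ℝ → ℝ) p := by
  have hexp : Continuous fun r => Real.exp (-κ * (T - r)) := by fun_prop
  have hw := continuous_workKernel p
  have h := intervalIntegral.integral_eq_sub_of_hasDeriv_right_of_le hT
    (f := fun r => Real.exp (-κ * (T - r)) * workKernel r p)
    (f' := fun r => κ * Real.exp (-κ * (T - r)) * workKernel r p +
      Real.exp (-κ * (T - r)) * (activeAt r).indicator (1 : ℝ × ℝ → ℝ) p)
    (by fun_prop) (fun r _ => ?_) ?_
  · rw [intervalIntegral.integral_add (Continuous.intervalIntegrable (by fun_prop) _ _)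
      (intervalIntegrable_mul_activeAt hexp p _ _), workKernel_zero] at h
    simp only [sub_self, mul_zero, Real.exp_zero, one_mul, sub_zero] at h
    rw [integral_activeAt (by linarith), inputKernel]
    have : ∫ r in (0 : ℝ)..T, -κ * Real.exp (-κ * (T - r)) * workKernel r p =
        -∫ r in (0 : ℝ)..T, κ * Real.exp (-κ * (T - r)) * workKernel r p := by
      rw [← intervalIntegral.integral_neg]
      simp only [neg_mul]
    rw [this]
    linarith
  · have h1 : HasDerivAt (fun r => Real.exp (-κ * (T - r))) (κ * Real.exp (-κ * (T - r))) r := by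
      have := (((hasDerivAt_id r).const_sub T).const_mul (-κ)).exp
      exact this.congr_deriv (by simp [mul_comm])
    exact h1.hasDerivWithinAt.mul (hasDerivWithinAt_workKernel r p)
  · exact (Continuous.intervalIntegrable (by fun_prop) _ _).add
      (intervalIntegrable_mul_activeAt hexp p _ _)

lemma inputKernel_nonneg (κ : ℝ) {T t : ℝ} (hT : 0 ≤ T) (ht : 0 ≤ t) (p : ℝ × ℝ) :
    0 ≤ inputKernel κ T t p := by
  rw [inputKernel_eq κ hT ht]
  refine add_nonneg (intervalIntegral.integral_nonneg hT fun u _ => ?_)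
    (intervalIntegral.integral_nonneg (by linarith) fun u _ => ?_)
  · exact mul_nonneg (Real.exp_nonneg _) (indicator_nonneg (fun _ _ => zero_le_one) _)
  · exact indicator_nonneg (fun _ _ => zero_le_one) _

lemma measurable_inputKernel (κ : ℝ) {T t : ℝ} (hT : 0 ≤ T) (ht : 0 ≤ t) :
    Measurable (inputKernel κ T t) := by
  have hA : Measurable fun z : (ℝ × ℝ) × ℝ => (activeAt z.2).indicator (1 : ℝ × ℝ → ℝ) z.1 := by
    have : (fun z : (ℝ × ℝ) × ℝ => (activeAt z.2).indicator (1 : ℝ × ℝ → ℝ) z.1) =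
        (Prod.swap ⁻¹' {q : ℝ × (ℝ × ℝ) | q.2 ∈ activeAt q.1}).indicator 1 := by
      ext z; simp [indicator]
    rw [this]
    exact measurable_one.indicator (measurableSet_activeAt_uncurry.preimage measurable_swap)
  have e : inputKernel κ T t = fun p =>
      (∫ u in (0 : ℝ)..T, Real.exp (-κ * (T - u)) * (activeAt u).indicator (1 : ℝ × ℝ → ℝ) p) +
      ∫ u in T..(T + t), (activeAt u).indicator (1 : ℝ × ℝ → ℝ) p :=
    funext (inputKernel_eq κ hT ht)
  rw [e]
  refine Measurable.add ?_ ?_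
  · simp_rw [intervalIntegral.integral_of_le hT]
    exact (StronglyMeasurable.integral_prod_right'
      (f := fun z : (ℝ × ℝ) × ℝ => Real.exp (-κ * (T - z.2)) *
        (activeAt z.2).indicator (1 : ℝ × ℝ → ℝ) z.1)
      (Measurable.stronglyMeasurable ((by fun_prop :
        Measurable fun z : (ℝ × ℝ) × ℝ => Real.exp (-κ * (T - z.2))).mul hA))).measurable
  · simp_rw [intervalIntegral.integral_of_le (by linarith : T ≤ T + t)]
    exact (StronglyMeasurable.integral_prod_right' (Measurable.stronglyMeasurable hA)).measurable

/-- The input kernel is the work done with weight `inputWeight κ t (T - u)` at time `u`. -/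
lemma ofReal_inputKernel (κ : ℝ) {T t : ℝ} (hT : 0 ≤ T) (ht : 0 ≤ t) (p : ℝ × ℝ) :
    ENNReal.ofReal (inputKernel κ T t p) =
      weightedWork (fun u => ENNReal.ofReal (inputWeight κ t (T - u))) p := by
  have hmeas := measurable_activeAt_indicator_left p
  have hnn : ∀ u, 0 ≤ (activeAt u).indicator (1 : ℝ × ℝ → ℝ) p := fun u =>
    indicator_nonneg (fun _ _ => zero_le_one) _
  have hI1 := (intervalIntegrable_mul_activeAt
    (by fun_prop : Continuous fun r => Real.exp (-κ * (T - r))) p 0 T).1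
  have hI2 : IntegrableOn (fun u => (activeAt u).indicator (1 : ℝ × ℝ → ℝ) p) (Ioc T (T + t)) := by
    simpa using (intervalIntegrable_mul_activeAt continuous_const (ρ := fun _ => 1) p T (T + t)).1
  have hm1 : Measurable ((Ioc 0 T).indicator fun u =>
      ENNReal.ofReal (Real.exp (-κ * (T - u)) * (activeAt u).indicator (1 : ℝ × ℝ → ℝ) p)) :=
    Measurable.indicator (Measurable.ennreal_ofReal (Measurable.mul (by fun_prop) hmeas))
      measurableSet_Ioc
  rw [inputKernel_eq κ hT ht, intervalIntegral.integral_of_le hT,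
    intervalIntegral.integral_of_le (by linarith), ENNReal.ofReal_add
      (integral_nonneg fun u => mul_nonneg (Real.exp_nonneg _) (hnn u))
      (integral_nonneg fun u => hnn u),
    ofReal_integral_eq_lintegral_ofReal hI1
      (.of_forall fun u => mul_nonneg (Real.exp_nonneg _) (hnn u)),
    ofReal_integral_eq_lintegral_ofReal hI2 (.of_forall fun u => hnn u),
    ← lintegral_indicator measurableSet_Ioc, ← lintegral_indicator measurableSet_Ioc,
    ← lintegral_add_left hm1]
  -- sessions start at nonnegative times, so only the null set `u = 0` is not covered by `(0, T + t]`
  have h0 : ∀ᵐ u : ℝ, u ≠ 0 := by simp [ae_iff]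
  refine lintegral_congr_ae ?_
  filter_upwards [h0] with u hu
  by_cases hp : p ∈ activeAt u
  · have hu0 : 0 < u := lt_of_le_of_ne (hp.1.trans hp.2.1) hu.symm
    have e1 : (activeAt u).indicator (1 : ℝ × ℝ → ℝ≥0∞) p = 1 := indicator_of_mem hp _
    rw [e1, mul_one]
    unfold inputWeight
    have e2 : (activeAt u).indicator (1 : ℝ × ℝ → ℝ) p = 1 := indicator_of_mem hp _
    by_cases h1 : u ≤ T
    · rw [indicator_of_mem (show u ∈ Ioc 0 T from ⟨hu0, h1⟩),
        indicator_of_notMem (show u ∉ Ioc T (T + t) by simp [h1]),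
        if_pos (by linarith), add_zero, e2, mul_one]
    · rw [indicator_of_notMem (show u ∉ Ioc 0 T by simp [h1]), if_neg (by linarith), zero_add]
      by_cases h2 : u ≤ T + t
      · rw [indicator_of_mem (show u ∈ Ioc T (T + t) from ⟨not_le.1 h1, h2⟩),
          if_pos (by linarith), e2]
      · rw [indicator_of_notMem (show u ∉ Ioc T (T + t) by simp [h2]), if_neg (by linarith)]
        simp
  · simp [indicator, hp]

/-- The work done during `(a, b]`, in the form of `ofReal_inputKernel`. -/
lemma ofReal_workKernel_sub {a b : ℝ} (hab : a ≤ b) (p : ℝ × ℝ) :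
    ENNReal.ofReal (workKernel b p - workKernel a p) =
      weightedWork (fun u => ENNReal.ofReal ((Ico (a - b) 0).indicator 1 (a - u))) p := by
  have hI2 : IntegrableOn (fun u => (activeAt u).indicator (1 : ℝ × ℝ → ℝ) p) (Ioc a b) := by
    simpa using (intervalIntegrable_mul_activeAt continuous_const (ρ := fun _ => 1) p a b).1
  rw [← integral_activeAt hab, intervalIntegral.integral_of_le hab,
    ofReal_integral_eq_lintegral_ofReal hI2
      (.of_forall fun u => indicator_nonneg (fun _ _ => zero_le_one) _),
    ← lintegral_indicator measurableSet_Ioc]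
  refine lintegral_congr fun u => ?_
  by_cases hp : p ∈ activeAt u
  · by_cases hu : u ∈ Ioc a b
    · have : a - u ∈ Ico (a - b) 0 := ⟨by linarith [hu.2], by linarith [hu.1]⟩
      simp [hu, hp, this]
    · have : a - u ∉ Ico (a - b) 0 := fun h => hu ⟨by linarith [h.2], by linarith [h.1]⟩
      simp [hu, this]
  · by_cases hu : u ∈ Ioc a b <;> simp [hu, hp]

/-! ### Covariances of weighted work -/

lemma measurable_measure_activeAt_sub {m : Measure (ℝ × ℝ)} [SFinite m] (T : ℝ) :
    Measurable fun z : ℝ × ℝ => m (activeAt (T - z.1) ∩ activeAt (T - z.2)) := by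
  have hs : MeasurableSet {w : (ℝ × ℝ) × (ℝ × ℝ) |
      w.2 ∈ activeAt (T - w.1.1) ∩ activeAt (T - w.1.2)} := by
    refine MeasurableSet.inter ?_ ?_
    · exact measurableSet_activeAt_uncurry.preimage (by fun_prop :
        Measurable fun w : (ℝ × ℝ) × (ℝ × ℝ) => (T - w.1.1, w.2))
    · exact measurableSet_activeAt_uncurry.preimage (by fun_prop :
        Measurable fun w : (ℝ × ℝ) × (ℝ × ℝ) => (T - w.1.2, w.2))
  exact measurable_measure_prodMk_left hs

/-- The inner product of two amounts of work with weights given in the reversed time `T - u`. -/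
lemma lintegral_weightedWork_sub_mul {m : Measure (ℝ × ℝ)} [SFinite m] {q q' : ℝ → ℝ≥0∞}
    (hq : Measurable q) (hq' : Measurable q') (T : ℝ) :
    ∫⁻ p, weightedWork (fun u => q (T - u)) p * weightedWork (fun u => q' (T - u)) p ∂m =
      ∫⁻ z : ℝ × ℝ, q z.1 * q' z.2 * m (activeAt (T - z.1) ∩ activeAt (T - z.2)) := by
  have hA := measurable_activeAt_indicator
  have hm := measurable_measure_activeAt_sub (m := m) T
  have hm' : Measurable fun z : ℝ × ℝ =>
      q z.1 * q' z.2 * m (activeAt (T - z.1) ∩ activeAt (T - z.2)) :=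
    ((hq.comp measurable_fst).mul (hq'.comp measurable_snd)).mul hm
  have hq1 : Measurable fun u => q (T - u) := hq.comp (by fun_prop)
  have hq1' : Measurable fun u => q' (T - u) := hq'.comp (by fun_prop)
  rw [lintegral_weightedWork_mul hq1 hq1',
    Measure.volume_eq_prod, lintegral_prod _ hm'.aemeasurable,
    ← lintegral_sub_left_eq_self _ T]
  refine lintegral_congr fun x => ?_
  rw [← lintegral_sub_left_eq_self _ T]
  simp only [sub_sub_cancel]

lemma controlMeasure_activeAt_sub_le {β θ : ℝ} (hβ : β ∈ Ioo (2 : ℝ) 3) (hθ : 0 < θ)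
    (T : ℝ) {x y : ℝ}
    (hxy : x ≠ y) :
    controlMeasure β θ (activeAt (T - x) ∩ activeAt (T - y)) ≤
      ENNReal.ofReal (θ ^ (1 - β) / (β - 2) * |x - y| ^ (2 - β)) := by
  have hc : 0 ≤ θ ^ (1 - β) / (β - 2) := div_nonneg (by positivity) (by linarith [hβ.1])
  by_cases h : 0 ≤ T - x ∧ 0 ≤ T - y
  · rw [controlMeasure_activeAt_inter hβ hθ h.1 h.2 (by simpa using hxy), sub_sub_sub_cancel_left,
      abs_sub_comm]
    refine ENNReal.ofReal_le_ofReal (mul_le_mul_of_nonneg_left ?_ hc)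
    have : 0 ≤ max (T - x) (T - y) ^ (2 - β) := Real.rpow_nonneg (le_max_of_le_left h.1) _
    linarith
  · rw [not_and_or, not_le, not_le] at h
    rcases h with h | h <;> simp [activeAt_of_neg h]

lemma tendsto_controlMeasure_activeAt_sub {β θ : ℝ} (hβ : β ∈ Ioo (2 : ℝ) 3) (hθ : 0 < θ) {x y : ℝ}
    (hxy : x ≠ y) :
    Tendsto (fun T => controlMeasure β θ (activeAt (T - x) ∩ activeAt (T - y))) atTop
      (𝓝 (ENNReal.ofReal (θ ^ (1 - β) / (β - 2) * |x - y| ^ (2 - β)))) := by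
  have h1 : Tendsto (fun T => max (T - x) (T - y) ^ (2 - β)) atTop (𝓝 0) := by
    have h2 : Tendsto (fun T : ℝ => max (T - x) (T - y)) atTop atTop :=
      tendsto_atTop_mono (fun T => le_max_left _ _) (tendsto_atTop_add_const_right _ _ tendsto_id)
    have h3 := (tendsto_rpow_neg_atTop (by linarith [hβ.1] : 0 < β - 2)).comp h2
    simpa [Function.comp_def] using h3
  have h2 : Tendsto (fun T => ENNReal.ofReal (θ ^ (1 - β) / (β - 2) *
      (|x - y| ^ (2 - β) - max (T - x) (T - y) ^ (2 - β)))) atTop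
      (𝓝 (ENNReal.ofReal (θ ^ (1 - β) / (β - 2) * (|x - y| ^ (2 - β) - 0)))) :=
    ENNReal.tendsto_ofReal ((tendsto_const_nhds.sub h1).const_mul _)
  rw [sub_zero] at h2
  refine h2.congr' ?_
  filter_upwards [eventually_ge_atTop x, eventually_ge_atTop y] with T hx hy
  rw [controlMeasure_activeAt_inter hβ hθ (sub_nonneg.2 hx) (sub_nonneg.2 hy) (by simpa using hxy),
    sub_sub_sub_cancel_left, abs_sub_comm y x]

lemma ae_fst_ne_snd : ∀ᵐ z : ℝ × ℝ, z.1 ≠ z.2 := by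
  rw [Measure.volume_eq_prod]
  refine (Measure.ae_prod_iff_ae_ae (p := fun z : ℝ × ℝ => z.1 ≠ z.2)
    (measurableSet_eq_fun measurable_fst measurable_snd).compl).2 (.of_forall fun x => ?_)
  simp [ae_iff]

/-- Bounds on a weight under which its Riesz form is finite. -/
structure IsWeight (q : ℝ → ℝ) : Prop where
  measurable : Measurable q
  integrable : Integrable q
  nonneg : ∀ x, 0 ≤ q x
  le_one : ∀ x, q x ≤ 1

lemma isWeight_inputWeight {κ : ℝ} (hκ : 0 < κ) (t : ℝ) : IsWeight (inputWeight κ t) :=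
  ⟨measurable_inputWeight κ t, integrable_inputWeight hκ t, inputWeight_nonneg κ t,
    inputWeight_le_one hκ t⟩

lemma isWeight_indicator_Ico (a b : ℝ) : IsWeight ((Ico a b).indicator 1) :=
  ⟨measurable_one.indicator measurableSet_Ico, integrable_indicator_Ico a b,
    fun _ => indicator_nonneg (fun _ _ => zero_le_one) _,
    fun _ => indicator_le_self' (fun _ _ => zero_le_one) _⟩

lemma isWeight_indicator_exp {κ : ℝ} (hκ : 0 < κ) :
    IsWeight ((Ici (0 : ℝ)).indicator fun x => Real.exp (-κ * x)) :=
  ⟨Measurable.indicator (by fun_prop) measurableSet_Ici, integrable_indicator_exp hκ,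
    fun _ => indicator_nonneg (fun _ _ => Real.exp_nonneg _) _,
    fun x => indicator_apply_le' (fun hx => Real.exp_le_one_iff.2
      (by nlinarith [mem_Ici.1 hx])) fun _ => zero_le_one⟩

lemma IsWeight.lintegral_riesz {γ c : ℝ} (hγ : -1 < γ) (hγ0 : γ ≤ 0) {q q' : ℝ → ℝ}
    (hq : IsWeight q) (hq' : IsWeight q') (hc : 0 ≤ c) :
    ∫⁻ z : ℝ × ℝ, ENNReal.ofReal (q z.1) * ENNReal.ofReal (q' z.2) *
        ENNReal.ofReal (c * |z.1 - z.2| ^ γ) = ENNReal.ofReal (c * rieszForm γ q q') := by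
  rw [ENNReal.ofReal_mul hc, ← _root_.lintegral_riesz hγ hγ0 hq.integrable hq'.integrable
    hq.nonneg hq'.nonneg hq'.le_one, ← lintegral_const_mul' _ _ ENNReal.ofReal_ne_top]
  refine lintegral_congr fun z => ?_
  rw [← ENNReal.ofReal_mul (hq.nonneg _), ← ENNReal.ofReal_mul
    (mul_nonneg (hq.nonneg _) (hq'.nonneg _)), ← ENNReal.ofReal_mul hc]
  congr 1
  ring

lemma IsWeight.integrable_riesz {γ : ℝ} (hγ : -1 < γ) (hγ0 : γ ≤ 0) {q q' : ℝ → ℝ}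
    (hq : IsWeight q) (hq' : IsWeight q') :
    Integrable fun z : ℝ × ℝ => q z.1 * q' z.2 * |z.1 - z.2| ^ γ :=
  _root_.integrable_riesz hγ hγ0 hq.integrable hq'.integrable hq.nonneg hq'.nonneg hq'.le_one

lemma rieszForm_add {γ : ℝ} (hγ : -1 < γ) (hγ0 : γ ≤ 0) {q₁ q₂ q' : ℝ → ℝ} (h₁ : IsWeight q₁)
    (h₂ : IsWeight q₂) (hq' : IsWeight q') :
    rieszForm γ (fun x => q₁ x + q₂ x) q' = rieszForm γ q₁ q' + rieszForm γ q₂ q' := by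
  unfold rieszForm
  rw [← integral_add (h₁.integrable_riesz hγ hγ0 hq') (h₂.integrable_riesz hγ hγ0 hq')]
  simp only [add_mul]

lemma coeff_nonneg {β θ : ℝ} (hβ : β ∈ Ioo (2 : ℝ) 3) (hθ : 0 < θ) :
    0 ≤ θ ^ (1 - β) / (β - 2) :=
  div_nonneg (by positivity) (by linarith [hβ.1])

lemma lintegral_weightedWork_le {β θ : ℝ} (hβ : β ∈ Ioo (2 : ℝ) 3) (hθ : 0 < θ) {q q' : ℝ → ℝ}
    (hq : IsWeight q) (hq' : IsWeight q') (T : ℝ) :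
    ∫⁻ p, weightedWork (fun u => ENNReal.ofReal (q (T - u))) p *
        weightedWork (fun u => ENNReal.ofReal (q' (T - u))) p ∂controlMeasure β θ ≤
      ENNReal.ofReal (θ ^ (1 - β) / (β - 2) * rieszForm (2 - β) q q') := by
  rw [lintegral_weightedWork_sub_mul (q := fun x => ENNReal.ofReal (q x))
    (q' := fun x => ENNReal.ofReal (q' x)) hq.measurable.ennreal_ofReal
    hq'.measurable.ennreal_ofReal, ← hq.lintegral_riesz (by linarith [hβ.2]) (by linarith [hβ.1])
    hq' (coeff_nonneg hβ hθ)]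
  refine lintegral_mono_ae ?_
  filter_upwards [ae_fst_ne_snd] with z hz
  gcongr
  exact controlMeasure_activeAt_sub_le hβ hθ T hz

/-- In the long run the overlap of the active sets only depends on the time lag. -/
lemma tendsto_lintegral_weightedWork {β θ : ℝ} (hβ : β ∈ Ioo (2 : ℝ) 3) (hθ : 0 < θ)
    {q q' : ℝ → ℝ} (hq : IsWeight q) (hq' : IsWeight q') :
    Tendsto (fun T => ∫⁻ p, weightedWork (fun u => ENNReal.ofReal (q (T - u))) p *
        weightedWork (fun u => ENNReal.ofReal (q' (T - u))) p ∂controlMeasure β θ) atTop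
      (𝓝 (ENNReal.ofReal (θ ^ (1 - β) / (β - 2) * rieszForm (2 - β) q q'))) := by
  simp_rw [fun T => lintegral_weightedWork_sub_mul (m := controlMeasure β θ)
    (q := fun x => ENNReal.ofReal (q x))
    (q' := fun x => ENNReal.ofReal (q' x)) hq.measurable.ennreal_ofReal
    hq'.measurable.ennreal_ofReal T]
  have hR := hq.lintegral_riesz (γ := 2 - β) (by linarith [hβ.2]) (by linarith [hβ.1])
    hq' (coeff_nonneg hβ hθ)
  rw [← hR]
  refine tendsto_lintegral_filter_of_dominated_convergence
    (fun z : ℝ × ℝ => ENNReal.ofReal (q z.1) * ENNReal.ofReal (q' z.2) *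
        ENNReal.ofReal (θ ^ (1 - β) / (β - 2) * |z.1 - z.2| ^ (2 - β))) (.of_forall fun T => ?_)
    (.of_forall fun T => ?_) (by rw [hR]; exact ENNReal.ofReal_ne_top) ?_
  · refine Measurable.mul ?_ (measurable_measure_activeAt_sub T)
    exact (hq.measurable.comp measurable_fst).ennreal_ofReal.mul
      (hq'.measurable.comp measurable_snd).ennreal_ofReal
  · filter_upwards [ae_fst_ne_snd] with z hz
    gcongr
    exact controlMeasure_activeAt_sub_le hβ hθ T hz
  · filter_upwards [ae_fst_ne_snd] with z hz
    exact ENNReal.Tendsto.const_mul (tendsto_controlMeasure_activeAt_sub hβ hθ hz)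
      (Or.inr (ENNReal.mul_ne_top ENNReal.ofReal_ne_top ENNReal.ofReal_ne_top))

/-! ### Covariances of the input -/

/-- The variance of the workload increments does not exceed that of fractional Brownian motion. -/
lemma integral_workKernel_sub_sq_le {β θ : ℝ} (hβ : β ∈ Ioo (2 : ℝ) 3) (hθ : 0 < θ) (a b : ℝ) :
    ∫ p, (workKernel b p - workKernel a p) ^ 2 ∂controlMeasure β θ ≤
      θ ^ (1 - β) / (β - 2) * (2 * |b - a| ^ (4 - β) / ((3 - β) * (4 - β))) := by
  wlog hab : a ≤ b generalizing a b
  · have := this b a (not_le.1 hab).le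
    rw [abs_sub_comm]
    refine le_trans (le_of_eq (integral_congr_ae (.of_forall fun p => ?_))) this
    simp only
    ring
  have hβ2 := hβ.1
  have hβ3 := hβ.2
  have hR : rieszForm (2 - β) ((Ico (a - b) 0).indicator 1) ((Ico (a - b) 0).indicator 1) =
      2 * |b - a| ^ (4 - β) / ((3 - β) * (4 - β)) := by
    have h := rieszForm_indicator_Ico (γ := 2 - β) (by linarith) (by linarith)
      (sub_nonneg.2 hab) (sub_nonneg.2 hab) 0
    rw [show 0 - (b - a) = a - b by ring] at h
    rw [h, sub_self, abs_zero, Real.zero_rpow (by linarith), abs_of_nonneg (sub_nonneg.2 hab),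
      show 2 - β + 2 = 4 - β by ring, show 2 - β + 1 = 3 - β by ring]
    ring
  have hmeas : Measurable fun p => (workKernel b p - workKernel a p) ^ 2 :=
    ((measurable_workKernel b).sub (measurable_workKernel a)).pow_const 2
  rw [integral_eq_lintegral_of_nonneg_ae (.of_forall fun p => sq_nonneg _)
    hmeas.aestronglyMeasurable]
  have hw := isWeight_indicator_Ico (a - b) 0
  have hle := lintegral_weightedWork_le hβ hθ hw hw a
  rw [hR] at hle
  refine ENNReal.toReal_le_of_le_ofReal (mul_nonneg (coeff_nonneg hβ hθ) (div_nonneg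
    (by positivity) (mul_nonneg (by linarith) (by linarith)))) (le_trans (le_of_eq ?_) hle)
  refine lintegral_congr fun p => ?_
  rw [sq, ENNReal.ofReal_mul (sub_nonneg.2 (monotone_workKernel p hab)), ofReal_workKernel_sub hab]

lemma lintegral_inputKernel_mul (κ : ℝ) {β θ T s t : ℝ} (hT : 0 ≤ T) (hs : 0 ≤ s) (ht : 0 ≤ t) :
    ∫⁻ p, ENNReal.ofReal (inputKernel κ T s p * inputKernel κ T t p) ∂controlMeasure β θ =
      ∫⁻ p, weightedWork (fun u => ENNReal.ofReal (inputWeight κ s (T - u))) p *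
        weightedWork (fun u => ENNReal.ofReal (inputWeight κ t (T - u))) p ∂controlMeasure β θ := by
  refine lintegral_congr fun p => ?_
  rw [ENNReal.ofReal_mul (inputKernel_nonneg κ hT hs p), ofReal_inputKernel κ hT hs,
    ofReal_inputKernel κ hT ht]

lemma integral_inputKernel_mul (κ : ℝ) {β θ T s t : ℝ} (hT : 0 ≤ T) (hs : 0 ≤ s) (ht : 0 ≤ t) :
    ∫ p, inputKernel κ T s p * inputKernel κ T t p ∂controlMeasure β θ =
      (∫⁻ p, weightedWork (fun u => ENNReal.ofReal (inputWeight κ s (T - u))) p *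
        weightedWork (fun u => ENNReal.ofReal (inputWeight κ t (T - u))) p
          ∂controlMeasure β θ).toReal := by
  rw [← lintegral_inputKernel_mul κ hT hs ht, integral_eq_lintegral_of_nonneg_ae
    (.of_forall fun p => mul_nonneg (inputKernel_nonneg κ hT hs p) (inputKernel_nonneg κ hT ht p))
    ((measurable_inputKernel κ hT hs).mul (measurable_inputKernel κ hT ht)).aestronglyMeasurable]

lemma integrable_inputKernel_mul {κ : ℝ} (hκ : 0 < κ) {β θ T s t : ℝ} (hβ : β ∈ Ioo (2 : ℝ) 3)
    (hθ : 0 < θ) (hT : 0 ≤ T) (hs : 0 ≤ s) (ht : 0 ≤ t) :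
    Integrable (fun p => inputKernel κ T s p * inputKernel κ T t p) (controlMeasure β θ) := by
  refine ⟨((measurable_inputKernel κ hT hs).mul
    (measurable_inputKernel κ hT ht)).aestronglyMeasurable, ?_⟩
  rw [hasFiniteIntegral_iff_ofReal (.of_forall fun p =>
    mul_nonneg (inputKernel_nonneg κ hT hs p) (inputKernel_nonneg κ hT ht p)),
    lintegral_inputKernel_mul κ hT hs ht]
  exact (lintegral_weightedWork_le hβ hθ (isWeight_inputWeight hκ s)
    (isWeight_inputWeight hκ t) T).trans_lt ENNReal.ofReal_lt_top

lemma integral_inputKernel_mul_le {κ : ℝ} (hκ : 0 < κ) {β θ T s t : ℝ} (hβ : β ∈ Ioo (2 : ℝ) 3)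
    (hθ : 0 < θ) (hT : 0 ≤ T) (hs : 0 ≤ s) (ht : 0 ≤ t) :
    ∫ p, inputKernel κ T s p * inputKernel κ T t p ∂controlMeasure β θ ≤
      θ ^ (1 - β) / (β - 2) * rieszForm (2 - β) (inputWeight κ s) (inputWeight κ t) := by
  rw [integral_inputKernel_mul κ hT hs ht]
  refine ENNReal.toReal_le_of_le_ofReal (mul_nonneg (coeff_nonneg hβ hθ)
    (rieszForm_nonneg (inputWeight_nonneg κ s) (inputWeight_nonneg κ t)))
    (lintegral_weightedWork_le hβ hθ (isWeight_inputWeight hκ s) (isWeight_inputWeight hκ t) T)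

lemma tendsto_integral_inputKernel_mul {κ : ℝ} (hκ : 0 < κ) {β θ s t : ℝ}
    (hβ : β ∈ Ioo (2 : ℝ) 3) (hθ : 0 < θ) (hs : 0 ≤ s) (ht : 0 ≤ t) :
    Tendsto (fun T => ∫ p, inputKernel κ T s p * inputKernel κ T t p ∂controlMeasure β θ) atTop
      (𝓝 (θ ^ (1 - β) / (β - 2) * rieszForm (2 - β) (inputWeight κ s) (inputWeight κ t))) := by
  have h := (ENNReal.tendsto_toReal ENNReal.ofReal_ne_top).comp
    (tendsto_lintegral_weightedWork hβ hθ (isWeight_inputWeight hκ s) (isWeight_inputWeight hκ t))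
  rw [ENNReal.toReal_ofReal (mul_nonneg (coeff_nonneg hβ hθ)
    (rieszForm_nonneg (inputWeight_nonneg κ s) (inputWeight_nonneg κ t)))] at h
  refine h.congr' ?_
  filter_upwards [eventually_ge_atTop 0] with T hT
  exact (integral_inputKernel_mul κ hT hs ht).symm

/-! ### The limit covariance -/

lemma integrableOn_exp_mul_exp_mul_abs_sub {κ : ℝ} (hκ : 0 < κ) {γ : ℝ} (hγ : -1 < γ)
    (hγ0 : γ ≤ 0) :
    IntegrableOn (fun p : ℝ × ℝ => Real.exp (-κ * p.1) * Real.exp (-κ * p.2) *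
      |p.2 - p.1| ^ γ) (Ioi 0 ×ˢ Ioi 0) := by
  refine ((isWeight_indicator_exp hκ).integrable_riesz hγ hγ0
    (isWeight_indicator_exp hκ)).integrableOn.congr_fun (fun p hp => ?_)
    (measurableSet_Ioi.prod measurableSet_Ioi)
  have h1 : p.1 ∈ Ici (0 : ℝ) := (mem_Ioi.1 hp.1).le
  have h2 : p.2 ∈ Ici (0 : ℝ) := (mem_Ioi.1 hp.2).le
  simp only [indicator_of_mem h1, indicator_of_mem h2]
  rw [abs_sub_comm]

lemma rieszForm_eq_iterated {γ : ℝ} (hγ : -1 < γ) (hγ0 : γ ≤ 0) {q q' : ℝ → ℝ}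
    (hq : IsWeight q) (hq' : IsWeight q') :
    rieszForm γ q q' = ∫ x, q x * ∫ y, q' y * |x - y| ^ γ := by
  rw [rieszForm, Measure.volume_eq_prod, integral_prod _ (hq.integrable_riesz hγ hγ0 hq')]
  simp_rw [mul_assoc, integral_const_mul]

lemma integral_indicator_Ici_mul (f F : ℝ → ℝ) :
    ∫ x, (Ici (0 : ℝ)).indicator f x * F x = ∫ x in Ioi 0, f x * F x := by
  rw [← integral_Ici_eq_integral_Ioi, ← integral_indicator measurableSet_Ici]
  refine integral_congr_ae (.of_forall fun x => ?_)
  by_cases h : x ∈ Ici (0 : ℝ) <;> simp only [indicator, h, if_true, if_false, zero_mul]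

lemma integral_indicator_Ico_mul {t : ℝ} (ht : 0 ≤ t) (F : ℝ → ℝ) :
    ∫ x, (Ico (0 - t) 0).indicator (1 : ℝ → ℝ) x * F x = ∫ u in (0 : ℝ)..t, F (-u) := by
  rw [intervalIntegral.integral_comp_neg, intervalIntegral.integral_of_le (by linarith),
    ← integral_Ico_eq_integral_Ioc, neg_zero, ← zero_sub t, ← integral_indicator measurableSet_Ico]
  refine integral_congr_ae (.of_forall fun x => ?_)
  by_cases h : x ∈ Ico (0 - t) (0 : ℝ) <;> simp only [indicator, h, if_true, if_false, zero_mul,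
    Pi.one_apply, one_mul]

lemma ouSigma_pos {d : ℕ} (hd : 0 < d) {β θ : ℝ} (hβ : β ∈ Ioo (2 : ℝ) 3) (hθ : 0 < θ) :
    0 < ouSigma d β θ := by
  rw [ouSigma, Real.sqrt_pos]
  have : 0 < β - 2 := by linarith [hβ.1]
  have : 0 < 3 - β := by linarith [hβ.2]
  have : 0 < 4 - β := by linarith [hβ.2]
  positivity

/-- The limit covariance is the one of `Z₀ + σ B`: writing each weight as `e^{-κx} 1{x ≥ 0}` plus the
indicator of `[-t, 0)`, the four parts of the Riesz form are the variance of `Z₀`, the two cross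
covariances, and the covariance of fractional Brownian motion. -/
lemma rieszForm_inputWeight {κ : ℝ} (hκ : 0 < κ) {d : ℕ} (hd : 0 < d) {β θ s t : ℝ}
    (hβ : β ∈ Ioo (2 : ℝ) 3) (hθ : 0 < θ) (hs : 0 ≤ s) (ht : 0 ≤ t) :
    (d : ℝ)⁻¹ * (θ ^ (1 - β) / (β - 2) *
        rieszForm (2 - β) (inputWeight κ s) (inputWeight κ t)) =
      ouInitVar d β θ κ + ouSigma d β θ * ouCrossCov d β θ κ s +
        ouSigma d β θ * ouCrossCov d β θ κ t + ouSigma d β θ ^ 2 *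
          (1 / 2 * (t ^ (4 - β) + s ^ (4 - β) - |t - s| ^ (4 - β))) := by
  have hβ2 := hβ.1
  have hβ3 := hβ.2
  have hγ : -1 < 2 - β := by linarith
  have hγ0 : 2 - β ≤ 0 := by linarith
  have hd' : (0 : ℝ) < d := by exact_mod_cast hd
  have hσ2 : ouSigma d β θ ^ 2 = 2 * θ ^ (1 - β) / (d * (β - 2) * (3 - β) * (4 - β)) := by
    rw [ouSigma, Real.sq_sqrt]
    have : 0 < β - 2 := by linarith
    have : 0 < 3 - β := by linarith
    have : 0 < 4 - β := by linarith
    positivity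
  have hσ := ouSigma_pos hd hβ hθ
  have he := isWeight_indicator_exp hκ
  have hI := fun t : ℝ => isWeight_indicator_Ico (0 - t) 0
  have hψ : ∀ t, inputWeight κ t = fun x => (Ici 0).indicator (fun x => Real.exp (-κ * x)) x +
      (Ico (0 - t) 0).indicator 1 x := fun t => funext (inputWeight_eq κ t)
  have hψw := fun t => isWeight_inputWeight hκ t
  have hexp : rieszForm (2 - β) (inputWeight κ s) (inputWeight κ t) =
      rieszForm (2 - β) ((Ici 0).indicator (fun x => Real.exp (-κ * x)))
        ((Ici 0).indicator (fun x => Real.exp (-κ * x))) +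
      rieszForm (2 - β) ((Ico (0 - t) 0).indicator 1)
        ((Ici 0).indicator (fun x => Real.exp (-κ * x))) +
      (rieszForm (2 - β) ((Ico (0 - s) 0).indicator 1)
        ((Ici 0).indicator (fun x => Real.exp (-κ * x))) +
      rieszForm (2 - β) ((Ico (0 - t) 0).indicator 1) ((Ico (0 - s) 0).indicator 1)) := by
    conv_lhs => rw [hψ s]
    rw [rieszForm_add hγ hγ0 he (hI s) (hψw t), rieszForm_comm _ _ (inputWeight κ t),
      rieszForm_comm _ _ (inputWeight κ t), hψ t, rieszForm_add hγ hγ0 he (hI t) he,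
      rieszForm_add hγ hγ0 he (hI t) (hI s),
      rieszForm_comm _ _ ((Ico (0 - s) 0).indicator 1)]
  have h1 : rieszForm (2 - β) ((Ici 0).indicator (fun x => Real.exp (-κ * x)))
        ((Ici 0).indicator (fun x => Real.exp (-κ * x))) =
      ∫ v in Ioi (0 : ℝ), ∫ u in Ioi (0 : ℝ),
        Real.exp (-κ * v) * Real.exp (-κ * u) * |u - v| ^ (2 - β) := by
    rw [rieszForm_eq_iterated hγ hγ0 he he, integral_indicator_Ici_mul]
    refine integral_congr_ae (.of_forall fun v => ?_)
    simp only
    rw [integral_indicator_Ici_mul, ← integral_const_mul]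
    refine integral_congr_ae (.of_forall fun u => ?_)
    simp only
    rw [abs_sub_comm, mul_assoc]
  have h2 : ∀ t, 0 ≤ t → rieszForm (2 - β) ((Ico (0 - t) 0).indicator 1)
        ((Ici 0).indicator (fun x => Real.exp (-κ * x))) =
      ∫ u in (0 : ℝ)..t, ∫ v in Ioi (0 : ℝ), Real.exp (-κ * v) * (u + v) ^ (2 - β) := by
    intro t ht
    rw [rieszForm_eq_iterated hγ hγ0 (hI t) he, integral_indicator_Ico_mul ht]
    refine intervalIntegral.integral_congr fun u hu => ?_
    rw [uIcc_of_le ht] at hu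
    rw [integral_indicator_Ici_mul]
    refine setIntegral_congr_fun measurableSet_Ioi fun v hv => ?_
    rw [show -u - v = -(u + v) by ring, abs_neg, abs_of_nonneg (add_nonneg hu.1 (le_of_lt hv))]
  have h3 := rieszForm_indicator_Ico (γ := 2 - β) hγ hγ0 ht hs 0
  rw [hexp, h1, h2 t ht, h2 s hs, h3, hσ2, ouInitVar, ouCrossCov, ouCrossCov, abs_sub_comm s t,
    show 2 - β + 1 = 3 - β by ring, show 2 - β + 2 = 4 - β by ring]
  have e1 : β - 2 ≠ 0 := by linarith
  have e2 : 3 - β ≠ 0 := by linarith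
  have e3 : 4 - β ≠ 0 := by linarith
  field_simp
  ring

/-! ### The fluid limit in the critical regime -/

lemma meanSession_pos {β θ : ℝ} (hβ : β ∈ Ioo (2 : ℝ) 3) (hθ : 0 < θ) : 0 < meanSession β θ :=
  one_div_pos.2 (mul_pos hθ (by linarith [hβ.1]))

lemma IsAdmissionPolicy.monotone {g : ℝ → ℝ} (hg : IsAdmissionPolicy g) : Monotone g := by
  obtain ⟨l, L, hl, -, h, -⟩ := hg.bounds
  exact monotone_of_deriv_nonneg hg.differentiable fun x => hl.le.trans (h x)

/-- Since the intensity decreases in the workload, the fluid limit sticks to the line `t ↦ a t`. -/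
lemma IsFluidLimit.eq_mul {β θ : ℝ} {g U : ℝ → ℝ} (hβ : β ∈ Ioo (2 : ℝ) 3) (hθ : 0 < θ)
    (hg : IsAdmissionPolicy g) (hU : IsFluidLimit β θ (meanSession β θ) g U) {t : ℝ}
    (ht : 0 ≤ t) : U t = meanSession β θ * t := by
  set a := meanSession β θ with ha
  have hapos : 0 < a := meanSession_pos hβ hθ
  obtain ⟨hU0, hU'⟩ := hU
  have hd : ∀ t ∈ Ici (0 : ℝ), HasDerivWithinAt (fun t => (U t - a * t) ^ 2)
      (2 * (U t - a * t) * (a * intensity g a t (U t) - a)) (Ici 0) t := by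
    intro t ht
    have h1 := ((hU' t ht).sub ((hasDerivWithinAt_id t (Ici 0)).const_mul a)).pow 2
    exact h1.congr_deriv (by simp [← ha])
  have hanti : AntitoneOn (fun t => (U t - a * t) ^ 2) (Ici 0) := by
    refine antitoneOn_of_hasDerivWithinAt_nonpos (convex_Ici 0)
      (fun t ht => (hd t ht).continuousWithinAt)
      (fun t ht => (hd t (interior_subset ht)).mono interior_subset) fun t _ => ?_
    have : (U t - a * t) * (intensity g a t (U t) - 1) ≤ 0 := by
      unfold intensity
      rcases le_total 0 (U t - a * t) with h | h
      · refine mul_nonpos_of_nonneg_of_nonpos h (sub_nonpos.2 (Real.exp_le_one_iff.2 ?_))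
        have := hg.monotone h
        rw [hg.zero] at this
        linarith
      · refine mul_nonpos_of_nonpos_of_nonneg h (sub_nonneg.2 (Real.one_le_exp ?_))
        have := hg.monotone h
        rw [hg.zero] at this
        linarith
    nlinarith
  have h := hanti (mem_Ici.2 le_rfl) (mem_Ici.2 ht) ht
  simp only [hU0, mul_zero, sub_zero] at h
  nlinarith [sq_nonneg (U t - a * t)]

section Fluid

variable {β θ : ℝ} {g U : ℝ → ℝ}

lemma cumIntensity_eq (hβ : β ∈ Ioo (2 : ℝ) 3) (hθ : 0 < θ)
    (hg : IsAdmissionPolicy g) (hU : IsFluidLimit β θ (meanSession β θ) g U) {t : ℝ}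
    (ht : 0 ≤ t) : cumIntensity (meanSession β θ) g U t = t := by
  rw [cumIntensity, intervalIntegral.integral_congr (g := fun _ => (1 : ℝ))]
  · simp
  · intro s hs
    rw [uIcc_of_le ht] at hs
    simp [intensity, hU.eq_mul hβ hθ hg hs.1, hg.zero]

lemma activationTime_eq (hβ : β ∈ Ioo (2 : ℝ) 3) (hθ : 0 < θ)
    (hg : IsAdmissionPolicy g) (hU : IsFluidLimit β θ (meanSession β θ) g U) {s : ℝ}
    (hs : 0 ≤ s) : activationTime (meanSession β θ) g U s = s := by
  have h : ∃ x ∈ Ici (0 : ℝ), cumIntensity (meanSession β θ) g U x = s :=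
    ⟨s, hs, cumIntensity_eq hβ hθ hg hU hs⟩
  have h1 := Function.invFunOn_eq h
  have h2 := Function.invFunOn_mem h
  rwa [cumIntensity_eq hβ hθ hg hU h2] at h1

lemma intensityDy_eq (hβ : β ∈ Ioo (2 : ℝ) 3) (hθ : 0 < θ)
    (hg : IsAdmissionPolicy g) (hU : IsFluidLimit β θ (meanSession β θ) g U) {s : ℝ}
    (hs : 0 ≤ s) : intensityDy g (meanSession β θ) s (U s) = -deriv g 0 := by
  have h0 : U s - meanSession β θ * s = 0 := sub_eq_zero.2 (hU.eq_mul hβ hθ hg hs)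
  have h1 : HasDerivAt g (deriv g 0) (U s - meanSession β θ * s) := by
    rw [h0]
    exact (hg.differentiable 0).hasDerivAt
  have h2 := (h1.comp_sub_const (U s) (meanSession β θ * s)).neg.exp
  rw [intensityDy]
  refine (h2.congr_deriv ?_).deriv
  simp [h0, hg.zero]

lemma ouRate_pos (hβ : β ∈ Ioo (2 : ℝ) 3) (hθ : 0 < θ) (hg : IsAdmissionPolicy g) :
    0 < ouRate β θ g := by
  obtain ⟨l, L, hl, -, h, -⟩ := hg.bounds
  exact mul_pos (meanSession_pos hβ hθ) (hl.trans_le (h 0))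

/-- The integrand of the limit equation in the critical regime. -/
lemma indicator_activeRegion_eq (hβ : β ∈ Ioo (2 : ℝ) 3) (hθ : 0 < θ)
    (hg : IsAdmissionPolicy g) (hU : IsFluidLimit β θ (meanSession β θ) g U) {t : ℝ}
    (ht : 0 ≤ t) :
    ((activeRegion (meanSession β θ) g U t).indicator fun p =>
      min p.2 (t - activationTime (meanSession β θ) g U p.1)) = workKernel t := by
  ext p
  rw [activeRegion, cumIntensity_eq hβ hθ hg hU ht]
  by_cases hp : p ∈ Icc 0 t ×ˢ Ici (0 : ℝ)
  · obtain ⟨⟨h1, h2⟩, h3⟩ := hp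
    rw [mem_Ici] at h3
    rw [indicator_of_mem (show p ∈ Icc 0 t ×ˢ Ici (0 : ℝ) from ⟨⟨h1, h2⟩, h3⟩),
      activationTime_eq hβ hθ hg hU h1, workKernel, if_pos ⟨h1, h3⟩,
      max_eq_right (le_min h3 (by linarith))]
  · rw [indicator_of_notMem hp, workKernel]
    split_ifs with h
    · refine (max_eq_left ((min_le_right _ _).trans ?_)).symm
      by_contra hc
      exact hp ⟨⟨h.1, by linarith⟩, h.2⟩
    · rfl

end Fluid

/-! ### The input of the linear equation -/

/-- The input `y(t) = x(t) + κ ∫₀ᵗ x(s) ds` with solution `x` of the linear equation. -/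
def drivingPath (κ : ℝ) (x : C(ℝ≥0, ℝ)) : C(ℝ≥0, ℝ) where
  toFun t := x t + κ * expConv 0 x t
  continuous_toFun := by
    have := (continuous_expConv 0).comp (by fun_prop :
      Continuous fun t : ℝ≥0 => (x, (t : ℝ)))
    exact x.continuous.add (continuous_const.mul this)

lemma drivingPath_apply (κ : ℝ) (x : C(ℝ≥0, ℝ)) (t : ℝ≥0) :
    drivingPath κ x t = x t + κ * ∫ s in (0 : ℝ)..t, x s.toNNReal := by
  simp [drivingPath, expConv]

lemma continuous_drivingPath (κ : ℝ) : Continuous (drivingPath κ) := by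
  refine ContinuousMap.continuous_of_continuous_uncurry _ ?_
  have := (continuous_expConv 0).comp (by fun_prop :
    Continuous fun q : C(ℝ≥0, ℝ) × ℝ≥0 => (q.1, (q.2 : ℝ)))
  exact continuous_eval.add (continuous_const.mul this)

lemma linearSolution_drivingPath (κ : ℝ) (x : C(ℝ≥0, ℝ)) :
    linearSolution κ (drivingPath κ x) = x :=
  (eq_linearSolution fun t => by rw [drivingPath_apply]; ring).symm

lemma continuous_shiftPath (T : ℝ≥0) : Continuous (shiftPath T) :=
  ContinuousMap.continuous_precomp _

/-- The input of the shifted path. -/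
lemma drivingPath_shiftPath (κ : ℝ) (x : C(ℝ≥0, ℝ)) (T t : ℝ≥0) :
    drivingPath κ (shiftPath T x) t = drivingPath κ x (T + t) +
      ∫ r in (0 : ℝ)..T, -κ * Real.exp (-κ * (T - r)) * drivingPath κ x r.toNNReal := by
  have hc := continuous_comp_toNNReal x
  have h1 : ∫ s in (0 : ℝ)..t, shiftPath T x s.toNNReal =
      ∫ s in (T : ℝ)..(T + t : ℝ), x s.toNNReal := by
    have := intervalIntegral.integral_comp_add_left (a := 0) (b := t)
      (fun s : ℝ => x s.toNNReal) (T : ℝ)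
    rw [add_zero] at this
    rw [← this]
    refine intervalIntegral.integral_congr fun s hs => ?_
    rw [uIcc_of_le t.coe_nonneg] at hs
    simp only [shiftPath, ContinuousMap.comp_apply, ContinuousMap.coe_mk]
    rw [Real.toNNReal_add T.coe_nonneg hs.1, Real.toNNReal_coe]
  have h2 := intervalIntegral.integral_add_adjacent_intervals
    (hc.intervalIntegrable (μ := volume) 0 T) (hc.intervalIntegrable T (T + t : ℝ))
  have h3 : x T = drivingPath κ x T - κ * expConv κ (drivingPath κ x) T := by
    rw [← linearSolution_apply, linearSolution_drivingPath]
  have h4 : ∫ r in (0 : ℝ)..T, -κ * Real.exp (-κ * (T - r)) * drivingPath κ x r.toNNReal =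
      -κ * expConv κ (drivingPath κ x) T := by
    rw [expConv, ← intervalIntegral.integral_const_mul]
    simp only [mul_assoc]
  rw [h4, drivingPath_apply, h1, drivingPath_apply, NNReal.coe_add, ← h2]
  rw [drivingPath_apply κ x T] at h3
  have h5 : shiftPath T x t = x (T + t) := rfl
  rw [h5]
  linarith

/-! ### Centred Gaussian paths -/

/-- The unit mass at `t`; its pairing with a path is the value of the path at `t`. -/
def pointMass (t : ℝ≥0) : ℝ≥0 →₀ ℝ := Finsupp.single t 1

lemma pathPairing_pointMass (x : C(ℝ≥0, ℝ)) (t : ℝ≥0) : pathPairing x (pointMass t) = x t := by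
  simp [pathPairing_apply, pointMass]

/-- The bilinear form `∑ₛ ∑ₜ w(s) w'(t) Γ(s, t)`. -/
def covForm (Γ : ℝ≥0 → ℝ≥0 → ℝ) : (ℝ≥0 →₀ ℝ) →ₗ[ℝ] (ℝ≥0 →₀ ℝ) →ₗ[ℝ] ℝ :=
  Finsupp.linearCombination ℝ fun s => Finsupp.linearCombination ℝ (Γ s)

lemma covForm_apply (Γ : ℝ≥0 → ℝ≥0 → ℝ) (w w' : ℝ≥0 →₀ ℝ) :
    covForm Γ w w' = ∑ s ∈ w.support, ∑ t ∈ w'.support, w s * (w' t * Γ s t) := by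
  simp [covForm, Finsupp.linearCombination_apply, Finsupp.sum, LinearMap.sum_apply, Finset.mul_sum]

lemma covForm_pointMass (Γ : ℝ≥0 → ℝ≥0 → ℝ) (s t : ℝ≥0) :
    covForm Γ (pointMass s) (pointMass t) = Γ s t := by
  simp [covForm, pointMass]

lemma covForm_comm {Γ : ℝ≥0 → ℝ≥0 → ℝ} (hΓ : ∀ s t, Γ s t = Γ t s) (w w' : ℝ≥0 →₀ ℝ) :
    covForm Γ w w' = covForm Γ w' w := by
  rw [covForm_apply, covForm_apply, Finset.sum_comm]
  refine Finset.sum_congr rfl fun s _ => Finset.sum_congr rfl fun t _ => ?_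
  rw [hΓ]
  ring

/-- `Y` is a centred Gaussian process with covariance `Γ`, stated through the laws of the linear
combinations of its values. -/
structure IsCentredGaussianPath {Ω : Type*} [MeasurableSpace Ω] (P : Measure Ω)
    (Γ : ℝ≥0 → ℝ≥0 → ℝ) (Y : Ω → C(ℝ≥0, ℝ)) : Prop where
  aemeasurable : AEMeasurable Y P
  nonneg : ∀ w, 0 ≤ covForm Γ w w
  law : ∀ w, P.map (fun ω => pathPairing (Y ω) w) = gaussianReal 0 (covForm Γ w w).toNNReal

namespace IsCentredGaussianPath

variable {Ω : Type*} [MeasurableSpace Ω] {P : Measure Ω} {Γ : ℝ≥0 → ℝ≥0 → ℝ} {Y : Ω → C(ℝ≥0, ℝ)}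

lemma aemeasurable_pairing (hY : IsCentredGaussianPath P Γ Y) (w : ℝ≥0 →₀ ℝ) :
    AEMeasurable (fun ω => pathPairing (Y ω) w) P :=
  (continuous_pathPairing w).measurable.comp_aemeasurable hY.aemeasurable

lemma integral_exp (hY : IsCentredGaussianPath P Γ Y) (w : ℝ≥0 →₀ ℝ) :
    ∫ x, Complex.exp (pathPairing x w * Complex.I) ∂(P.map Y) =
      Complex.exp (-(covForm Γ w w / 2)) := by
  rw [integral_map hY.aemeasurable (continuous_exp_pathPairing w).aestronglyMeasurable]
  have h := charFun_centred_gaussianReal (hY.nonneg w) 1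
  rw [← hY.law, charFun_apply_real, integral_map (hY.aemeasurable_pairing w)
    (by fun_prop)] at h
  simpa using h

lemma integral_pairing (hY : IsCentredGaussianPath P Γ Y) (w : ℝ≥0 →₀ ℝ) :
    ∫ ω, pathPairing (Y ω) w ∂P = 0 := by
  have h := integral_map (hY.aemeasurable_pairing w) (f := id) aestronglyMeasurable_id
  rw [hY.law] at h
  simpa using h.symm

lemma memLp_pairing (hY : IsCentredGaussianPath P Γ Y) (w : ℝ≥0 →₀ ℝ) :
    MemLp (fun ω => pathPairing (Y ω) w) 2 P := by
  have h : MemLp id 2 (P.map fun ω => pathPairing (Y ω) w) := by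
    rw [hY.law]
    exact memLp_id_gaussianReal' 2 (by norm_num)
  exact (memLp_map_measure_iff aestronglyMeasurable_id (hY.aemeasurable_pairing w)).1 h

lemma variance_pairing (hY : IsCentredGaussianPath P Γ Y) (w : ℝ≥0 →₀ ℝ) :
    Var[fun ω => pathPairing (Y ω) w; P] = covForm Γ w w := by
  have h := variance_map (X := id) aemeasurable_id (hY.aemeasurable_pairing w)
  rw [hY.law, variance_id_gaussianReal, Real.coe_toNNReal _ (hY.nonneg w)] at h
  exact h.symm

/-- Covariances are obtained from variances by polarization. -/
lemma covariance_pairing [IsProbabilityMeasure P] (hY : IsCentredGaussianPath P Γ Y)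
    (hΓ : ∀ s t, Γ s t = Γ t s) (w w' : ℝ≥0 →₀ ℝ) :
    cov[fun ω => pathPairing (Y ω) w, fun ω => pathPairing (Y ω) w'; P] = covForm Γ w w' := by
  have h := variance_add (hY.memLp_pairing w) (hY.memLp_pairing w')
  have e : ((fun ω => pathPairing (Y ω) w) + fun ω => pathPairing (Y ω) w') =
      fun ω => pathPairing (Y ω) (w + w') := by
    ext ω; simp
  rw [e, hY.variance_pairing, hY.variance_pairing, hY.variance_pairing] at h
  simp only [map_add, LinearMap.add_apply] at h
  rw [covForm_comm hΓ w' w] at h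
  linarith

lemma gaussian_pairing [IsProbabilityMeasure P] (hY : IsCentredGaussianPath P Γ Y) {T : Type*}
    (u : T → ℝ≥0 →₀ ℝ) : IsGaussianProcess (fun t ω => pathPairing (Y ω) (u t)) P := by
  refine ⟨fun I => ⟨isGaussian_of_map_eq_gaussianReal fun L => ?_⟩⟩
  have hmeas : AEMeasurable (fun ω => I.restrict fun t => pathPairing (Y ω) (u t)) P :=
    aemeasurable_pi_iff.2 fun t => hY.aemeasurable_pairing _
  classical
  refine ⟨0, (covForm Γ (∑ t : I, L (Pi.single t 1) • u t)
    (∑ t : I, L (Pi.single t 1) • u t)).toNNReal, ?_⟩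
  rw [AEMeasurable.map_map_of_aemeasurable (by fun_prop) hmeas, ← hY.law]
  congr 1
  ext ω
  have : (I.restrict fun t => pathPairing (Y ω) (u t)) =
      ∑ t : I, pathPairing (Y ω) (u t) • (Pi.single t 1 : I → ℝ) := by
    ext t
    simp [Finset.sum_apply, Pi.single_apply]
  rw [Function.comp_apply, this, map_sum, map_sum]
  refine Finset.sum_congr rfl fun t _ => ?_
  rw [map_smul, map_smul, smul_eq_mul, smul_eq_mul, mul_comm]

lemma measure_lt_abs_pairing_le [IsProbabilityMeasure P] (hY : IsCentredGaussianPath P Γ Y)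
    (w : ℝ≥0 →₀ ℝ) {ε : ℝ} (hε : 0 < ε) :
    P.map Y {x | ε < |pathPairing x w|} ≤ ENNReal.ofReal (covForm Γ w w / ε ^ 2) := by
  have hopen : IsOpen {x : C(ℝ≥0, ℝ) | ε < |pathPairing x w|} :=
    isOpen_lt continuous_const (continuous_pathPairing w).abs
  rw [Measure.map_apply_of_aemeasurable hY.aemeasurable hopen.measurableSet, ← hY.variance_pairing]
  refine le_trans (measure_mono fun ω hω => ?_) (meas_ge_le_variance_div_sq (hY.memLp_pairing w) hε)
  rw [mem_ofPred_eq, hY.integral_pairing, sub_zero]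
  exact le_of_lt hω

end IsCentredGaussianPath

/-- Tightness of centred Gaussian paths from bounds on their covariances. -/
lemma isTightMeasureSet_of_covForm {Ω : Type*} [MeasurableSpace Ω] {P : Measure Ω}
    [IsProbabilityMeasure P] {ι : Type*} {Γ : ι → ℝ≥0 → ℝ≥0 → ℝ} {Y : ι → Ω → C(ℝ≥0, ℝ)}
    (hY : ∀ n, IsCentredGaussianPath P (Γ n) (Y n)) {C δ : ℝ} (hC : 0 ≤ C) (hδ : 0 < δ)
    (h0 : ∀ n, Γ n 0 0 ≤ C)
    (h1 : ∀ n s t, covForm (Γ n) (pointMass t - pointMass s)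
      (pointMass t - pointMass s) ≤ C * |(t : ℝ) - s| ^ (1 + δ)) :
    IsTightMeasureSet {μ | ∃ n, P.map (Y n) = μ} := by
  refine isTightMeasureSet_of_increments hC hδ ?_ ?_
  · rintro _ ⟨n, rfl⟩ ε hε
    have h := (hY n).measure_lt_abs_pairing_le (pointMass 0) hε
    simp only [pathPairing_pointMass, covForm_pointMass] at h
    exact h.trans (ENNReal.ofReal_le_ofReal (by gcongr; exact h0 n))
  · rintro _ ⟨n, rfl⟩ s t ε hε
    have h := (hY n).measure_lt_abs_pairing_le (pointMass t - pointMass s) hε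
    rw [map_sub (covForm (Γ n))] at h
    simp only [map_sub (pathPairing _), pathPairing_pointMass] at h
    rw [← map_sub (covForm (Γ n))] at h
    refine h.trans (ENNReal.ofReal_le_ofReal ?_)
    gcongr
    exact h1 n s t

/-! ### The law of the input of the shifted equation -/

/-- The covariance of the input of the equation shifted by `T`. -/
def inputCov (d : ℕ) (β θ κ : ℝ) (T s t : ℝ≥0) : ℝ :=
  (d : ℝ)⁻¹ * ∫ p, inputKernel κ T s p * inputKernel κ T t p ∂controlMeasure β θ

/-- The covariance of `Z₀ + σ B`, the limit of `inputCov` as `T → ∞`. -/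
def ouInputCov (d : ℕ) (β θ κ : ℝ) (s t : ℝ≥0) : ℝ :=
  (d : ℝ)⁻¹ * (θ ^ (1 - β) / (β - 2) * rieszForm (2 - β) (inputWeight κ s) (inputWeight κ t))

lemma ouInputCov_comm (d : ℕ) (β θ κ : ℝ) (s t : ℝ≥0) :
    ouInputCov d β θ κ s t = ouInputCov d β θ κ t s := by
  rw [ouInputCov, rieszForm_comm, ouInputCov]

lemma covForm_inputCov {d : ℕ} {β θ κ : ℝ} (hβ : β ∈ Ioo (2 : ℝ) 3) (hθ : 0 < θ) (hκ : 0 < κ)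
    (T : ℝ≥0) (w : ℝ≥0 →₀ ℝ) :
    covForm (inputCov d β θ κ T) w w = (d : ℝ)⁻¹ *
      ∫ p, (Finsupp.linearCombination ℝ (fun t : ℝ≥0 => inputKernel κ T t p) w) ^ 2
        ∂controlMeasure β θ := by
  have hi : ∀ s t : ℝ≥0, Integrable (fun p => inputKernel κ T s p * inputKernel κ T t p)
      (controlMeasure β θ) := fun s t =>
    integrable_inputKernel_mul hκ hβ hθ T.coe_nonneg s.coe_nonneg t.coe_nonneg
  have e : ∀ p, (Finsupp.linearCombination ℝ (fun t : ℝ≥0 => inputKernel κ T t p) w) ^ 2 =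
      ∑ s ∈ w.support, ∑ t ∈ w.support, w s * w t *
        (inputKernel κ T s p * inputKernel κ T t p) := by
    intro p
    rw [Finsupp.linearCombination_apply, Finsupp.sum, sq, Finset.sum_mul_sum]
    refine Finset.sum_congr rfl fun s _ => Finset.sum_congr rfl fun t _ => ?_
    simp only [smul_eq_mul]
    ring
  simp_rw [e]
  rw [integral_finsetSum _ fun s _ => integrable_finsetSum _ fun t _ => (hi s t).const_mul _,
    covForm_apply, Finset.mul_sum]
  refine Finset.sum_congr rfl fun s _ => ?_
  rw [integral_finsetSum _ fun t _ => (hi s t).const_mul _, Finset.mul_sum]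
  refine Finset.sum_congr rfl fun t _ => ?_
  rw [integral_const_mul, inputCov]
  ring

lemma inputCov_zero_zero_le {d : ℕ} {β θ κ : ℝ} (hβ : β ∈ Ioo (2 : ℝ) 3) (hθ : 0 < θ)
    (hκ : 0 < κ) (T : ℝ≥0) : inputCov d β θ κ T 0 0 ≤ ouInputCov d β θ κ 0 0 := by
  unfold inputCov ouInputCov
  gcongr
  exact integral_inputKernel_mul_le hκ hβ hθ T.coe_nonneg le_rfl le_rfl

lemma ouInputCov_nonneg {d : ℕ} {β θ κ : ℝ} (hβ : β ∈ Ioo (2 : ℝ) 3) (hθ : 0 < θ) (s t : ℝ≥0) :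
    0 ≤ ouInputCov d β θ κ s t :=
  mul_nonneg (by positivity) (mul_nonneg (coeff_nonneg hβ hθ)
    (rieszForm_nonneg (inputWeight_nonneg _ _) (inputWeight_nonneg _ _)))

/-- The time integrals cancel in the increments of the input, which are those of `W`. -/
lemma covForm_inputCov_sub_le {d : ℕ} {β θ κ : ℝ} (hβ : β ∈ Ioo (2 : ℝ) 3) (hθ : 0 < θ)
    (hκ : 0 < κ) (T s t : ℝ≥0) :
    covForm (inputCov d β θ κ T) (pointMass t - pointMass s) (pointMass t - pointMass s) ≤
      (d : ℝ)⁻¹ * (θ ^ (1 - β) / (β - 2) * (2 * |(t : ℝ) - s| ^ (4 - β) /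
        ((3 - β) * (4 - β)))) := by
  rw [covForm_inputCov hβ hθ hκ]
  have h := integral_workKernel_sub_sq_le hβ hθ (T + s) (T + t)
  rw [add_sub_add_left_eq_sub] at h
  gcongr
  refine le_trans (le_of_eq (integral_congr_ae (.of_forall fun p => ?_))) h
  simp [pointMass, inputKernel]

lemma tendsto_covForm_inputCov {d : ℕ} {β θ κ : ℝ} (hβ : β ∈ Ioo (2 : ℝ) 3) (hθ : 0 < θ)
    (hκ : 0 < κ) (w : ℝ≥0 →₀ ℝ) :
    Tendsto (fun T => covForm (inputCov d β θ κ T) w w) atTop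
      (𝓝 (covForm (ouInputCov d β θ κ) w w)) := by
  simp_rw [covForm_apply]
  refine tendsto_finsetSum _ fun s _ => tendsto_finsetSum _ fun t _ =>
    ((Tendsto.const_mul _ ?_).const_mul _)
  exact ((tendsto_integral_inputKernel_mul hκ hβ hθ s.coe_nonneg t.coe_nonneg).comp
    (NNReal.tendsto_coe_atTop.2 tendsto_id)).const_mul _

lemma IsFluctuationLimit.aemeasurable_stationAverage {Ω : Type*} [MeasurableSpace Ω]
    {P : Measure Ω} {d : ℕ} {β θ b : ℝ} {g U : ℝ → ℝ} {M : Fin d → Set (ℝ × ℝ) → Ω → ℝ}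
    {Z : Fin d → Ω → C(ℝ≥0, ℝ)} (hZ : IsFluctuationLimit P β θ b g U M Z) :
    AEMeasurable (stationAverage Z) P := by
  refine aemeasurable_path fun t => ?_
  have : (fun ω => stationAverage Z ω t) = fun ω => (d : ℝ)⁻¹ * ∑ i, Z i ω t := by
    ext ω
    simp [stationAverage]
  rw [this]
  exact (Finset.aemeasurable_fun_sum _ fun i _ => hZ.aemeasurable i t).const_mul _

section Input

variable {Ω : Type*} [MeasurableSpace Ω] {P : Measure Ω} {d : ℕ}
  {β θ : ℝ} {g U : ℝ → ℝ} {M : Fin d → Set (ℝ × ℝ) → Ω → ℝ} {Z : Fin d → Ω → C(ℝ≥0, ℝ)}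

/-- The input of the equation of the station average is the average of the Gaussian integrals. -/
lemma drivingPath_stationAverage_eq (hd : 0 < d) (hβ : β ∈ Ioo (2 : ℝ) 3) (hθ : 0 < θ)
    (hg : IsAdmissionPolicy g) (hU : IsFluidLimit β θ (meanSession β θ) g U)
    (hZ : IsFluctuationLimit P β θ (meanSession β θ) g U M Z) (t : ℝ≥0) :
    ∃ R : Fin d → Ω → ℝ,
      (∀ i, IsGaussianIntegral P (controlMeasure β θ) (M i) (workKernel t) (R i)) ∧
      ∀ᵐ ω ∂P, drivingPath (ouRate β θ g) (stationAverage Z ω) t = (d : ℝ)⁻¹ * ∑ i, R i ω := by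
  choose R hR hae using fun i => hZ.equation i t
  rw [indicator_activeRegion_eq hβ hθ hg hU t.coe_nonneg] at hR
  refine ⟨R, hR, ?_⟩
  filter_upwards [ae_all_iff.2 hae] with ω hω
  have hd' : (d : ℝ) ≠ 0 := by positivity
  have h1 : ∫ s in (0 : ℝ)..t, intensityDy g (meanSession β θ) s (U s) *
      stationAverage Z ω s.toNNReal = -deriv g 0 *
        ∫ s in (0 : ℝ)..t, stationAverage Z ω s.toNNReal := by
    rw [← intervalIntegral.integral_const_mul]
    refine intervalIntegral.integral_congr fun s hs => ?_
    rw [uIcc_of_le t.coe_nonneg] at hs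
    simp only [intensityDy_eq hβ hθ hg hU hs.1]
  have h2 : stationAverage Z ω t = (d : ℝ)⁻¹ * ∑ i, Z i ω t := by simp [stationAverage]
  rw [drivingPath_apply, h2]
  simp_rw [hω, h1, Finset.sum_add_distrib, Finset.sum_const, Finset.card_univ, Fintype.card_fin,
    nsmul_eq_mul]
  rw [ouRate]
  field_simp
  ring

lemma map_sum_drivingPath [IsProbabilityMeasure P] (hd : 0 < d)
    (hβ : β ∈ Ioo (2 : ℝ) 3) (hθ : 0 < θ) (hg : IsAdmissionPolicy g) (hU : IsFluidLimit β θ (meanSession β θ) g U)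
    (hZ : IsFluctuationLimit P β θ (meanSession β θ) g U M Z) {ι : Type} (s : Finset ι)
    (τ : ι → ℝ≥0) (c : ι → ℝ) :
    P.map (fun ω => ∑ j ∈ s, c j * drivingPath (ouRate β θ g) (stationAverage Z ω) (τ j)) =
      gaussianReal 0 ((d : ℝ)⁻¹ *
        ∫ p, (∑ j ∈ s, c j * workKernel (τ j) p) ^ 2 ∂controlMeasure β θ).toNNReal := by
  choose R hR hae using fun j => drivingPath_stationAverage_eq hd hβ hθ hg hU hZ (τ j)
  rw [← map_sum_average_gaussianIntegral hd hZ.gaussian hZ.indep s c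
    (fun j _ => (hR j ⟨0, hd⟩).memLp) fun j _ => hR j]
  refine Measure.map_congr ?_
  filter_upwards [(Finset.eventually_all s).2 fun j _ => hae j] with ω hω
  exact Finset.sum_congr rfl fun j hj => by rw [hω j hj]

lemma sum_mul_add_integral {ι : Type*} (s : Finset ι) (w F : ι → ℝ) (e f : ℝ → ℝ) (T : ℝ) :
    ∑ t ∈ s, w t * (F t + ∫ r in (0 : ℝ)..T, e r * f r) =
      ∑ t ∈ s, w t * F t + ∫ r in (0 : ℝ)..T, (∑ t ∈ s, w t) * e r * f r := by
  simp_rw [mul_add, Finset.sum_add_distrib, ← Finset.sum_mul, mul_assoc,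
    intervalIntegral.integral_const_mul]

/-- The inputs of the shifted equations are centred Gaussian: their linear combinations are linear
combinations of `W` plus a time integral of `W`. -/
theorem isCentredGaussianPath_input [IsProbabilityMeasure P] (hd : 0 < d)
    (hβ : β ∈ Ioo (2 : ℝ) 3) (hθ : 0 < θ) (hg : IsAdmissionPolicy g) (hU : IsFluidLimit β θ (meanSession β θ) g U)
    (hZ : IsFluctuationLimit P β θ (meanSession β θ) g U M Z) (T : ℝ≥0) :
    IsCentredGaussianPath P (inputCov d β θ (ouRate β θ g) T)
      fun ω => drivingPath (ouRate β θ g) (shiftPath T (stationAverage Z ω)) := by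
  set κ := ouRate β θ g with hκ_def
  have hκ : 0 < κ := ouRate_pos hβ hθ hg
  have hW : AEMeasurable (fun ω => drivingPath κ (stationAverage Z ω)) P :=
    (continuous_drivingPath κ).measurable.comp_aemeasurable hZ.aemeasurable_stationAverage
  refine ⟨((continuous_drivingPath κ).comp (continuous_shiftPath T)).measurable.comp_aemeasurable
    hZ.aemeasurable_stationAverage, fun w => ?_, fun w => ?_⟩
  · rw [covForm_inputCov hβ hθ hκ]
    exact mul_nonneg (by positivity) (integral_nonneg fun p => sq_nonneg _)
  -- a time horizon for all values of `W` that occur; `workKernel K` dominates their kernels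
  set K : ℝ≥0 := T + w.support.sup id
  have hG : MemLp (workKernel K) 2 (controlMeasure β θ) := by
    obtain ⟨R, hR, -⟩ := drivingPath_stationAverage_eq hd hβ hθ hg hU hZ K
    exact (hR ⟨0, hd⟩).memLp
  have key := map_sum_add_integral_eq_gaussianReal (P := P) (m := controlMeasure β θ)
    (W := fun ω => drivingPath κ (stationAverage Z ω)) (h := fun t p => workKernel t p)
    (C := (d : ℝ)⁻¹) (by positivity)
    (fun t => (continuous_eval_const t).measurable.comp_aemeasurable hW)
    (fun ι s τ c => map_sum_drivingPath hd hβ hθ hg hU hZ s τ c)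
    (fun t => (measurable_workKernel t).aestronglyMeasurable)
    (fun p => (continuous_workKernel p).comp NNReal.continuous_coe) (K := K) hG
    (fun t ht p => by
      rw [abs_of_nonneg (workKernel_nonneg _ _)]
      exact monotone_workKernel p (NNReal.coe_le_coe.2 ht))
    w.support (fun t => T + t) (fun t ht => add_le_add le_rfl (Finset.le_sup (f := id) ht)) w
    (ρ := fun r => (∑ t ∈ w.support, w t) * (-κ * Real.exp (-κ * (T - r)))) (by fun_prop)
    (T := T) le_self_add
  rw [covForm_inputCov hβ hθ hκ]
  convert key using 2
  · ext ω
    simp_rw [pathPairing_apply, Finsupp.sum, drivingPath_shiftPath]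
    exact sum_mul_add_integral _ _ _ _ _ _
  · congr 2
    refine integral_congr_ae (.of_forall fun p => ?_)
    simp only [Finsupp.linearCombination_apply, Finsupp.sum, smul_eq_mul, inputKernel]
    rw [sum_mul_add_integral]
    congr 2
    refine intervalIntegral.integral_congr fun r hr => ?_
    rw [uIcc_of_le T.coe_nonneg] at hr
    simp only [Real.coe_toNNReal _ hr.1]

lemma isTightMeasureSet_input [IsProbabilityMeasure P] (hd : 0 < d)
    (hβ : β ∈ Ioo (2 : ℝ) 3) (hθ : 0 < θ) (hg : IsAdmissionPolicy g) (hU : IsFluidLimit β θ (meanSession β θ) g U)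
    (hZ : IsFluctuationLimit P β θ (meanSession β θ) g U M Z) :
    IsTightMeasureSet {μ | ∃ T : ℝ≥0, P.map (fun ω =>
      drivingPath (ouRate β θ g) (shiftPath T (stationAverage Z ω))) = μ} := by
  have hκ := ouRate_pos hβ hθ hg
  have hβ2 := hβ.1
  have hβ3 := hβ.2
  set C₁ := ouInputCov d β θ (ouRate β θ g) 0 0
  set C₂ := (d : ℝ)⁻¹ * (θ ^ (1 - β) / (β - 2) * (2 / ((3 - β) * (4 - β))))
  have hC₁ : 0 ≤ C₁ := ouInputCov_nonneg hβ hθ 0 0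
  have hC₂ : 0 ≤ C₂ := mul_nonneg (by positivity) (mul_nonneg (coeff_nonneg hβ hθ)
    (div_nonneg (by norm_num) (mul_nonneg (by linarith) (by linarith))))
  refine isTightMeasureSet_of_covForm (C := C₁ + C₂) (δ := 3 - β)
    (fun T => isCentredGaussianPath_input hd hβ hθ hg hU hZ T) (by positivity) (by linarith)
    (fun T => (inputCov_zero_zero_le hβ hθ hκ T).trans (by linarith)) fun T s t => ?_
  refine (covForm_inputCov_sub_le hβ hθ hκ T s t).trans ?_
  rw [show 1 + (3 - β) = 4 - β by ring]
  have h : 0 ≤ |(t : ℝ) - s| ^ (4 - β) := by positivity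
  calc _ = C₂ * |(t : ℝ) - s| ^ (4 - β) := by ring
    _ ≤ _ := by
      gcongr
      linarith

lemma tendsto_integral_exp_input [IsProbabilityMeasure P] (hd : 0 < d)
    (hβ : β ∈ Ioo (2 : ℝ) 3) (hθ : 0 < θ) (hg : IsAdmissionPolicy g) (hU : IsFluidLimit β θ (meanSession β θ) g U)
    (hZ : IsFluctuationLimit P β θ (meanSession β θ) g U M Z) (w : ℝ≥0 →₀ ℝ) :
    Tendsto (fun T : ℝ≥0 => ∫ x, Complex.exp (pathPairing x w * Complex.I)
      ∂(P.map fun ω => drivingPath (ouRate β θ g) (shiftPath T (stationAverage Z ω)))) atTop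
      (𝓝 (Complex.exp (-(covForm (ouInputCov d β θ (ouRate β θ g)) w w / 2)))) := by
  simp_rw [fun T => (isCentredGaussianPath_input hd hβ hθ hg hU hZ T).integral_exp w]
  have h := tendsto_covForm_inputCov (d := d) hβ hθ (ouRate_pos hβ hθ hg) w
  have hc : Continuous fun v : ℝ => Complex.exp (-((v : ℂ) / 2)) := by fun_prop
  exact (hc.tendsto _).comp h

end Input

/-! ### The data of the fractional Ornstein–Uhlenbeck equation -/

lemma ouInputCov_eq {κ : ℝ} (hκ : 0 < κ) {d : ℕ} (hd : 0 < d) {β θ : ℝ}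
    (hβ : β ∈ Ioo (2 : ℝ) 3) (hθ : 0 < θ) (s t : ℝ≥0) :
    ouInputCov d β θ κ s t = ouInitVar d β θ κ + ouSigma d β θ * ouCrossCov d β θ κ s +
      ouSigma d β θ * ouCrossCov d β θ κ t + ouSigma d β θ ^ 2 *
        (1 / 2 * ((t : ℝ) ^ (4 - β) + (s : ℝ) ^ (4 - β) - |(t : ℝ) - s| ^ (4 - β))) :=
  rieszForm_inputWeight hκ hd hβ hθ s.coe_nonneg t.coe_nonneg

lemma ouCrossCov_zero (d : ℕ) (β θ κ : ℝ) : ouCrossCov d β θ κ 0 = 0 := by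
  simp [ouCrossCov]

/-- The input `Z₀ + σ B` of the fractional Ornstein–Uhlenbeck equation. -/
def ouInput (σ : ℝ) (B : C(ℝ≥0, ℝ)) (z : ℝ) : C(ℝ≥0, ℝ) := ContinuousMap.const _ z + σ • B

lemma ouInput_apply (σ : ℝ) (B : C(ℝ≥0, ℝ)) (z : ℝ) (t : ℝ≥0) :
    ouInput σ B z t = z + σ * B t := by
  simp [ouInput]

/-- The input built from any data of the fractional Ornstein–Uhlenbeck equation has the limit
covariance. -/
theorem IsOUData.isCentredGaussianPath {Ω : Type*} [MeasurableSpace Ω] {P : Measure Ω}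
    [IsProbabilityMeasure P] {d : ℕ} (hd : 0 < d) {β θ κ : ℝ} (hβ : β ∈ Ioo (2 : ℝ) 3)
    (hθ : 0 < θ) (hκ : 0 < κ) {B : Ω → C(ℝ≥0, ℝ)} {Z₀ : Ω → ℝ} (h : IsOUData P d β θ κ B Z₀) :
    IsCentredGaussianPath P (ouInputCov d β θ κ)
      fun ω => ouInput (ouSigma d β θ) (B ω) (Z₀ ω) := by
  set σ := ouSigma d β θ
  have hZ : HasGaussianLaw Z₀ P := h.jointly_gaussian.hasGaussianLaw_eval none
  have hB : ∀ t, HasGaussianLaw (fun ω => B ω t) P := fun t => h.fbm.gaussian.hasGaussianLaw_eval t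
  have hσB : ∀ t, MemLp (fun ω => σ * B ω t) 2 P := fun t => (hB t).memLp_two.const_mul σ
  have hYL : ∀ t, MemLp (fun ω => Z₀ ω + σ * B ω t) 2 P := fun t => hZ.memLp_two.add (hσB t)
  have hcov : ∀ s t, cov[fun ω => Z₀ ω + σ * B ω s, fun ω => Z₀ ω + σ * B ω t; P] =
      ouInputCov d β θ κ s t := by
    intro s t
    have e : ∀ t, (fun ω => Z₀ ω + σ * B ω t) = Z₀ + fun ω => σ * B ω t := fun t => rfl
    rw [e, e, covariance_add_left hZ.memLp_two (hσB s) (e t ▸ hYL t),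
      covariance_add_right hZ.memLp_two hZ.memLp_two (hσB t),
      covariance_add_right (hσB s) hZ.memLp_two (hσB t), covariance_const_mul_left,
      covariance_const_mul_left, covariance_const_mul_right, covariance_const_mul_right,
      covariance_self hZ.aemeasurable, h.init_var, covariance_comm Z₀, h.cross_cov, h.cross_cov,
      h.fbm.covariance, ouInputCov_eq hκ hd hβ hθ, show 2 * ((4 - β) / 2) = 4 - β by ring,
      abs_sub_comm (s : ℝ)]
    ring
  have hpair : ∀ w : ℝ≥0 →₀ ℝ, (fun ω => pathPairing (ouInput σ (B ω) (Z₀ ω)) w) =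
      fun ω => ∑ t ∈ w.support, w t * (Z₀ ω + σ * B ω t) := by
    intro w
    ext ω
    simp only [pathPairing_apply, Finsupp.sum, ouInput_apply]
  have hmean : ∀ w : ℝ≥0 →₀ ℝ, ∫ ω, pathPairing (ouInput σ (B ω) (Z₀ ω)) w ∂P = 0 := by
    intro w
    rw [hpair, integral_finsetSum _ fun t _ => ((hYL t).integrable one_le_two).const_mul _]
    refine Finset.sum_eq_zero fun t _ => ?_
    rw [integral_const_mul, integral_add hZ.integrable ((hB t).integrable.const_mul σ),
      integral_const_mul, h.init_mean, h.fbm.mean_zero]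
    simp
  have hgauss : ∀ w : ℝ≥0 →₀ ℝ,
      HasGaussianLaw (fun ω => pathPairing (ouInput σ (B ω) (Z₀ ω)) w) P := by
    intro w
    classical
    let I : Finset (Option ℝ≥0) := Finset.insertNone w.support
    let L : (I → ℝ) →L[ℝ] ℝ := ∑ t : w.support, w t •
      (ContinuousLinearMap.proj (R := ℝ) (φ := fun _ : I => ℝ) ⟨none, Finset.none_mem_insertNone⟩ +
        σ • ContinuousLinearMap.proj (R := ℝ) (φ := fun _ : I => ℝ)
          ⟨some t, Finset.some_mem_insertNone.2 t.2⟩)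
    have hL := (h.jointly_gaussian.hasGaussianLaw I).map_fun L
    have e : (fun ω => ∑ t ∈ w.support, w t * (Z₀ ω + σ * B ω t)) = fun ω =>
        L (I.restrict fun o : Option ℝ≥0 => o.elim (Z₀ ω) fun t => B ω t) := by
      ext ω
      rw [← Finset.sum_coe_sort]
      simp only [L, sum_apply]
      rfl
    rw [hpair, e]
    exact hL
  have hvar : ∀ w : ℝ≥0 →₀ ℝ, Var[fun ω => pathPairing (ouInput σ (B ω) (Z₀ ω)) w; P] =
      covForm (ouInputCov d β θ κ) w w := by
    intro w
    rw [← covariance_self (hgauss w).aemeasurable, hpair,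
      covariance_fun_sum_fun_sum' (fun t _ => (hYL t).const_mul _)
        (fun t _ => (hYL t).const_mul _), covForm_apply]
    refine Finset.sum_congr rfl fun s _ => Finset.sum_congr rfl fun t _ => ?_
    rw [covariance_const_mul_left, covariance_const_mul_right, hcov]
  refine ⟨aemeasurable_path fun t => ?_, fun w => ?_, fun w => ?_⟩
  · simp_rw [ouInput_apply]
    exact (hYL t).aestronglyMeasurable.aemeasurable
  · rw [← hvar]
    exact variance_nonneg _ _
  · rw [(hgauss w).map_eq_gaussianReal, hmean, hvar]

/-- A centred Gaussian law with the covariance of the limit input splits into the data of the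
fractional Ornstein–Uhlenbeck equation: `Z₀` is the value at `0` and `B = (Y - Y(0)) / σ`. -/
theorem IsCentredGaussianPath.isOUData {μ : Measure C(ℝ≥0, ℝ)} [IsProbabilityMeasure μ] {d : ℕ}
    (hd : 0 < d) {β θ κ : ℝ} (hβ : β ∈ Ioo (2 : ℝ) 3) (hθ : 0 < θ) (hκ : 0 < κ)
    (h : IsCentredGaussianPath μ (ouInputCov d β θ κ) id) :
    IsOUData μ d β θ κ (fun x => (ouSigma d β θ)⁻¹ • (x - ContinuousMap.const _ (x 0)))
      (fun x => x 0) := by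
  set σ := ouSigma d β θ with hσ_def
  have hσ : σ ≠ 0 := (ouSigma_pos hd hβ hθ).ne'
  have hβ4 : 4 - β ≠ 0 := by linarith [hβ.2]
  have hB : ∀ t : ℝ≥0, (fun x : C(ℝ≥0, ℝ) =>
      (σ⁻¹ • (x - ContinuousMap.const ℝ≥0 (x 0)) : C(ℝ≥0, ℝ)) t) =
      fun x => pathPairing (id x) (σ⁻¹ • (pointMass t - pointMass 0)) := by
    intro t
    ext x
    simp [map_sub, map_smul, pathPairing_pointMass]
  have hZ : (fun x : C(ℝ≥0, ℝ) => x 0) = fun x => pathPairing (id x) (pointMass 0) := by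
    ext x
    simp [pathPairing_pointMass]
  have hΓ := ouInputCov_eq hκ hd hβ hθ
  have hcomm := ouInputCov_comm d β θ κ
  constructor
  · constructor
    · have := h.gaussian_pairing fun t : ℝ≥0 => σ⁻¹ • (pointMass t - pointMass 0)
      exact this.congr fun t => .of_forall fun x => (congrFun (hB t) x).symm
    · intro t
      rw [hB]
      exact h.integral_pairing _
    · intro s t
      rw [hB, hB, h.covariance_pairing hcomm]
      simp only [map_smul, map_sub, LinearMap.smul_apply, LinearMap.sub_apply, covForm_pointMass,
        smul_eq_mul, hΓ, ← hσ_def]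
      rw [show 2 * ((4 - β) / 2) = 4 - β by ring, abs_sub_comm (s : ℝ) t]
      simp only [NNReal.coe_zero, ouCrossCov_zero, Real.zero_rpow hβ4, sub_self, sub_zero, zero_sub,
        abs_neg, abs_zero,
        NNReal.abs_eq]
      field_simp
      ring
  · have := h.gaussian_pairing fun o : Option ℝ≥0 =>
      o.elim (pointMass 0) fun t => σ⁻¹ • (pointMass t - pointMass 0)
    refine this.congr fun o => .of_forall fun x => ?_
    rcases o with _ | t
    · exact (congrFun hZ x).symm
    · exact (congrFun (hB t) x).symm
  · rw [hZ]
    exact h.integral_pairing _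
  · rw [hZ, h.variance_pairing, covForm_pointMass, hΓ]
    simp [ouCrossCov_zero, Real.zero_rpow hβ4]
  · intro t
    rw [hZ, hB, h.covariance_pairing hcomm]
    simp only [map_smul, map_sub, LinearMap.smul_apply, LinearMap.sub_apply, covForm_pointMass,
      smul_eq_mul, hΓ, ← hσ_def]
    simp only [NNReal.coe_zero, ouCrossCov_zero, Real.zero_rpow hβ4, sub_self, sub_zero, zero_sub,
        abs_neg, abs_zero,
      NNReal.abs_eq]
    field_simp
    ring

/-- A law on path space is centred Gaussian if the characteristic functions of its marginals are. -/
lemma isCentredGaussianPath_id {μ : Measure C(ℝ≥0, ℝ)} [IsProbabilityMeasure μ]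
    {Γ : ℝ≥0 → ℝ≥0 → ℝ} (hΓ : ∀ w, 0 ≤ covForm Γ w w)
    (h : ∀ w, ∫ x, Complex.exp (pathPairing x w * Complex.I) ∂μ =
      Complex.exp (-(covForm Γ w w / 2))) : IsCentredGaussianPath μ Γ id := by
  refine ⟨aemeasurable_id, hΓ, fun w => ?_⟩
  have hm : AEMeasurable (fun x => pathPairing x w) μ :=
    (continuous_pathPairing w).measurable.aemeasurable
  refine map_eq_gaussianReal_of_charFun hm (hΓ w) fun ξ => ?_
  rw [charFun_apply_real, integral_map hm (by fun_prop)]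
  have := h (ξ • w)
  simp only [map_smul, LinearMap.smul_apply, smul_eq_mul] at this
  push_cast at this
  rw [this]
  congr 2
  ring

lemma shiftPath_shiftPath (h T : ℝ≥0) (x : C(ℝ≥0, ℝ)) :
    shiftPath h (shiftPath T x) = shiftPath (T + h) x := by
  ext t
  simp [shiftPath, add_assoc]

/-- The limit in distribution of the shifts of a path is stationary. -/
lemma isStationaryPath_of_tendsto {Ω Ω' : Type*} [MeasurableSpace Ω] [MeasurableSpace Ω']
    {P : Measure Ω} [IsProbabilityMeasure P] {P' : Measure Ω'} [IsProbabilityMeasure P']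
    {X : Ω → C(ℝ≥0, ℝ)} {Y : Ω' → C(ℝ≥0, ℝ)}
    (h : TendstoInDistribution (fun (T : ℝ≥0) ω => shiftPath T (X ω)) atTop Y (fun _ => P) P') :
    IsStationaryPath P' Y := by
  intro r
  have h1 := h.continuous_comp (continuous_shiftPath r)
  have h2 : TendstoInDistribution (fun (T : ℝ≥0) ω => shiftPath (T + r) (X ω)) atTop Y
      (fun _ => P) P' :=
    ⟨fun T => h.forall_aemeasurable (T + r), h.aemeasurable_limit,
      h.tendsto.comp (tendsto_atTop_mono (fun _ => le_self_add) tendsto_id)⟩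
  have e : (fun T : ℝ≥0 => shiftPath r ∘ fun ω => shiftPath T (X ω)) =
      fun (T : ℝ≥0) ω => shiftPath (T + r) (X ω) := by
    ext1 T
    ext1 ω
    exact shiftPath_shiftPath r T (X ω)
  rw [e] at h1
  exact ⟨h1.aemeasurable_limit, h.aemeasurable_limit, tendstoInDistribution_unique _ h1 h2⟩

end

theorem theorem2p4 {Ω : Type*} [MeasurableSpace Ω] (P : Measure Ω) [IsProbabilityMeasure P]
    (d : ℕ) (hd : 0 < d) (β θ : ℝ) (hβ : β ∈ Ioo (2 : ℝ) 3) (hθ : 0 < θ)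
    (b : ℝ) (hb : b = meanSession β θ)
    (g : ℝ → ℝ) (hg : IsAdmissionPolicy g)
    (U : ℝ → ℝ) (hU : IsFluidLimit β θ b g U)
    (M : Fin d → Set (ℝ × ℝ) → Ω → ℝ) (Z : Fin d → Ω → C(ℝ≥0, ℝ))
    (hZ : IsFluctuationLimit P β θ b g U M Z) :
    -- the initial variance is finite
    IntegrableOn (fun p : ℝ × ℝ => Real.exp (-ouRate β θ g * p.1) *
      Real.exp (-ouRate β θ g * p.2) * |p.2 - p.1| ^ (2 - β)) (Ioi 0 ×ˢ Ioi 0) ∧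
    -- the data of the fractional Ornstein–Uhlenbeck equation exist
    (∃ (Ω' : Type) (_ : MeasurableSpace Ω') (P' : Measure Ω') (_ : IsProbabilityMeasure P')
      (B : Ω' → C(ℝ≥0, ℝ)) (Z₀ : Ω' → ℝ), IsOUData P' d β θ (ouRate β θ g) B Z₀) ∧
    -- for all such data: unique solvability, convergence to the solution, and its stationarity
    ∀ (Ω' : Type*) [MeasurableSpace Ω'] (P' : Measure Ω') [IsProbabilityMeasure P']
      (B : Ω' → C(ℝ≥0, ℝ)) (Z₀ : Ω' → ℝ), IsOUData P' d β θ (ouRate β θ g) B Z₀ →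
      ∃ Zinf : Ω' → C(ℝ≥0, ℝ),
        IsOUSolution P' (ouRate β θ g) (ouSigma d β θ) B Z₀ Zinf ∧
        (∀ X, IsOUSolution P' (ouRate β θ g) (ouSigma d β θ) B Z₀ X → X =ᵐ[P'] Zinf) ∧
        TendstoInDistribution (fun (T : ℝ≥0) ω => shiftPath T (stationAverage Z ω)) atTop
          Zinf (fun _ => P) P' ∧
        IsStationaryPath P' Zinf := by
  subst hb
  have hκ := ouRate_pos hβ hθ hg
  have hY := isCentredGaussianPath_input hd hβ hθ hg hU hZ
  set κ := ouRate β θ g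
  let μ : ℝ≥0 → ProbabilityMeasure C(ℝ≥0, ℝ) := fun T =>
    ⟨P.map fun ω => drivingPath κ (shiftPath T (stationAverage Z ω)),
      Measure.isProbabilityMeasure_map (hY T).aemeasurable⟩
  have htight : IsTightMeasureSet {(μ T : Measure C(ℝ≥0, ℝ)) | T} :=
    isTightMeasureSet_input hd hβ hθ hg hU hZ
  have hchar := tendsto_integral_exp_input hd hβ hθ hg hU hZ
  refine ⟨integrableOn_exp_mul_exp_mul_abs_sub hκ (by linarith [hβ.2]) (by linarith [hβ.1]), ?_, ?_⟩
  · obtain ⟨μ₀, hμ₀⟩ := exists_law_of_tight_of_tendsto_charFun htight hchar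
    have hnn : ∀ w, 0 ≤ covForm (ouInputCov d β θ κ) w w := fun w =>
      ge_of_tendsto' (tendsto_covForm_inputCov hβ hθ hκ w) fun T => (hY T).nonneg w
    exact ⟨C(ℝ≥0, ℝ), inferInstance, μ₀, inferInstance, _, _,
      (isCentredGaussianPath_id hnn hμ₀).isOUData hd hβ hθ hκ⟩
  intro Ω' _ P' _ B Z₀ hdata
  have hlim := hdata.isCentredGaussianPath hd hβ hθ hκ
  set σ := ouSigma d β θ
  have hconv : TendstoInDistribution
      (fun (T : ℝ≥0) ω => drivingPath κ (shiftPath T (stationAverage Z ω))) atTop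
      (fun ω => ouInput σ (B ω) (Z₀ ω)) (fun _ => P) P' := by
    refine ⟨fun T => (hY T).aemeasurable, hlim.aemeasurable, ?_⟩
    refine tendsto_of_tight_of_tendsto_charFun (μ := μ) htight fun w => ?_
    have := hchar w
    rwa [← hlim.integral_exp w] at this
  have hconv' := hconv.continuous_comp (continuous_linearSolution κ)
  have e : (fun T : ℝ≥0 => linearSolution κ ∘ fun ω =>
      drivingPath κ (shiftPath T (stationAverage Z ω))) =
      fun (T : ℝ≥0) ω => shiftPath T (stationAverage Z ω) := by
    ext1 T
    ext1 ω
    exact linearSolution_drivingPath κ _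
  rw [e] at hconv'
  refine ⟨linearSolution κ ∘ fun ω => ouInput σ (B ω) (Z₀ ω), .of_forall fun ω t => ?_,
    fun X hX => ?_, hconv', isStationaryPath_of_tendsto hconv'⟩
  · simp only [Function.comp_apply]
    rw [linearSolution_eq κ _ t, ouInput_apply]
    ring
  · filter_upwards [hX] with ω hω
    refine eq_linearSolution fun t => ?_
    rw [hω t, ouInput_apply]
    ring
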